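/- For $h>0$ let $\Omega_h=\{x\in\mathbb R^3:|x_3|<h\}$. For an integer $k$, let $\mathcal A(\Omega_h,k)$ be the set of conformal minimal immersions $\mathbf X:A_{R_0,R_1}=\{R_0<|z|<R_1\}\to\Omega_h$ ($0<R_0<R_1$) that are proper as maps into $\Omega_h$, whose image $\Sigma$ spans the two planes $\{x_3=\pm h\}$ (that is, $\overline\Sigma\setminus\Sigma\subset\partial\Omega_h$ and $\overline\Sigma$ meets both planes), and whose Gauss map $g=\phi_3/(\phi_1-i\phi_2)$, $\phi_k=\partial_xX_k-i\partial_yX_k$, takes values in $\mathbb C\setminus\{0\}$ and has winding number $k$ on the circles $|z|=r$. A figure eight is a smooth regular closed plane curve with exactly one self-intersection, which is a transverse double point, and with turning number zero. There is a constant $\kappa>0$ such that for all $h>0$ and $F_3>0$ with $h<\kappa F_3$ there is an annulus $\mathbf X\in\mathcal A(\Omega_h,0)$ with flux $(0,0,F_3)$ and the following properties. 1. For every $\eta\in(-h,h)$ the set $\{z\in A_{R_0,R_1}:X_3(z)=\eta\}$ is a circle $\{|z|=r_\eta\}$, and its image, the level curve $\Sigma_\eta$, is a figure eight in the plane $\{x_3=\eta\}$.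 The length $\ell(\eta)$ of $\Sigma_\eta$ is a $C^2$ function on $(-h,h)$ and $$2\Big(\frac{2\pi}{F_3}\Big)^2\ell(\eta)<\ell''(\eta)<4\Big(\frac{2\pi}{F_3}\Big)^2\ell(\eta)\qquad(|\eta|<h).$$ In particular (the case $F_3=2\pi$), every sufficiently thin slab $\Omega_h$ carries such an annulus with $2\ell<\ell''<4\ell$; and every slab, however thick, carries such an annulus for every sufficiently large $F_3$. 2. $\mathbf X$ is part of a complete minimal surface: there are nonzero complex numbers $a_{-1},a_0,a_1,b_{-1},b_0,b_1$ with $a_0^2+2a_{-1}a_1=0$ and $b_0^2+2b_{-1}b_1=0$ and a conformal minimal immersion $\mathbf Y:\mathbb C\setminus\{0\}\to\mathbb R^3$ such that, with $G_-(z)=a_{-1}z^{-1}+a_0+a_1z$ and $G_+(z)=b_{-1}z^{-1}+b_0+b_1z$, $$\partial_x\mathbf Y-i\,\partial_y\mathbf Y=\frac1z\Big(\tfrac12(G_-^2-G_+^2),\ \tfrac i2(G_-^2+G_+^2),\ G_-G_+\Big),$$ and $\mathbf X=\mathbf Y\circ T$ on $A_{R_0,R_1}$ for some injective holomorphic map $T:A_{R_0,R_1}\to\mathbb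 C\setminus\{0\}$. The surface $\mathbf Y$ is complete, has total curvature $-8\pi$, and has exactly two ends, at $0$ and at $\infty$, each of multiplicity two (outside a compact set, the orthogonal projection of the end to a suitable plane is a two-sheeted cover). -/

import Mathlib

open scoped ContDiff

noncomputable section

namespace MinimalAnnuli

/-- Euclidean three-space; the coordinates `x₁, x₂, x₃` are `p 0, p 1, p 2`. -/
abbrev E3 := EuclideanSpace ℝ (Fin 3)

/-- The open planar annulus `A_{R₀,R₁}`. -/
def annulus (R₀ R₁ : ℝ) : Set ℂ := {z | R₀ < ‖z‖ ∧ ‖z‖ < R₁}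

/-- The open horizontal slab between the planes `{x₃ = a}` and `{x₃ = b}`. -/
def slab (a b : ℝ) : Set E3 := {p | a < p 2 ∧ p 2 < b}

/-- A conformal harmonic (hence minimal) immersion on the plane domain `D`. -/
structure IsConformalMinimalImmersion (X : ℂ → E3) (D : Set ℂ) : Prop where
  harmonic : InnerProductSpace.HarmonicOnNhd X D
  norm_eq : ∀ z ∈ D, ‖fderiv ℝ X z 1‖ = ‖fderiv ℝ X z Complex.I‖
  orthogonal : ∀ z ∈ D, inner ℝ (fderiv ℝ X z 1) (fderiv ℝ X z Complex.I) = 0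
  immersion : ∀ z ∈ D, fderiv ℝ X z 1 ≠ 0

/-- The functions `φ_k = ∂X_k/∂x - i ∂X_k/∂y`. -/
def phi (X : ℂ → E3) (k : Fin 3) (z : ℂ) : ℂ :=
  ((fderiv ℝ X z 1 k : ℝ) : ℂ) - Complex.I * ((fderiv ℝ X z Complex.I k : ℝ) : ℂ)

/-- The Gauss map `g = φ₃ / (φ₁ - i φ₂)`, read through stereographic projection
(at points where the denominator does not vanish). -/
def gaussMap (X : ℂ → E3) (z : ℂ) : ℂ :=
  phi X 2 z / (phi X 0 z - Complex.I * phi X 1 z)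

/-- `X`, on `A_{R₀,R₁}`, is a minimal annulus in the slab between `{x₃ = a}` and `{x₃ = b}` that
spans these two planes: a conformal minimal immersion, proper as a map into the open slab, whose
image `Σ` satisfies `closure Σ \ Σ ⊆ {x₃ = a} ∪ {x₃ = b}` and reaches both planes. -/
structure IsMinimalAnnulus (a b R₀ R₁ : ℝ) (X : ℂ → E3) : Prop where
  radii : 0 < R₀ ∧ R₀ < R₁
  minimal : IsConformalMinimalImmersion X (annulus R₀ R₁)
  mapsTo : Set.MapsTo X (annulus R₀ R₁) (slab a b)
  proper : ∀ K : Set E3, IsCompact K → K ⊆ slab a b → IsCompact (annulus R₀ R₁ ∩ X ⁻¹' K)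
  boundary : closure (X '' annulus R₀ R₁) \ (X '' annulus R₀ R₁) ⊆ {p | p 2 = a ∨ p 2 = b}
  spans_lower : (closure (X '' annulus R₀ R₁) ∩ {p | p 2 = a}).Nonempty
  spans_upper : (closure (X '' annulus R₀ R₁) ∩ {p | p 2 = b}).Nonempty

/-- The Gauss map of `X` on `A_{R₀,R₁}` takes values in `ℂ \ {0}` and has winding number `k`. -/
structure HasWindingNumber (R₀ R₁ : ℝ) (X : ℂ → E3) (k : ℤ) : Prop where
  ne_infty : ∀ z ∈ annulus R₀ R₁, phi X 0 z - Complex.I * phi X 1 z ≠ 0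
  ne_zero : ∀ z ∈ annulus R₀ R₁, gaussMap X z ≠ 0
  winding : ∀ r ∈ Set.Ioo R₀ R₁,
    (2 * Real.pi * Complex.I : ℂ)⁻¹ * (∮ z in C(0, r), logDeriv (gaussMap X) z) = k

/-- The velocity of `θ ↦ X (r e^{iθ})`. -/
def angularVelocity (X : ℂ → E3) (r θ : ℝ) : E3 :=
  fderiv ℝ X (circleMap 0 r θ) (circleMap 0 r θ * Complex.I)

/-- The outward unit conormal along `θ ↦ X (r e^{iθ})` of a conformal immersion: since `X` is
conformal, the radial derivative is tangent to the surface and orthogonal to the curve. -/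
def conormal (X : ℂ → E3) (r θ : ℝ) : E3 :=
  ‖fderiv ℝ X (circleMap 0 r θ) (circleMap 0 1 θ)‖⁻¹ •
    fderiv ℝ X (circleMap 0 r θ) (circleMap 0 1 θ)

/-- `L(r)`, the length of the image of the circle `|z| = r`. -/
def circleLength (X : ℂ → E3) (r : ℝ) : ℝ :=
  ∫ θ in (0 : ℝ)..(2 * Real.pi), ‖angularVelocity X r θ‖

/-- The flux `∫ ν ds` over the image of the circle `|z| = r`. -/
def flux (X : ℂ → E3) (r : ℝ) : E3 :=
  ∫ θ in (0 : ℝ)..(2 * Real.pi), ‖angularVelocity X r θ‖ • conormal X r θ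

/-- The horizontal projection `x₁ + i x₂` of `θ ↦ X (r e^{iθ})`. -/
def horizontalCurve (X : ℂ → E3) (r θ : ℝ) : ℂ :=
  (X (circleMap 0 r θ) 0 : ℂ) + Complex.I * (X (circleMap 0 r θ) 1 : ℂ)

/-- A figure eight: a smooth regular closed plane curve (of period `2π`) with exactly one
self-intersection, this being a transverse double point, and with turning number zero (the unit
tangent has a continuous periodic angle function). -/
structure IsFigureEight (γ : ℝ → ℂ) : Prop where
  smooth : ContDiff ℝ ∞ γ
  periodic : Function.Periodic γ (2 * Real.pi)
  regular : ∀ θ, deriv γ θ ≠ 0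
  double_point : ∃ s t : ℝ, s < t ∧ t < s + 2 * Real.pi ∧ γ s = γ t ∧
    LinearIndependent ℝ ![deriv γ s, deriv γ t] ∧
    ∀ p ∈ Set.Ico s (s + 2 * Real.pi), ∀ q ∈ Set.Ico s (s + 2 * Real.pi),
      p < q → γ p = γ q → p = s ∧ q = t
  turning : ∃ α : ℝ → ℝ, Continuous α ∧ Function.Periodic α (2 * Real.pi) ∧
    ∀ θ, deriv γ θ = (‖deriv γ θ‖ : ℂ) * Complex.exp (Complex.I * (α θ : ℂ))

/-- The metric induced by `Y` on the open set `D` is complete: every `C¹` path in `D` that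
eventually leaves every compact subset of `D` has infinite length. -/
def IsCompleteOn (Y : ℂ → E3) (D : Set ℂ) : Prop :=
  ∀ γ : ℝ → ℂ, ContDiffOn ℝ 1 γ (Set.Ici 0) → (∀ t ∈ Set.Ici (0 : ℝ), γ t ∈ D) →
    (∀ K : Set ℂ, IsCompact K → K ⊆ D → ∀ᶠ t in Filter.atTop, γ t ∉ K) →
    ∫⁻ t in Set.Ioi (0 : ℝ), ‖fderiv ℝ Y (γ t) (deriv γ t)‖ₑ = ⊤

/-- The Gaussian curvature `-Δ(log λ)/λ²` of the metric `λ² |dz|²`, `λ = ‖∂Y/∂x‖`, induced by a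
conformal immersion `Y`. -/
def gaussCurvature (Y : ℂ → E3) (z : ℂ) : ℝ :=
  -(Laplacian.laplacian (fun w : ℂ => Real.log ‖fderiv ℝ Y w 1‖) z) / ‖fderiv ℝ Y z 1‖ ^ 2

/-- The conformal immersion `Y` of `D` has finite total curvature `∫ K dA = c`, where
`dA = λ² dx dy`. -/
def HasTotalCurvature (Y : ℂ → E3) (D : Set ℂ) (c : ℝ) : Prop :=
  MeasureTheory.IntegrableOn (fun z => gaussCurvature Y z * ‖fderiv ℝ Y z 1‖ ^ 2) D ∧
    ∫ z in D, gaussCurvature Y z * ‖fderiv ℝ Y z 1‖ ^ 2 = c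

/-- The end of `Y` along the filter `l` (the punctured neighbourhoods of a puncture) has
multiplicity `m`: the orthogonal projection of the end to some plane (spanned by the orthonormal
pair `e`) is proper and covers the outside of a compact set with exactly `m` sheets. -/
def HasEndOfMultiplicity (Y : ℂ → E3) (l : Filter ℂ) (m : ℕ) : Prop :=
  ∃ e : Fin 2 → E3, Orthonormal ℝ e ∧
    Filter.Tendsto (fun z => inner ℝ (e 0) (Y z) ^ 2 + inner ℝ (e 1) (Y z) ^ 2) l Filter.atTop ∧
    ∃ U ∈ l, ∀ V ∈ l, V ⊆ U → ∃ R : ℝ, ∀ a b : ℝ, R < a ^ 2 + b ^ 2 →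
      {z ∈ V | inner ℝ (e 0) (Y z) = a ∧ inner ℝ (e 1) (Y z) = b}.encard = m

/-- The Laurent polynomial `c₋₁ z⁻¹ + c₀ + c₁ z`, with coefficients `c 0 = c₋₁`, `c 1 = c₀`,
`c 2 = c₁`. -/
def trinomial (c : Fin 3 → ℂ) (z : ℂ) : ℂ := c 0 * z⁻¹ + c 1 + c 2 * z

/-- On `ℂ \ {0}`, `Y` has the Weierstrass data `ψ₃/g = G₋²`, `ψ₃ g = G₊²`, where `ψ₃ = z φ₃`
(equivalently `g = G₊/G₋` and height differential `G₋ G₊ dz / z`). -/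
def HasWeierstrassData (Y : ℂ → E3) (Gm Gp : ℂ → ℂ) : Prop :=
  ∀ z : ℂ, z ≠ 0 →
    phi Y 0 z = 1 / 2 * z⁻¹ * (Gm z ^ 2 - Gp z ^ 2) ∧
    phi Y 1 z = Complex.I / 2 * z⁻¹ * (Gm z ^ 2 + Gp z ^ 2) ∧
    phi Y 2 z = z⁻¹ * Gm z * Gp z

end MinimalAnnuli

end

/-!
The annulus and the complete surface are explicit. With `q = w - w⁻¹` the surface `surf c` has the
Laurent polynomials `G₋ = √c (√2 + q)` and `G₊ = √c (√2 - q)`, and it integrates to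
`x₁ = 2√2 c Re (w + w⁻¹)`, `x₂ = - c Im (w² - w⁻²) / 2`, `x₃ = c (4 log |w| - Re (w² - w⁻²) / 2)`.

*The complete surface.* Its metric is `c (2 + |q|²) |dw| / |w| ≥ 2 c |dw| / |w|`, which gives
completeness (`surf_isCompleteOn`). The curvature form is minus the pull-back by `q` of the area form
of a sphere. The map `q` is injective on `|w| > 1` and on `0 < |w| < 1`, with images of full measure,
so the total curvature is twice `-4π` (`surf_hasTotalCurvature`). In `s = w²` the projection to the
`x₃`-`x₂`-plane is, up to a factor, `s - s⁻¹ - 4 log |s|`. Far out this is the identity minus a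
contraction, hence a bijection of neighbourhoods of infinity, and `w ↦ w²` makes two sheets
(`surf_hasEnd_cobounded`, `surf_hasEnd_zero`).

*The annulus.* With `w = e^ζ` the height is `4 c Re (ζ - sinh (2ζ) / 4)`. On `|Re ζ| ≤ 1/2` the
function in brackets is the identity minus a contraction, so it has a holomorphic inverse `logInv` on
`|Re τ| < 1/10`. In the parameter `z = e^τ` the surface is the annulus `ann c`, of height
`4 c log |z|`, and its level curves are the circles `|z| = e^t`. The Gauss map has a single-valued
logarithm `logGauss` there, so its winding number is zero, and the vertical flux is `8 π c`.

*Figure eights.* The circle `|w| = 1` goes to the Lissajous curve `(4√2 c cos φ, - c sin 2φ)`. The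
nearby level curves have the same symmetry under reflection in the `x₁`-axis, and on the upper half
circle their first coordinate is still strictly monotone. So two parameters with the same image are
opposite, and the second coordinate vanishes there, which leaves `±π/2` (`ann_isFigureEight`).

*The length.* The tangent has length `4 c cosh u`, where `u = log |g|` is harmonic in `τ = t + iθ`.
Integration by parts in `θ` shows that `∫ cosh u dθ` has the second derivative `∫ cosh u |∇u|² dθ` in
`t` (`integral_second_derivative`). For `t = 0` one has `u = 0`, so the first integral is `2π`, while
the second is `40π / (3√3)`, strictly between `4π` and `8π` (`four_pi_lt_normLength₂_zero`,
`normLength₂_zero_lt`). By continuity the estimate persists for small `t`, that is, for `h / c` and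
hence `h / F₃` small.
-/

noncomputable section

namespace MinimalAnnuli

open Complex Filter Topology

/-! ### The complexified height in the logarithmic coordinate -/

/-- In the coordinate `w = e^ζ`, the holomorphic function whose real part is a quarter of the height
`4 log |w| - Re (w² - w⁻²) / 2`. -/
def logHeight (ζ : ℂ) : ℂ := ζ - sinh (2 * ζ) / 4

/-- The closed vertical strip on which `logHeight` is a perturbation of the identity by a
contraction. -/
def strip : Set ℂ := {ζ | |ζ.re| ≤ 1 / 2}

lemma cosh_one_lt_two : Real.cosh 1 < 2 := by
  rw [Real.cosh_eq]
  have h1 := Real.exp_one_lt_d9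
  have h2 : Real.exp (-1) < 1 := Real.exp_lt_one_iff.2 (by norm_num)
  linarith

lemma sinh_one_lt : Real.sinh 1 < 7 / 5 := by
  rw [Real.sinh_eq]
  have h1 := Real.exp_one_lt_d9
  have h2 : 0 < Real.exp (-1) := Real.exp_pos _
  linarith

lemma norm_cosh_le (z : ℂ) : ‖cosh z‖ ≤ Real.cosh z.re := by
  rw [Complex.cosh, Real.cosh_eq, norm_div]
  have := norm_add_le (exp z) (exp (-z))
  rw [Complex.norm_exp, Complex.norm_exp, neg_re] at this
  simp only [Complex.norm_ofNat]
  linarith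

lemma cosh_two_mul_re_lt {ζ : ℂ} (h : ζ ∈ strip) : Real.cosh (2 * ζ.re) < 2 := by
  refine lt_of_le_of_lt ?_ cosh_one_lt_two
  have h' : |ζ.re| ≤ 1 / 2 := h
  rw [Real.cosh_le_cosh, abs_mul, abs_one]
  norm_num
  linarith

lemma norm_cosh_two_mul_le {ζ : ℂ} (h : ζ ∈ strip) : ‖cosh (2 * ζ)‖ ≤ Real.cosh 1 := by
  refine (norm_cosh_le _).trans ?_
  have h' : |ζ.re| ≤ 1 / 2 := h
  rw [Real.cosh_le_cosh, abs_one]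
  simp [abs_mul]
  linarith

lemma convex_strip : Convex ℝ strip := by
  have : strip = Complex.reLm ⁻¹' Set.Icc (-(1 / 2)) (1 / 2) := by
    ext z
    simp [strip, abs_le]
  rw [this]
  exact (convex_Icc _ _).linear_preimage _

lemma isClosed_strip : IsClosed strip :=
  isClosed_le (continuous_abs.comp continuous_re) continuous_const

lemma hasDerivAt_sinh_two_mul_div_four (ζ : ℂ) :
    HasDerivAt (fun ζ : ℂ => sinh (2 * ζ) / 4) (cosh (2 * ζ) / 2) ζ := by
  have := ((hasDerivAt_id ζ).const_mul (2 : ℂ)).csinh.div_const 4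
  convert! this using 1
  simp only [id]
  ring

lemma norm_sinh_sub_le {ζ ξ : ℂ} (hζ : ζ ∈ strip) (hξ : ξ ∈ strip) :
    ‖sinh (2 * ζ) / 4 - sinh (2 * ξ) / 4‖ ≤ Real.cosh 1 / 2 * ‖ζ - ξ‖ := by
  refine convex_strip.norm_image_sub_le_of_norm_hasDerivWithin_le (𝕜 := ℂ)
    (f := fun ζ : ℂ => sinh (2 * ζ) / 4)
    (fun x _ => (hasDerivAt_sinh_two_mul_div_four x).hasDerivWithinAt) (fun x hx => ?_) hξ hζ
  rw [norm_div, Complex.norm_ofNat]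
  linarith [norm_cosh_two_mul_le hx]

lemma hasDerivAt_logHeight (ζ : ℂ) : HasDerivAt logHeight (1 - cosh (2 * ζ) / 2) ζ :=
  (hasDerivAt_id ζ).sub (hasDerivAt_sinh_two_mul_div_four ζ)

lemma one_sub_cosh_ne_zero {ζ : ℂ} (h : ζ ∈ strip) : 1 - cosh (2 * ζ) / 2 ≠ 0 := by
  intro h0
  have h1 : cosh (2 * ζ) = 2 := by linear_combination (-2) * h0
  have := norm_cosh_two_mul_le h
  rw [h1, Complex.norm_ofNat] at this
  linarith [cosh_one_lt_two]

/-- On the strip `logHeight` shrinks distances at most by the factor `1 - cosh 1 / 2`, which is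
positive. -/
lemma norm_sub_le_of_strip {ζ ξ : ℂ} (hζ : ζ ∈ strip) (hξ : ξ ∈ strip) :
    (1 - Real.cosh 1 / 2) * ‖ζ - ξ‖ ≤ ‖logHeight ζ - logHeight ξ‖ := by
  have h1 := norm_sinh_sub_le hζ hξ
  have h2 : ζ - ξ = (logHeight ζ - logHeight ξ) + (sinh (2 * ζ) / 4 - sinh (2 * ξ) / 4) := by
    simp only [logHeight]; ring
  have h3 : ‖ζ - ξ‖ ≤ ‖logHeight ζ - logHeight ξ‖ + ‖sinh (2 * ζ) / 4 - sinh (2 * ξ) / 4‖ := by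
    conv_lhs => rw [h2]
    exact norm_add_le _ _
  linarith

lemma injOn_logHeight : Set.InjOn logHeight strip := by
  intro ζ hζ ξ hξ h
  have := norm_sub_le_of_strip hζ hξ
  rw [h, sub_self, norm_zero] at this
  have h2 : 0 < 1 - Real.cosh 1 / 2 := by linarith [cosh_one_lt_two]
  have h3 : ‖ζ - ξ‖ ≤ 0 := by
    by_contra! h4
    have := mul_pos h2 h4
    linarith
  exact sub_eq_zero.1 (norm_le_zero_iff.1 h3)

lemma re_sinh_two_mul (ζ : ℂ) :
    (sinh (2 * ζ)).re = Real.sinh (2 * ζ.re) * Real.cos (2 * ζ.im) := by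
  have : (2 * ζ) = ((2 * ζ.re : ℝ) : ℂ) + ((2 * ζ.im : ℝ) : ℂ) * I := by
    apply Complex.ext <;> simp
  rw [this, Complex.sinh_add, Complex.sinh_mul_I, Complex.cosh_mul_I]
  simp [← Complex.ofReal_sinh, ← Complex.ofReal_cosh, ← Complex.ofReal_sin, ← Complex.ofReal_cos,
    -Complex.ofReal_mul]

lemma im_sinh_two_mul (ζ : ℂ) :
    (sinh (2 * ζ)).im = Real.cosh (2 * ζ.re) * Real.sin (2 * ζ.im) := by
  have : (2 * ζ) = ((2 * ζ.re : ℝ) : ℂ) + ((2 * ζ.im : ℝ) : ℂ) * I := by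
    apply Complex.ext <;> simp
  rw [this, Complex.sinh_add, Complex.sinh_mul_I, Complex.cosh_mul_I]
  simp [← Complex.ofReal_sinh, ← Complex.ofReal_cosh, ← Complex.ofReal_sin, ← Complex.ofReal_cos,
    -Complex.ofReal_mul]

/-- The equation `ζ - sinh (2ζ) / 4 = τ` is solved by Banach's fixed point theorem. -/
lemma exists_logHeight_eq {τ : ℂ} (hτ : |τ.re| ≤ 1 / 10) : ∃ ζ ∈ strip, logHeight ζ = τ := by
  set f : ℂ → ℂ := fun ζ => τ + sinh (2 * ζ) / 4 with hf
  -- the strip is invariant: `1/10 + sinh 1 / 4 ≤ 1/2`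
  have hmaps : Set.MapsTo f strip strip := by
    intro ζ hζ
    have h1 : (f ζ).re = τ.re + Real.sinh (2 * ζ.re) * Real.cos (2 * ζ.im) / 4 := by
      rw [hf, ← re_sinh_two_mul]
      simp [Complex.add_re]
    have h2 : |Real.sinh (2 * ζ.re)| ≤ Real.sinh 1 := by
      rw [Real.abs_sinh, Real.sinh_le_sinh, abs_mul, abs_two]
      have h' : |ζ.re| ≤ 1 / 2 := hζ
      linarith
    have h3 : |Real.sinh (2 * ζ.re) * Real.cos (2 * ζ.im)| ≤ Real.sinh 1 := by
      rw [abs_mul]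
      calc _ ≤ Real.sinh 1 * 1 := by
            gcongr
            exact Real.abs_cos_le_one _
        _ = _ := mul_one _
    have h4 := sinh_one_lt
    show |(f ζ).re| ≤ 1 / 2
    rw [h1]
    rw [abs_le] at h3 hτ ⊢
    constructor <;> linarith [h3.1, h3.2, hτ.1, hτ.2]
  have hK : 0 ≤ Real.cosh 1 / 2 := by positivity
  have hc : ContractingWith (NNReal.mk (Real.cosh 1 / 2) hK) (hmaps.restrict f strip strip) := by
    refine ⟨?_, LipschitzWith.of_dist_le_mul fun x y => ?_⟩
    · rw [← NNReal.coe_lt_coe]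
      simp only [NNReal.coe_mk, NNReal.coe_one]
      linarith [cosh_one_lt_two]
    · rw [Subtype.dist_eq, Subtype.dist_eq, dist_eq_norm, dist_eq_norm]
      have := norm_sinh_sub_le x.2 y.2
      simpa [hf] using this
  obtain ⟨ζ, hζ, hfix, -⟩ := hc.exists_fixedPoint' isClosed_strip.isComplete hmaps
    (x := 0) (by simp [strip]) (edist_ne_top _ _)
  refine ⟨ζ, hζ, ?_⟩
  have : τ + sinh (2 * ζ) / 4 = ζ := hfix
  simp only [logHeight]
  linear_combination -this

open Classical in
/-- The inverse of `logHeight` on the strip `|Re τ| ≤ 1/10`, with values in `strip` (and the junk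
value `0` where there is no solution). -/
def logInv (τ : ℂ) : ℂ :=
  if h : ∃ ζ ∈ strip, logHeight ζ = τ then h.choose else 0

lemma logInv_mem (τ : ℂ) : logInv τ ∈ strip := by
  unfold logInv
  split_ifs with h
  · exact h.choose_spec.1
  · simp [strip]

lemma logHeight_logInv {τ : ℂ} (hτ : |τ.re| ≤ 1 / 10) : logHeight (logInv τ) = τ := by
  have h := exists_logHeight_eq hτ
  unfold logInv
  rw [dif_pos h]
  exact h.choose_spec.2

lemma logInv_eq {τ ζ : ℂ} (hτ : |τ.re| ≤ 1 / 10) (hζ : ζ ∈ strip) (h : logHeight ζ = τ) :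
    logInv τ = ζ :=
  injOn_logHeight (logInv_mem τ) hζ ((logHeight_logInv hτ).trans h.symm)

/-- The symmetries and periods of `logHeight` pass to `logInv` by uniqueness. -/
lemma logInv_conj {τ : ℂ} (hτ : |τ.re| ≤ 1 / 10) :
    logInv (starRingEnd ℂ τ) = starRingEnd ℂ (logInv τ) := by
  refine logInv_eq (by simpa using hτ) (by simpa [strip] using logInv_mem τ) ?_
  conv_rhs => rw [← logHeight_logInv hτ]
  simp [logHeight, ← Complex.sinh_conj, Complex.conj_ofNat]

lemma logInv_neg {τ : ℂ} (hτ : |τ.re| ≤ 1 / 10) : logInv (-τ) = -logInv τ := by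
  refine logInv_eq (by simpa using hτ) (by simpa [strip] using logInv_mem τ) ?_
  conv_rhs => rw [← logHeight_logInv hτ]
  simp [logHeight]
  ring

lemma logInv_add_pi {τ : ℂ} (hτ : |τ.re| ≤ 1 / 10) :
    logInv (τ + Real.pi * I) = logInv τ + Real.pi * I := by
  refine logInv_eq (by simpa using hτ) (by simpa [strip] using logInv_mem τ) ?_
  conv_rhs => rw [← logHeight_logInv hτ]
  have : sinh (2 * (logInv τ + Real.pi * I)) = sinh (2 * logInv τ) := by
    rw [show 2 * (logInv τ + Real.pi * I) = 2 * logInv τ + (2 * Real.pi : ℂ) * I by ring,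
      Complex.sinh_add, Complex.sinh_mul_I, Complex.cosh_mul_I]
    simp
  simp only [logHeight, this]
  ring

lemma sinh_two_mul_add_int (ζ : ℂ) (n : ℤ) :
    sinh (2 * (ζ + n * (2 * Real.pi * I))) = sinh (2 * ζ) := by
  have h1 : 2 * (ζ + n * (2 * Real.pi * I)) = 2 * ζ + (2 * n : ℤ) * (2 * Real.pi * I) := by
    push_cast; ring
  have h2 : -(2 * (ζ + n * (2 * Real.pi * I))) = -(2 * ζ) + (-(2 * n) : ℤ) * (2 * Real.pi * I) := by
    push_cast; ring
  rw [Complex.sinh, Complex.sinh, h2, h1, Complex.exp_periodic.int_mul _ _,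
    Complex.exp_periodic.int_mul _ _]

lemma logHeight_add_int (ζ : ℂ) (n : ℤ) :
    logHeight (ζ + n * (2 * Real.pi * I)) = logHeight ζ + n * (2 * Real.pi * I) := by
  rw [logHeight, sinh_two_mul_add_int, logHeight]
  ring

lemma logInv_add_int {τ : ℂ} (hτ : |τ.re| ≤ 1 / 10) (n : ℤ) :
    logInv (τ + n * (2 * Real.pi * I)) = logInv τ + n * (2 * Real.pi * I) := by
  refine logInv_eq (by simpa using hτ) (by simpa [strip] using logInv_mem τ) ?_
  rw [logHeight_add_int, logHeight_logInv hτ]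

lemma logInv_add_two_pi {τ : ℂ} (hτ : |τ.re| ≤ 1 / 10) :
    logInv (τ + 2 * Real.pi * I) = logInv τ + 2 * Real.pi * I := by
  simpa using logInv_add_int hτ 1

/-- The open strip of the coordinate `τ`, on which `logInv` is a holomorphic inverse of
`logHeight`. -/
def openStrip : Set ℂ := {τ | |τ.re| < 1 / 10}

lemma isOpen_openStrip : IsOpen openStrip :=
  isOpen_lt (continuous_abs.comp continuous_re) continuous_const

lemma continuousOn_logInv : ContinuousOn logInv {τ | |τ.re| ≤ 1 / 10} := by
  have h2 : 0 < 1 - Real.cosh 1 / 2 := by linarith [cosh_one_lt_two]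
  refine LipschitzOnWith.continuousOn (K := NNReal.mk (1 - Real.cosh 1 / 2)⁻¹ (inv_pos.2 h2).le)
    (LipschitzOnWith.of_dist_le_mul fun x hx y hy => ?_)
  rw [dist_eq_norm, dist_eq_norm, NNReal.coe_mk, ← div_eq_inv_mul, le_div_iff₀ h2, mul_comm]
  simpa [logHeight_logInv hx, logHeight_logInv hy] using
    norm_sub_le_of_strip (logInv_mem x) (logInv_mem y)

lemma hasDerivAt_logInv {τ : ℂ} (hτ : τ ∈ openStrip) :
    HasDerivAt logInv (1 - cosh (2 * logInv τ) / 2)⁻¹ τ := by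
  have hn : ∀ᶠ y in 𝓝 τ, y ∈ openStrip := isOpen_openStrip.mem_nhds hτ
  refine HasDerivAt.of_local_left_inverse (f := logHeight) ?_ (hasDerivAt_logHeight _)
    (one_sub_cosh_ne_zero (logInv_mem τ)) (hn.mono fun y hy => logHeight_logInv (le_of_lt hy))
  exact continuousOn_logInv.continuousAt (hn.mono fun y hy => le_of_lt hy)

end MinimalAnnuli

namespace MinimalAnnuli

open Complex Filter Topology InnerProductSpace

/-! ### Local logarithms -/

/-- A branch of the logarithm near `exp τ` that takes the value `τ` there. -/
lemma exists_local_log (τ : ℂ) : ∃ l : ℂ → ℂ, AnalyticAt ℂ l (exp τ) ∧ l (exp τ) = τ ∧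
    HasDerivAt l (exp τ)⁻¹ (exp τ) ∧ ∀ᶠ z in 𝓝 (exp τ), exp (l z) = z := by
  have hone : exp τ * (exp τ)⁻¹ = 1 := mul_inv_cancel₀ (exp_ne_zero τ)
  refine ⟨fun z => τ + log (z * (exp τ)⁻¹), ?_, by simp, ?_, ?_⟩
  · refine analyticAt_const.add (AnalyticAt.clog (analyticAt_id.mul analyticAt_const) ?_)
    simp
  · have h1 := (((hasDerivAt_id (exp τ)).mul_const (exp τ)⁻¹).clog (by simp)).const_add τ
    convert! h1 using 1
    simp
  · filter_upwards [eventually_ne_nhds (exp_ne_zero τ)] with z hz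
    rw [exp_add, exp_log (mul_ne_zero hz (inv_ne_zero (exp_ne_zero τ)))]
    field_simp [exp_ne_zero τ]

/-- A function of `z = exp τ` that is differentiable in `τ` is differentiable in `z`. -/
lemma hasDerivAt_of_comp_exp {f g : ℂ → ℂ} {g' τ : ℂ} (hg : HasDerivAt g g' τ)
    (h : ∀ᶠ s in 𝓝 τ, f (exp s) = g s) : HasDerivAt f (g' * (exp τ)⁻¹) (exp τ) := by
  obtain ⟨l, hlan, hlτ, hlder, hl⟩ := exists_local_log τ
  have h1 : Tendsto l (𝓝 (exp τ)) (𝓝 τ) := by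
    simpa only [hlτ] using hlan.continuousAt.tendsto
  refine (HasDerivAt.comp_of_eq (exp τ) hg hlder hlτ.symm).congr_of_eventuallyEq ?_
  filter_upwards [hl, h1.eventually h] with z hz hz'
  rwa [hz] at hz'

/-! ### Real parts of holomorphic curves in `ℂ³` -/

/-- The real part `ℂ³ → ℝ³`, as a real-linear map. -/
def reE3 : (Fin 3 → ℂ) →L[ℝ] E3 :=
  (EuclideanSpace.equiv (Fin 3) ℝ).symm.toContinuousLinearMap ∘L
    ContinuousLinearMap.pi fun k => Complex.reCLM ∘L ContinuousLinearMap.proj k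

@[simp] lemma reE3_apply (v : Fin 3 → ℂ) (k : Fin 3) : reE3 v k = (v k).re := rfl

/-- Near `z`, the map `X` is the real part of a holomorphic curve in `ℂ³` whose velocity at `z` is
`φ`. -/
def IsReHolomorphicAt (X : ℂ → E3) (φ : Fin 3 → ℂ) (z : ℂ) : Prop :=
  ∃ F : ℂ → Fin 3 → ℂ, AnalyticAt ℂ F z ∧ HasDerivAt F φ z ∧ X =ᶠ[𝓝 z] fun w => reE3 (F w)

namespace IsReHolomorphicAt

variable {X : ℂ → E3} {φ : Fin 3 → ℂ} {z : ℂ}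

lemma harmonicAt (h : IsReHolomorphicAt X φ z) : HarmonicAt X z := by
  obtain ⟨F, hF, -, hX⟩ := h
  exact (harmonicAt_congr_nhds hX).2 (hF.harmonicAt.comp_CLM reE3)

lemma hasFDerivAt (h : IsReHolomorphicAt X φ z) :
    HasFDerivAt X (reE3 ∘L (ContinuousLinearMap.toSpanSingleton ℂ φ).restrictScalars ℝ) z := by
  obtain ⟨F, -, hF, hX⟩ := h
  exact (reE3.hasFDerivAt.comp z (hF.hasFDerivAt.restrictScalars ℝ)).congr_of_eventuallyEq hX

lemma fderiv_apply (h : IsReHolomorphicAt X φ z) (v : ℂ) : fderiv ℝ X z v = reE3 (v • φ) := by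
  rw [h.hasFDerivAt.fderiv]
  rfl

lemma phi_eq (h : IsReHolomorphicAt X φ z) (k : Fin 3) : phi X k z = φ k := by
  unfold phi
  rw [h.fderiv_apply, h.fderiv_apply]
  apply Complex.ext <;> simp

/-- A lift through the exponential: if `X ∘ exp` is the real part of a holomorphic curve near `τ`,
then `X` is the real part of a holomorphic curve near `exp τ`. -/
lemma of_exp {F : ℂ → Fin 3 → ℂ} {F' : Fin 3 → ℂ} {τ : ℂ} (hF : AnalyticAt ℂ F τ)
    (hF' : HasDerivAt F F' τ) (hX : ∀ᶠ s in 𝓝 τ, X (exp s) = reE3 (F s)) :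
    IsReHolomorphicAt X ((exp τ)⁻¹ • F') (exp τ) := by
  obtain ⟨l, hlan, hlτ, hlder, hl⟩ := exists_local_log τ
  refine ⟨F ∘ l, AnalyticAt.comp_of_eq hF hlan hlτ,
    HasDerivAt.scomp_of_eq (exp τ) hF' hlder hlτ.symm, ?_⟩
  have h1 : Tendsto l (𝓝 (exp τ)) (𝓝 τ) := by
    simpa only [hlτ] using hlan.continuousAt.tendsto
  filter_upwards [hl, h1.eventually hX] with z hz hz'
  rwa [hz] at hz'

end IsReHolomorphicAt

lemma norm_reE3_smul_sq {φ : Fin 3 → ℂ} (h : φ 0 ^ 2 + φ 1 ^ 2 + φ 2 ^ 2 = 0) (v : ℂ) :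
    ‖reE3 (v • φ)‖ ^ 2 = ‖v‖ ^ 2 * (‖φ 0‖ ^ 2 + ‖φ 1‖ ^ 2 + ‖φ 2‖ ^ 2) / 2 := by
  have hre := congrArg Complex.re h
  have him := congrArg Complex.im h
  simp only [Complex.add_re, Complex.add_im, sq, Complex.mul_re, Complex.mul_im, Complex.zero_re,
    Complex.zero_im] at hre him
  rw [EuclideanSpace.norm_sq_eq, Fin.sum_univ_three]
  simp only [reE3_apply, Pi.smul_apply, smul_eq_mul, Complex.mul_re, Real.norm_eq_abs, sq_abs,
    Complex.sq_norm, Complex.normSq_apply]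
  linear_combination (v.re ^ 2 - v.im ^ 2) / 2 * hre - v.re * v.im * him

lemma inner_reE3_I_smul {φ : Fin 3 → ℂ} (h : φ 0 ^ 2 + φ 1 ^ 2 + φ 2 ^ 2 = 0) :
    inner ℝ (reE3 φ) (reE3 (I • φ)) = 0 := by
  have him := congrArg Complex.im h
  simp only [Complex.add_im, sq, Complex.mul_im, Complex.zero_im] at him
  rw [PiLp.inner_apply, Fin.sum_univ_three]
  simp
  linarith

/-- Holomorphic null curves in `ℂ³` have conformal minimal immersions as real parts. -/
lemma isConformalMinimalImmersion_of_isReHolomorphicAt {X : ℂ → E3} {D : Set ℂ}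
    (φ : ℂ → Fin 3 → ℂ) (hX : ∀ z ∈ D, IsReHolomorphicAt X (φ z) z)
    (h0 : ∀ z ∈ D, φ z 0 ^ 2 + φ z 1 ^ 2 + φ z 2 ^ 2 = 0) (hne : ∀ z ∈ D, φ z ≠ 0) :
    IsConformalMinimalImmersion X D where
  harmonic z hz := (hX z hz).harmonicAt
  norm_eq z hz := by
    rw [(hX z hz).fderiv_apply, (hX z hz).fderiv_apply,
      ← sq_eq_sq₀ (norm_nonneg _) (norm_nonneg _), norm_reE3_smul_sq (h0 z hz),
      norm_reE3_smul_sq (h0 z hz)]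
    simp
  orthogonal z hz := by
    rw [(hX z hz).fderiv_apply, (hX z hz).fderiv_apply, one_smul]
    exact inner_reE3_I_smul (h0 z hz)
  immersion z hz h := by
    rw [(hX z hz).fderiv_apply] at h
    have h1 := norm_reE3_smul_sq (h0 z hz) 1
    rw [h] at h1
    simp only [norm_zero, norm_one] at h1
    refine hne z hz (funext fun k => ?_)
    have h2 : ‖φ z k‖ ^ 2 = 0 := by
      have := sq_nonneg ‖φ z 0‖
      have := sq_nonneg ‖φ z 1‖
      have := sq_nonneg ‖φ z 2‖
      fin_cases k <;> simp only [Fin.zero_eta, Fin.mk_one, Fin.reduceFinMk] <;> nlinarith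
    simpa using h2

end MinimalAnnuli

namespace MinimalAnnuli

open Complex Filter Topology InnerProductSpace MeasureTheory

/-! ### The complete minimal surface -/

/-- The complete minimal surface, with scale factor `c`, on `ℂ \ {0}` (with a junk value at
`0`). -/
def surf (c : ℝ) (w : ℂ) : E3 :=
  !₂[c * (2 * √2 * (w + w⁻¹).re), c * (-(w ^ 2 - w⁻¹ ^ 2).im / 2),
    c * (4 * Real.log ‖w‖ - (w ^ 2 - w⁻¹ ^ 2).re / 2)]

/-- The holomorphic null curve, in the coordinate `ζ = log w`, whose real part is the surface. -/
def surfLift (c : ℝ) (ζ : ℂ) : Fin 3 → ℂ :=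
  ![c * (4 * √2 * cosh ζ), c * (I * sinh (2 * ζ)), c * (4 * logHeight ζ)]

/-- The functions `φ_k` of the surface, written with `q = w - w⁻¹`. -/
def surfPhi (c : ℝ) (w : ℂ) : Fin 3 → ℂ :=
  (c * w⁻¹) • ![2 * √2 * (w - w⁻¹), I * ((w - w⁻¹) ^ 2 + 2), 2 - (w - w⁻¹) ^ 2]

lemma exp_sub_inv (ζ : ℂ) : exp ζ - (exp ζ)⁻¹ = 2 * sinh ζ := by
  rw [← Complex.exp_neg, Complex.sinh]; ring

lemma exp_add_inv (ζ : ℂ) : exp ζ + (exp ζ)⁻¹ = 2 * cosh ζ := by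
  rw [← Complex.exp_neg, Complex.cosh]; ring

lemma exp_sq_sub_inv_sq (ζ : ℂ) : exp ζ ^ 2 - (exp ζ)⁻¹ ^ 2 = 2 * sinh (2 * ζ) := by
  rw [Complex.sinh_two_mul]
  linear_combination (exp ζ - (exp ζ)⁻¹) * exp_add_inv ζ + 2 * cosh ζ * exp_sub_inv ζ

lemma surf_exp (c : ℝ) (ζ : ℂ) : surf c (exp ζ) = reE3 (surfLift c ζ) := by
  ext k
  rw [reE3_apply]
  unfold surf surfLift logHeight
  rw [exp_add_inv, exp_sq_sub_inv_sq, Complex.norm_exp, Real.log_exp]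
  fin_cases k
  · simp
    left
    ring
  · simp
    ring
  · simp
    left
    ring

/-- The velocity of `surfLift`. -/
def surfLiftDeriv (c : ℝ) (ζ : ℂ) : Fin 3 → ℂ :=
  ![c * (4 * √2 * sinh ζ), c * (I * (2 * cosh (2 * ζ))), c * (4 * (1 - cosh (2 * ζ) / 2))]

lemma hasDerivAt_surfLift (c : ℝ) (ζ : ℂ) :
    HasDerivAt (surfLift c) (surfLiftDeriv c ζ) ζ := by
  rw [hasDerivAt_pi]
  intro k
  fin_cases k
  · exact ((Complex.hasDerivAt_cosh ζ).const_mul _).const_mul _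
  · have h := (((hasDerivAt_id ζ).const_mul (2 : ℂ)).csinh.const_mul I).const_mul (c : ℂ)
    convert! h using 1
    simp [surfLiftDeriv]
    left
    ring
  · exact ((hasDerivAt_logHeight ζ).const_mul _).const_mul _

lemma differentiable_surfLift (c : ℝ) : Differentiable ℂ (surfLift c) := fun ζ =>
  (hasDerivAt_surfLift c ζ).differentiableAt

lemma surfPhi_exp (c : ℝ) (ζ : ℂ) : surfPhi c (exp ζ) = (exp ζ)⁻¹ • surfLiftDeriv c ζ := by
  unfold surfPhi surfLiftDeriv
  rw [exp_sub_inv, Complex.cosh_two_mul, Complex.cosh_sq]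
  ext k
  fin_cases k <;> simp <;> ring

lemma surf_isReHolomorphicAt (c : ℝ) {w : ℂ} (hw : w ≠ 0) :
    IsReHolomorphicAt (surf c) (surfPhi c w) w := by
  rw [← exp_log hw, surfPhi_exp]
  exact IsReHolomorphicAt.of_exp ((differentiable_surfLift c).analyticAt _)
    (hasDerivAt_surfLift c _) (Eventually.of_forall fun s => surf_exp c s)

lemma sqrt_two_sq : ((√2 : ℝ) : ℂ) ^ 2 = 2 := by
  rw [← Complex.ofReal_pow, Real.sq_sqrt (by norm_num)]
  norm_num

lemma surfPhi_null (c : ℝ) (w : ℂ) :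
    surfPhi c w 0 ^ 2 + surfPhi c w 1 ^ 2 + surfPhi c w 2 ^ 2 = 0 := by
  simp only [surfPhi, Pi.smul_apply, smul_eq_mul, Matrix.cons_val_zero, Matrix.cons_val_one,
    Matrix.cons_val]
  linear_combination (c * w⁻¹) ^ 2 * 4 * (w - w⁻¹) ^ 2 * sqrt_two_sq +
    (c * w⁻¹) ^ 2 * ((w - w⁻¹) ^ 2 + 2) ^ 2 * I_sq

/-- The conformal factor is `c (2 + |q|²) / |w|`, where `q = w - w⁻¹`. -/
lemma norm_fderiv_surf {c : ℝ} (hc : 0 < c) {w : ℂ} (hw : w ≠ 0) (v : ℂ) :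
    ‖fderiv ℝ (surf c) w v‖ = c * (2 + ‖w - w⁻¹‖ ^ 2) / ‖w‖ * ‖v‖ := by
  rw [(surf_isReHolomorphicAt c hw).fderiv_apply, ← sq_eq_sq₀ (norm_nonneg _) (by positivity),
    norm_reE3_smul_sq (surfPhi_null c w)]
  have key : ‖surfPhi c w 0‖ ^ 2 + ‖surfPhi c w 1‖ ^ 2 + ‖surfPhi c w 2‖ ^ 2
      = (c / ‖w‖) ^ 2 * (2 * (2 + ‖w - w⁻¹‖ ^ 2) ^ 2) := by
    simp only [surfPhi, Pi.smul_apply, smul_eq_mul, Matrix.cons_val_zero, Matrix.cons_val_one,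
      Matrix.cons_val, norm_mul, norm_inv, norm_I, Complex.norm_real, Complex.norm_ofNat,
      Real.norm_eq_abs, mul_pow, sq_abs, abs_of_pos hc]
    have h2 : √2 ^ 2 = (2 : ℝ) := Real.sq_sqrt (by norm_num)
    generalize w - w⁻¹ = q
    have h3 : |√2| ^ 2 = 2 := by rw [sq_abs, h2]
    have h4 : ‖q ^ 2 + 2‖ ^ 2 + ‖2 - q ^ 2‖ ^ 2 = 2 * ‖q‖ ^ 4 + 8 := by
      have h5 : ‖q‖ ^ 4 = ‖q ^ 2‖ ^ 2 := by rw [norm_pow]; ring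
      rw [h5]
      generalize q ^ 2 = p
      simp only [Complex.sq_norm, Complex.normSq_apply, Complex.add_re, Complex.sub_re,
        Complex.add_im, Complex.sub_im, Complex.re_ofNat, Complex.im_ofNat]
      ring
    field_simp
    linear_combination 4 * ‖q‖ ^ 2 * h2 + h4
  rw [key]
  ring

lemma surf_minimal {c : ℝ} (hc : 0 < c) : IsConformalMinimalImmersion (surf c) {0}ᶜ := by
  refine isConformalMinimalImmersion_of_isReHolomorphicAt (surfPhi c)
    (fun w hw => surf_isReHolomorphicAt c hw) (fun w _ => surfPhi_null c w) fun w hw h => ?_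
  have h1 := norm_fderiv_surf hc hw 1
  rw [(surf_isReHolomorphicAt c hw).fderiv_apply, h] at h1
  have hw' : 0 < ‖w‖ := norm_pos_iff.2 hw
  have : 0 < c * (2 + ‖w - w⁻¹‖ ^ 2) / ‖w‖ * ‖(1 : ℂ)‖ := by
    rw [norm_one]
    positivity
  rw [smul_zero, map_zero, norm_zero] at h1
  linarith

/-- The coefficients of the Laurent polynomial `G₋ = √c (√2 + w - w⁻¹)`. -/
def coeffMinus (c : ℝ) : Fin 3 → ℂ := ![-√c, √c * √2, √c]

/-- The coefficients of the Laurent polynomial `G₊ = √c (√2 - w + w⁻¹)`. -/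
def coeffPlus (c : ℝ) : Fin 3 → ℂ := ![√c, √c * √2, -√c]

lemma surf_hasWeierstrassData {c : ℝ} (hc : 0 < c) :
    HasWeierstrassData (surf c) (trinomial (coeffMinus c)) (trinomial (coeffPlus c)) := by
  intro w hw
  have hs : ((√c : ℝ) : ℂ) ^ 2 = c := by rw [← Complex.ofReal_pow, Real.sq_sqrt hc.le]
  have hm : trinomial (coeffMinus c) w = √c * (√2 + (w - w⁻¹)) := by
    simp [trinomial, coeffMinus]; ring
  have hp : trinomial (coeffPlus c) w = √c * (√2 - (w - w⁻¹)) := by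
    simp [trinomial, coeffPlus]; ring
  have h2 := sqrt_two_sq
  simp only [(surf_isReHolomorphicAt c hw).phi_eq, hm, hp]
  simp only [surfPhi, Pi.smul_apply, smul_eq_mul, Matrix.cons_val_zero, Matrix.cons_val_one,
    Matrix.cons_val]
  generalize w - w⁻¹ = q
  refine ⟨?_, ?_, ?_⟩
  · linear_combination -(2 * √2 * q * w⁻¹) * hs
  · linear_combination -(I * w⁻¹ * (q ^ 2 + √2 ^ 2)) * hs - I * w⁻¹ * c * h2
  · linear_combination -(w⁻¹ * (√2 ^ 2 - q ^ 2)) * hs - w⁻¹ * c * h2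

/-- The metric dominates `2 c |dw| / |w|`, so that `log |w|` is bounded along paths of finite
length. -/
lemma surf_isCompleteOn {c : ℝ} (hc : 0 < c) : IsCompleteOn (surf c) {0}ᶜ := by
  intro γ hγ hγ0 hleave
  by_contra hfin
  have hne : ∀ t ∈ Set.Ioi (0 : ℝ), γ t ≠ 0 := fun t ht => hγ0 t (Set.Ioi_subset_Ici_self ht)
  have hγ' : ContDiffOn ℝ 1 γ (Set.Ioi 0) := hγ.mono Set.Ioi_subset_Ici_self
  have hcont : ContinuousOn (deriv γ) (Set.Ioi 0) :=
    hγ'.continuousOn_deriv_of_isOpen isOpen_Ioi le_rfl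
  have hder : ∀ t ∈ Set.Ioi (0 : ℝ), HasDerivAt γ (deriv γ t) t := fun t ht =>
    ((hγ'.differentiableOn one_ne_zero).differentiableAt (isOpen_Ioi.mem_nhds ht)).hasDerivAt
  -- the derivative of `log |γ|`
  set d : ℝ → ℝ := fun t => inner ℝ (γ t) (deriv γ t) / ‖γ t‖ ^ 2 with hd
  have hlog : ∀ t ∈ Set.Ioi (0 : ℝ), HasDerivAt (fun t => Real.log ‖γ t‖) (d t) t := by
    intro t ht
    have hn : ‖γ t‖ ≠ 0 := norm_ne_zero_iff.2 (hne t ht)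
    have h1 := ((hder t ht).norm_sq.log (pow_ne_zero 2 hn)).const_mul (1 / 2)
    have h2 : (fun t => Real.log ‖γ t‖) = fun t => 1 / 2 * Real.log (‖γ t‖ ^ 2) := by
      funext t
      rw [Real.log_pow]
      push_cast
      ring
    rw [h2]
    convert! h1 using 1
    rw [hd]
    ring
  have hdcont : ContinuousOn d (Set.Ioi 0) := by
    refine ((hγ'.continuousOn).inner hcont).div ((hγ'.continuousOn).norm.pow 2) fun t ht => ?_
    exact pow_ne_zero 2 (norm_ne_zero_iff.2 (hne t ht))
  have hdle : ∀ t ∈ Set.Ioi (0 : ℝ),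
      ‖d t‖ ≤ (2 * c)⁻¹ * ‖fderiv ℝ (surf c) (γ t) (deriv γ t)‖ := by
    intro t ht
    have hn : 0 < ‖γ t‖ := norm_pos_iff.2 (hne t ht)
    have h1 : ‖d t‖ ≤ ‖deriv γ t‖ / ‖γ t‖ := by
      rw [hd]
      simp only [norm_div, norm_pow, norm_norm]
      rw [div_le_div_iff₀ (by positivity) hn]
      calc _ ≤ (‖γ t‖ * ‖deriv γ t‖) * ‖γ t‖ := by
            gcongr
            exact norm_inner_le_norm _ _
        _ = _ := by ring
    refine h1.trans ?_
    rw [norm_fderiv_surf hc (hne t ht), div_le_iff₀ hn]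
    have : (2 * c)⁻¹ * (c * (2 + ‖γ t - (γ t)⁻¹‖ ^ 2) / ‖γ t‖ * ‖deriv γ t‖) * ‖γ t‖
        = ‖deriv γ t‖ + ‖γ t - (γ t)⁻¹‖ ^ 2 / 2 * ‖deriv γ t‖ := by
      field_simp
    rw [this]
    have : 0 ≤ ‖γ t - (γ t)⁻¹‖ ^ 2 / 2 * ‖deriv γ t‖ := by positivity
    linarith
  set J := ∫⁻ t in Set.Ioi (0 : ℝ), ‖fderiv ℝ (surf c) (γ t) (deriv γ t)‖ₑ with hJ
  set B := ENNReal.ofReal (2 * c)⁻¹ * J with hB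
  have hBfin : B ≠ ⊤ := ENNReal.mul_ne_top ENNReal.ofReal_ne_top hfin
  have hbound : ∀ t, 1 ≤ t → |Real.log ‖γ t‖ - Real.log ‖γ 1‖| ≤ B.toReal := by
    intro t ht
    have hsub : Set.uIcc 1 t ⊆ Set.Ioi (0 : ℝ) := by
      rw [Set.uIcc_of_le ht]
      exact fun s hs => lt_of_lt_of_le one_pos hs.1
    have hint : ∫ s in (1 : ℝ)..t, d s = Real.log ‖γ t‖ - Real.log ‖γ 1‖ :=
      intervalIntegral.integral_eq_sub_of_hasDerivAt (fun s hs => hlog s (hsub hs))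
        (hdcont.mono hsub).intervalIntegrable
    rw [← hint, intervalIntegral.integral_of_le ht, ← Real.norm_eq_abs, ← toReal_enorm]
    refine ENNReal.toReal_mono hBfin ((enorm_integral_le_lintegral_enorm _).trans ?_)
    rw [hB, hJ, ← lintegral_const_mul' _ _ ENNReal.ofReal_ne_top]
    have hsub' : Set.Ioc 1 t ⊆ Set.Ioi (0 : ℝ) := fun s hs => one_pos.trans hs.1
    refine (lintegral_mono_set hsub').trans
      (setLIntegral_mono' measurableSet_Ioi fun s hs => ?_)
    rw [← ofReal_norm, ← ofReal_norm, ← ENNReal.ofReal_mul (by positivity)]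
    exact ENNReal.ofReal_le_ofReal (hdle s hs)
  -- a path of finite length would stay in this compact annulus
  set a := Real.log ‖γ 1‖
  set b := B.toReal
  set K : Set ℂ := {w | Real.exp (a - b) ≤ ‖w‖ ∧ ‖w‖ ≤ Real.exp (a + b)} with hK
  have hKc : IsCompact K := by
    refine (isCompact_closedBall (0 : ℂ) (Real.exp (a + b))).of_isClosed_subset ?_ ?_
    · exact (isClosed_le continuous_const continuous_norm).inter
        (isClosed_le continuous_norm continuous_const)
    · intro w hw
      simpa using hw.2
  have hK0 : K ⊆ {0}ᶜ := by
    rintro w hw (rfl : w = 0)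
    have := hw.1
    rw [norm_zero] at this
    exact absurd this (not_le.2 (Real.exp_pos _))
  obtain ⟨t, ht, ht1⟩ := ((hleave K hKc hK0).and (eventually_ge_atTop 1)).exists
  have hpos : 0 < ‖γ t‖ := norm_pos_iff.2 (hne t (lt_of_lt_of_le one_pos ht1))
  have := abs_le.1 (hbound t ht1)
  refine ht ⟨?_, ?_⟩
  · rw [← Real.le_log_iff_exp_le hpos]
    linarith [this.1]
  · rw [← Real.log_le_iff_le_exp hpos]
    linarith [this.2]

end MinimalAnnuli

namespace MinimalAnnuli

open Complex Filter Topology InnerProductSpace MeasureTheory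

/-! ### Total curvature -/

/-- The second derivative in a direction `v`, computed by differentiating twice along lines. -/
lemma iteratedFDeriv_two_eq_of_hasLineDerivAt {f g : ℂ → ℝ} {g' : ℝ} {z v : ℂ}
    (hf : ContDiffAt ℝ 2 f z) (hg : ∀ᶠ w in 𝓝 z, HasLineDerivAt ℝ f (g w) w v)
    (hg' : HasLineDerivAt ℝ g g' z v) : iteratedFDeriv ℝ 2 f z ![v, v] = g' := by
  rw [iteratedFDeriv_two_apply]
  simp only [Matrix.cons_val_zero, Matrix.cons_val_one]
  have h1 : HasFDerivAt (fderiv ℝ f) (fderiv ℝ (fderiv ℝ f) z) z :=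
    ((hf.fderiv_right (m := 1) (by norm_num)).differentiableAt one_ne_zero).hasFDerivAt
  have h2 : HasFDerivAt (fun w => fderiv ℝ f w v)
      ((ContinuousLinearMap.apply ℝ ℝ v) ∘L fderiv ℝ (fderiv ℝ f) z) z :=
    (ContinuousLinearMap.apply ℝ ℝ v).hasFDerivAt.comp z h1
  have h3 := h2.hasLineDerivAt v
  have h4 : g =ᶠ[𝓝 z] fun w => fderiv ℝ f w v := by
    filter_upwards [hg, hf.eventually (by simp)] with w hw hw'
    exact hw.lineDeriv.symm.trans (hw'.differentiableAt two_ne_zero).lineDeriv_eq_fderiv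
  exact (h3.congr_of_eventuallyEq h4).unique hg'

lemma hasDerivAt_comp_line {f : ℂ → ℂ} {f' : ℂ} {z v : ℂ} {t : ℝ}
    (h : HasDerivAt f f' (z + (t : ℝ) • v)) :
    HasDerivAt (fun t : ℝ => f (z + t • v)) (f' * v) t := by
  have h1 : HasDerivAt (fun t : ℝ => z + t • v) v t := by
    simpa using ((hasDerivAt_id t).smul_const v).const_add z
  have h2 := HasFDerivAt.comp_hasDerivAt t (h.hasFDerivAt.restrictScalars ℝ) h1
  convert! h2 using 1
  simp [mul_comm]

/-- The area density of the pull-back of the spherical metric `2√2 |dq| / (2 + |q|²)` by a holomorphic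
function `q`, as a Laplacian. -/
lemma laplacian_log_two_add_norm_sq {q : ℂ → ℂ} {z : ℂ} (hq : AnalyticAt ℂ q z) :
    Laplacian.laplacian (fun w => Real.log (2 + ‖q w‖ ^ 2)) z
      = 8 * ‖deriv q z‖ ^ 2 / (2 + ‖q z‖ ^ 2) ^ 2 := by
  set f : ℂ → ℝ := fun w => Real.log (2 + ‖q w‖ ^ 2) with hf
  have hpos : ∀ w, 2 + ‖q w‖ ^ 2 ≠ 0 := fun w => by positivity
  have hfc : ContDiffAt ℝ 2 f z := by
    have h1 : ContDiffAt ℝ 2 q z := (hq.contDiffAt (n := 2)).restrict_scalars ℝ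
    exact (contDiffAt_const.add (h1.norm_sq ℝ)).log (hpos z)
  have hline : ∀ w v, AnalyticAt ℂ q w →
      HasLineDerivAt ℝ f (2 * inner ℝ (q w) (deriv q w * v) / (2 + ‖q w‖ ^ 2)) w v := by
    intro w v hw
    have h0 : HasDerivAt q (deriv q w) (w + (0 : ℝ) • v) := by
      simpa using hw.differentiableAt.hasDerivAt
    have h1 := ((hasDerivAt_comp_line h0).norm_sq.const_add 2).log (hpos _)
    simpa [HasLineDerivAt, hf] using h1
  have key : ∀ v, iteratedFDeriv ℝ 2 f z ![v, v]
      = (2 * (inner ℝ (q z) (deriv (deriv q) z * v * v) + ‖deriv q z * v‖ ^ 2) * (2 + ‖q z‖ ^ 2)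
        - (2 * inner ℝ (q z) (deriv q z * v)) ^ 2) / (2 + ‖q z‖ ^ 2) ^ 2 := by
    intro v
    refine iteratedFDeriv_two_eq_of_hasLineDerivAt hfc
      (hq.eventually_analyticAt.mono fun w hw => hline w v hw) ?_
    have h0 : HasDerivAt q (deriv q z) (z + (0 : ℝ) • v) := by
      simpa using hq.differentiableAt.hasDerivAt
    have h1 : HasDerivAt (deriv q) (deriv (deriv q) z) (z + (0 : ℝ) • v) := by
      simpa using hq.deriv.differentiableAt.hasDerivAt
    have h2 := ((((hasDerivAt_comp_line h0).inner ℝ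
      ((hasDerivAt_comp_line h1).mul_const v)).const_mul 2).div
      ((hasDerivAt_comp_line h0).norm_sq.const_add 2) (hpos _))
    unfold HasLineDerivAt
    convert! h2 using 1
    simp only [zero_smul, add_zero, real_inner_self_eq_norm_sq]
    ring
  rw [laplacian_eq_iteratedFDeriv_complexPlane]
  simp only [key]
  have e1 : inner ℝ (q z) (deriv (deriv q) z * I * I) = -inner ℝ (q z) (deriv (deriv q) z) := by
    rw [mul_assoc, I_mul_I, mul_neg_one, inner_neg_right]
  have e2 : inner ℝ (q z) (deriv q z) ^ 2 + inner ℝ (q z) (deriv q z * I) ^ 2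
      = ‖q z‖ ^ 2 * ‖deriv q z‖ ^ 2 := by
    simp only [Complex.inner, Complex.sq_norm, Complex.normSq_apply]
    simp
    ring
  rw [e1]
  simp only [mul_one, norm_mul, norm_I]
  rw [← add_div]
  congr 1
  linear_combination (-4) * e2

lemma hasDerivAt_sub_inv {w : ℂ} (hw : w ≠ 0) :
    HasDerivAt (fun w : ℂ => w - w⁻¹) (1 + (w ^ 2)⁻¹) w := by
  convert! (hasDerivAt_id w).sub (hasDerivAt_inv hw) using 1
  ring

/-- The conformal factor `c (2 + |q|²) / |w|` has the logarithm `log (2 + |q|²)` up to a harmonic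
function, so the curvature form is minus the pull-back of the spherical area by `q`. -/
lemma gaussCurvature_surf {c : ℝ} (hc : 0 < c) {w : ℂ} (hw : w ≠ 0) :
    gaussCurvature (surf c) w * ‖fderiv ℝ (surf c) w 1‖ ^ 2
      = -(‖1 + (w ^ 2)⁻¹‖ ^ 2 * (8 / (2 + ‖w - w⁻¹‖ ^ 2) ^ 2)) := by
  have hne : ‖fderiv ℝ (surf c) w 1‖ ^ 2 ≠ 0 :=
    pow_ne_zero 2 (norm_ne_zero_iff.2 ((surf_minimal hc).immersion w hw))
  rw [gaussCurvature, div_mul_cancel₀ _ hne]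
  congr 1
  have hq : AnalyticAt ℂ (fun w : ℂ => w - w⁻¹) w := analyticAt_id.sub (analyticAt_inv hw)
  have hharm : HarmonicAt (fun w : ℂ => Real.log ‖w‖) w :=
    AnalyticAt.harmonicAt_log_norm (f := fun w => w) analyticAt_id hw
  set f₁ : ℂ → ℝ := fun w => Real.log (2 + ‖w - w⁻¹‖ ^ 2) with hf₁
  have hc₁ : ContDiffAt ℝ 2 f₁ w := by
    have h1 : ContDiffAt ℝ 2 (fun w : ℂ => w - w⁻¹) w :=
      (hq.contDiffAt (n := 2)).restrict_scalars ℝ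
    exact (contDiffAt_const.add (h1.norm_sq ℝ)).log (by positivity)
  have hev : (fun w : ℂ => Real.log ‖fderiv ℝ (surf c) w 1‖)
      =ᶠ[𝓝 w] ((fun _ => Real.log c) + (f₁ - fun w => Real.log ‖w‖)) := by
    filter_upwards [eventually_ne_nhds hw] with u hu
    have hu' : ‖u‖ ≠ 0 := norm_ne_zero_iff.2 hu
    rw [norm_fderiv_surf hc hu, norm_one, mul_one, Real.log_div (by positivity) hu',
      Real.log_mul hc.ne' (by positivity)]
    simp [hf₁]
    ring
  have hc₂ : ContDiffAt ℝ 2 (f₁ - fun w : ℂ => Real.log ‖w‖) w := hc₁.sub hharm.1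
  rw [(laplacian_congr_nhds hev).eq_of_nhds, contDiffAt_const.laplacian_add hc₂, hc₁.laplacian_sub hharm.1,
    hharm.2.eq_of_nhds, hf₁, laplacian_log_two_add_norm_sq hq, (hasDerivAt_sub_inv hw).deriv]
  simp
  ring

/-- The density, in the coordinate `q`, of the pull-back of the area of the sphere. -/
def sphereDensity (q : ℂ) : ℝ := 8 / (2 + ‖q‖ ^ 2) ^ 2

lemma integrable_sphereDensity : Integrable sphereDensity := by
  have h := (integrable_rpow_neg_one_add_norm_sq (E := ℂ) (μ := volume) (r := 4)
    (by rw [Complex.finrank_real_complex]; norm_num)).const_mul 8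
  refine h.mono' ?_ (Eventually.of_forall fun q => ?_)
  · refine Continuous.aestronglyMeasurable ?_
    unfold sphereDensity
    exact continuous_const.div (by fun_prop) fun q => by positivity
  · have : (1 + ‖q‖ ^ 2) ^ (-(4 : ℝ) / 2) = ((1 + ‖q‖ ^ 2) ^ 2)⁻¹ := by
      rw [show (-(4 : ℝ) / 2) = -((2 : ℕ) : ℝ) by norm_num, Real.rpow_neg (by positivity),
        Real.rpow_natCast]
    rw [this, sphereDensity, Real.norm_of_nonneg (by positivity), div_eq_mul_inv]
    gcongr
    norm_num

lemma integral_sphereDensity : ∫ q, sphereDensity q = 4 * Real.pi := by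
  have h := integral_fun_norm_addHaar (volume : Measure ℂ)
    (fun r : ℝ => 8 / (2 + r ^ 2) ^ 2)
  have hv : (volume : Measure ℂ).real (Metric.ball 0 1) = Real.pi := by
    rw [Measure.real, Complex.volume_ball]
    simp
  have hI : ∫ y in Set.Ioi (0 : ℝ), y * (8 / (2 + y ^ 2) ^ 2) = 2 := by
    rw [integral_Ioi_of_hasDerivAt_of_nonneg' (g := fun r : ℝ => -4 / (2 + r ^ 2)) (l := 0)]
    · norm_num
    · intro x _
      have h1 : HasDerivAt (fun r : ℝ => 2 + r ^ 2) (2 * x) x := by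
        simpa using (hasDerivAt_pow 2 x).const_add 2
      have h2 := (hasDerivAt_const x (-4 : ℝ)).div h1 (by positivity)
      convert! h2 using 1
      ring
    · intro x hx
      have : 0 < x := hx
      positivity
    · refine Tendsto.div_atTop tendsto_const_nhds ?_
      exact tendsto_atTop_add_const_left _ _ (tendsto_pow_atTop two_ne_zero)
  unfold sphereDensity
  rw [h, hv, Complex.finrank_real_complex]
  simp only [Nat.add_one_sub_one, pow_one, smul_eq_mul, hI, nsmul_eq_mul]
  push_cast
  ring

lemma det_restrictScalars_mul (a : ℂ) :
    ((ContinuousLinearMap.toSpanSingleton ℂ a).restrictScalars ℝ).det = ‖a‖ ^ 2 := by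
  rw [Complex.sq_norm, ← Algebra.norm_complex_apply, Algebra.norm_apply, ContinuousLinearMap.det]
  congr 1
  ext
  simp [mul_comm]

/-- A region of the `w`-plane which `q = w - w⁻¹` maps injectively onto a set of full measure
carries the area of one sphere. -/
lemma integral_sphereDensity_comp {S : Set ℂ} (hS : MeasurableSet S) (h0 : ∀ w ∈ S, w ≠ 0)
    (hinj : Set.InjOn (fun w : ℂ => w - w⁻¹) S)
    (hsurj : ∀ q : ℂ, q.re ≠ 0 → q ∈ (fun w : ℂ => w - w⁻¹) '' S) :
    IntegrableOn (fun w : ℂ => ‖1 + (w ^ 2)⁻¹‖ ^ 2 * (8 / (2 + ‖w - w⁻¹‖ ^ 2) ^ 2)) S ∧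
      ∫ w in S, ‖1 + (w ^ 2)⁻¹‖ ^ 2 * (8 / (2 + ‖w - w⁻¹‖ ^ 2) ^ 2) = 4 * Real.pi := by
  have hder : ∀ w ∈ S, HasFDerivWithinAt (fun w : ℂ => w - w⁻¹)
      ((ContinuousLinearMap.toSpanSingleton ℂ (1 + (w ^ 2)⁻¹)).restrictScalars ℝ) S w :=
    fun w hw => ((hasDerivAt_sub_inv (h0 w hw)).hasFDerivAt.restrictScalars ℝ).hasFDerivWithinAt
  have hae : (fun w : ℂ => w - w⁻¹) '' S =ᵐ[volume] (Set.univ : Set ℂ) := by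
    rw [ae_eq_univ]
    refine measure_mono_null (t := ((LinearMap.ker Complex.reLm : Submodule ℝ ℂ) : Set ℂ))
      (fun q hq => ?_) (Measure.addHaar_submodule _ _ fun h => ?_)
    · by_contra hre
      exact hq (hsurj q fun h => hre (by simpa using h))
    · have : (1 : ℂ) ∈ LinearMap.ker Complex.reLm := by rw [h]; trivial
      simp at this
  have habs : (fun w : ℂ => ‖1 + (w ^ 2)⁻¹‖ ^ 2 * (8 / (2 + ‖w - w⁻¹‖ ^ 2) ^ 2))
      = fun w => |((ContinuousLinearMap.toSpanSingleton ℂ (1 + (w ^ 2)⁻¹)).restrictScalars ℝ).det|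
        • sphereDensity (w - w⁻¹) := by
    funext w
    rw [det_restrictScalars_mul, abs_of_nonneg (by positivity), smul_eq_mul, sphereDensity]
  rw [habs]
  refine ⟨(integrableOn_image_iff_integrableOn_abs_det_fderiv_smul volume hS hder hinj _).1
    integrable_sphereDensity.integrableOn, ?_⟩
  rw [← integral_image_eq_integral_abs_det_fderiv_smul volume hS hder hinj,
    setIntegral_congr_set hae, setIntegral_univ, integral_sphereDensity]

lemma sub_inv_eq_iff {w v : ℂ} (hw : w ≠ 0) (hv : v ≠ 0) (h : w - w⁻¹ = v - v⁻¹) :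
    w = v ∨ w * v = -1 := by
  have : (w - v) * (w * v + 1) = 0 := by
    field_simp at h
    linear_combination h
  rcases mul_eq_zero.1 this with h | h
  · exact Or.inl (sub_eq_zero.1 h)
  · exact Or.inr (by linear_combination h)

/-- Off the imaginary axis the two solutions `w`, `-w⁻¹` of `w - w⁻¹ = q` do not lie on the unit
circle. -/
lemma exists_sub_inv_eq {q : ℂ} (hq : q.re ≠ 0) : ∃ w : ℂ, 1 < ‖w‖ ∧ w - w⁻¹ = q := by
  obtain ⟨s, hs⟩ := IsAlgClosed.exists_pow_nat_eq (q ^ 2 + 4) two_pos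
  set w := (q + s) / 2 with hw
  have hroot : w ^ 2 - q * w - 1 = 0 := by
    rw [hw]; linear_combination hs / 4
  have hw0 : w ≠ 0 := by
    intro h
    rw [h] at hroot
    norm_num at hroot
  have hwq : w - w⁻¹ = q := by
    field_simp
    linear_combination hroot
  rcases lt_trichotomy ‖w‖ 1 with h | h | h
  · refine ⟨-w⁻¹, ?_, ?_⟩
    · rw [norm_neg, norm_inv]
      exact (one_lt_inv₀ (norm_pos_iff.2 hw0)).2 h
    · rw [← hwq, inv_neg, inv_inv]
      ring
  · exfalso
    apply hq
    have : w⁻¹ = starRingEnd ℂ w := Complex.inv_eq_conj h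
    rw [← hwq, this]
    simp
  · exact ⟨w, h, hwq⟩

/-- Both the outside and the punctured inside of the unit circle carry the area of one sphere, since
`w ↦ -w⁻¹`, the other solution of `w - w⁻¹ = q`, exchanges them. -/
lemma surf_hasTotalCurvature {c : ℝ} (hc : 0 < c) :
    HasTotalCurvature (surf c) {0}ᶜ (-8 * Real.pi) := by
  set S₁ : Set ℂ := {w | 1 < ‖w‖} with hS₁
  set S₂ : Set ℂ := {w | ‖w‖ < 1 ∧ w ≠ 0} with hS₂
  set G : ℂ → ℝ := fun w => ‖1 + (w ^ 2)⁻¹‖ ^ 2 * (8 / (2 + ‖w - w⁻¹‖ ^ 2) ^ 2) with hG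
  have hne₁ : ∀ w ∈ S₁, w ≠ 0 := by
    rintro w hw rfl
    have : (1 : ℝ) < ‖(0 : ℂ)‖ := hw
    norm_num at this
  have hm₁ : MeasurableSet S₁ := (isOpen_lt continuous_const continuous_norm).measurableSet
  have hm₂ : MeasurableSet S₂ :=
    ((isOpen_lt continuous_norm continuous_const).inter isOpen_ne).measurableSet
  have h₁ := integral_sphereDensity_comp (S := S₁) hm₁ hne₁
    (fun w hw v hv h => (sub_inv_eq_iff (hne₁ w hw) (hne₁ v hv) h).resolve_right fun h' => by
      have h2 := congrArg norm h'
      rw [norm_mul, norm_neg, norm_one] at h2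
      have : (1 : ℝ) < ‖w‖ := hw
      have : (1 : ℝ) < ‖v‖ := hv
      nlinarith)
    (fun q hq => by
      obtain ⟨w, hw, h⟩ := exists_sub_inv_eq hq
      exact ⟨w, hw, h⟩)
  have h₂ := integral_sphereDensity_comp (S := S₂) hm₂ (fun w hw => hw.2)
    (fun w hw v hv h => (sub_inv_eq_iff hw.2 hv.2 h).resolve_right fun h' => by
      have h2 := congrArg norm h'
      rw [norm_mul, norm_neg, norm_one] at h2
      have h3 := hw.1
      have h4 := hv.1
      nlinarith [norm_nonneg w, norm_nonneg v])
    (fun q hq => by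
      obtain ⟨w, hw, h⟩ := exists_sub_inv_eq hq
      have hw0 : w ≠ 0 := hne₁ w hw
      refine ⟨-w⁻¹, ⟨?_, neg_ne_zero.2 (inv_ne_zero hw0)⟩, ?_⟩
      · rw [norm_neg, norm_inv]
        exact inv_lt_one_of_one_lt₀ hw
      · simp only [inv_neg, inv_inv]
        rw [← h]
        ring)
  have hdisj : Disjoint S₁ S₂ := by
    rw [Set.disjoint_left]
    intro w h h'
    exact lt_asymm h h'.1
  have hae : ({0}ᶜ : Set ℂ) =ᵐ[volume] (S₁ ∪ S₂ : Set ℂ) := by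
    have hsub : S₁ ∪ S₂ ⊆ {0}ᶜ := Set.union_subset hne₁ fun w hw => hw.2
    refine EventuallyLE.antisymm ?_ (LE.le.eventuallyLE hsub)
    rw [ae_le_set]
    refine measure_mono_null (fun w hw => ?_) (Measure.addHaar_sphere volume (0 : ℂ) 1)
    rw [mem_sphere_zero_iff_norm]
    by_contra hw1
    rcases lt_or_gt_of_ne hw1 with h | h
    · exact hw.2 (Or.inr ⟨h, hw.1⟩)
    · exact hw.2 (Or.inl h)
  have hcurv : Set.EqOn (fun z => gaussCurvature (surf c) z * ‖fderiv ℝ (surf c) z 1‖ ^ 2)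
      (fun w => -G w) {0}ᶜ := fun w hw => gaussCurvature_surf hc hw
  have hm : MeasurableSet ({0}ᶜ : Set ℂ) := (measurableSet_singleton 0).compl
  refine ⟨?_, ?_⟩
  · rw [integrableOn_congr_fun hcurv hm, integrableOn_congr_set_ae hae]
    exact (h₁.1.union h₂.1).neg
  · rw [setIntegral_congr_fun hm hcurv, integral_neg, setIntegral_congr_set hae,
      setIntegral_union hdisj hm₂ h₁.1 h₂.1, h₁.2, h₂.2]
    ring

end MinimalAnnuli

namespace MinimalAnnuli

open Complex Filter Topology

/-! ### The ends -/

/-- In the coordinate `s = w²`, the horizontal-vertical projection `-2 (x₃ + i x₂)` of the surface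
of scale one. -/
def endMap (s : ℂ) : ℂ := s - (s⁻¹ + (4 * Real.log ‖s‖ : ℝ))

lemma abs_log_sub_log_le {a b : ℝ} (ha : 16 ≤ a) (hb : 16 ≤ b) :
    |Real.log a - Real.log b| ≤ |a - b| / 16 := by
  have key : ∀ {a b : ℝ}, 16 ≤ a → 16 ≤ b → Real.log a - Real.log b ≤ |a - b| / 16 := by
    intro a b ha hb
    have ha' : 0 < a := by linarith
    have hb' : 0 < b := by linarith
    rw [← Real.log_div ha'.ne' hb'.ne']
    calc Real.log (a / b) ≤ a / b - 1 := Real.log_le_sub_one_of_pos (by positivity)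
      _ = (a - b) / b := by field_simp
      _ ≤ |a - b| / b := by gcongr; exact le_abs_self _
      _ ≤ |a - b| / 16 := by gcongr
  rw [abs_le]
  have h1 := key ha hb
  have h2 := key hb ha
  rw [abs_sub_comm] at h2
  constructor <;> linarith

/-- Far out, `endMap` differs from the identity by a contraction. -/
lemma norm_error_sub_le {s t : ℂ} (hs : 16 ≤ ‖s‖) (ht : 16 ≤ ‖t‖) :
    ‖(s⁻¹ + (4 * Real.log ‖s‖ : ℝ)) - (t⁻¹ + (4 * Real.log ‖t‖ : ℝ))‖ ≤ 1 / 2 * ‖s - t‖ := by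
  have hs0 : s ≠ 0 := norm_pos_iff.1 (by linarith)
  have ht0 : t ≠ 0 := norm_pos_iff.1 (by linarith)
  have h1 : ‖s⁻¹ - t⁻¹‖ ≤ ‖s - t‖ / 16 := by
    rw [inv_sub_inv hs0 ht0, norm_div, norm_mul, norm_sub_rev]
    gcongr
    nlinarith
  have h2 : ‖((4 * Real.log ‖s‖ : ℝ) : ℂ) - (4 * Real.log ‖t‖ : ℝ)‖ ≤ ‖s - t‖ / 4 := by
    rw [← Complex.ofReal_sub, Complex.norm_real, Real.norm_eq_abs, ← mul_sub, abs_mul]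
    have := abs_log_sub_log_le hs ht
    have h3 := abs_norm_sub_norm_le s t
    rw [abs_of_pos (by norm_num : (0 : ℝ) < 4)]
    linarith
  calc _ = ‖(s⁻¹ - t⁻¹) + (((4 * Real.log ‖s‖ : ℝ) : ℂ) - (4 * Real.log ‖t‖ : ℝ))‖ := by
        congr 1; ring
    _ ≤ _ := norm_add_le _ _
    _ ≤ _ := by linarith [norm_nonneg (s - t)]

lemma injOn_endMap : Set.InjOn endMap {s | 16 ≤ ‖s‖} := by
  intro s hs t ht h
  have h1 := norm_error_sub_le hs ht
  have h2 : s - t = (s⁻¹ + (4 * Real.log ‖s‖ : ℝ)) - (t⁻¹ + (4 * Real.log ‖t‖ : ℝ)) := by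
    unfold endMap at h
    linear_combination h
  rw [← h2] at h1
  have h3 : ‖s - t‖ ≤ 0 := by linarith
  exact sub_eq_zero.1 (norm_le_zero_iff.1 h3)

/-- The error term `s⁻¹ + 4 log |s|` is small compared with `s`. -/
lemma exists_error_le : ∃ R : ℝ, 16 ≤ R ∧
    ∀ s : ℂ, R ≤ ‖s‖ → ‖s⁻¹ + (4 * Real.log ‖s‖ : ℝ)‖ ≤ ‖s‖ / 4 := by
  have h1 : ∀ᶠ r : ℝ in atTop, ‖Real.log r‖ ≤ 1 / 32 * ‖r‖ :=
    Real.isLittleO_log_id_atTop.bound (by norm_num)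
  obtain ⟨R, hR⟩ := eventually_atTop.1 h1
  refine ⟨max R 16, le_max_right _ _, fun s hs => ?_⟩
  have hs1 : R ≤ ‖s‖ := (le_max_left _ _).trans hs
  have hs2 : 16 ≤ ‖s‖ := (le_max_right _ _).trans hs
  have h2 := hR ‖s‖ hs1
  rw [norm_norm, Real.norm_eq_abs] at h2
  have h3 : ‖s⁻¹‖ ≤ 1 := by
    rw [norm_inv]
    exact inv_le_one_of_one_le₀ (by linarith)
  have h4 : ‖((4 * Real.log ‖s‖ : ℝ) : ℂ)‖ = 4 * |Real.log ‖s‖| := by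
    rw [Complex.norm_real, Real.norm_eq_abs, abs_mul, abs_of_pos (by norm_num : (0 : ℝ) < 4)]
  have := norm_add_le s⁻¹ ((4 * Real.log ‖s‖ : ℝ) : ℂ)
  linarith

/-- Far out, `endMap s = t` is solved by Banach's fixed point theorem on the disc of radius
`‖t‖ / 2` about `t`. -/
lemma exists_endMap_eq (r : ℝ) :
    ∃ R : ℝ, ∀ t : ℂ, R < ‖t‖ → ∃ s : ℂ, r < ‖s‖ ∧ 16 ≤ ‖s‖ ∧ endMap s = t := by
  obtain ⟨R₀, hR₀, hR⟩ := exists_error_le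
  refine ⟨max (2 * R₀) (2 * r), fun t ht => ?_⟩
  have ht1 : 2 * R₀ < ‖t‖ := (le_max_left _ _).trans_lt ht
  have ht2 : 2 * r < ‖t‖ := (le_max_right _ _).trans_lt ht
  set e : ℂ → ℂ := fun s => s⁻¹ + (4 * Real.log ‖s‖ : ℝ) with he
  set B := Metric.closedBall t (‖t‖ / 2) with hB
  have hfar : ∀ s ∈ B, ‖t‖ / 2 ≤ ‖s‖ := by
    intro s hs
    rw [hB, mem_closedBall_iff_norm'] at hs
    have := norm_sub_norm_le t s
    linarith
  have hmaps : Set.MapsTo (fun s => t + e s) B B := by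
    intro s hs
    have h1 := norm_error_sub_le (s := s) (t := t) (by linarith [hfar s hs]) (by linarith)
    have h2 := hR t (by linarith)
    rw [hB, mem_closedBall_iff_norm] at hs ⊢
    have h3 : ‖e s‖ ≤ ‖e s - e t‖ + ‖e t‖ := by
      simpa using norm_add_le (e s - e t) (e t)
    have h4 : ‖e s - e t‖ ≤ 1 / 2 * ‖s - t‖ := h1
    have h5 : ‖e t‖ ≤ ‖t‖ / 4 := h2
    rw [add_sub_cancel_left]
    linarith
  have hc : ContractingWith (1 / 2) (hmaps.restrict _ B B) := by
    refine ⟨by norm_num, LipschitzWith.of_dist_le_mul fun x y => ?_⟩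
    rw [Subtype.dist_eq, Subtype.dist_eq, dist_eq_norm, dist_eq_norm]
    have := norm_error_sub_le (s := x) (t := y) (by linarith [hfar x x.2])
      (by linarith [hfar y y.2])
    simpa [he] using this
  obtain ⟨s, hs, hfix, -⟩ := hc.exists_fixedPoint' Metric.isClosed_closedBall.isComplete hmaps
    (x := t) (Metric.mem_closedBall_self (by positivity)) (edist_ne_top _ _)
  refine ⟨s, by linarith [hfar s hs], by linarith [hfar s hs], ?_⟩
  have h : t + e s = s := hfix
  simp only [endMap]
  linear_combination -h

lemma encard_sq_eq {s : ℂ} (hs : s ≠ 0) : {w : ℂ | w ^ 2 = s}.encard = 2 := by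
  obtain ⟨u, hu⟩ := IsAlgClosed.exists_pow_nat_eq s two_pos
  have hu0 : u ≠ 0 := by
    rintro rfl
    exact hs (by simpa using hu.symm)
  have : {w : ℂ | w ^ 2 = s} = {u, -u} := by
    ext w
    simp only [Set.mem_ofPred_eq, Set.mem_insert_iff, Set.mem_singleton_iff]
    rw [← hu, sq_eq_sq_iff_eq_or_eq_neg]
  rw [this]
  refine Set.encard_pair fun h => hu0 ?_
  linear_combination h / 2

lemma encard_endMap_sq_of_cobounded {V : Set ℂ} (hV : V ∈ Bornology.cobounded ℂ)
    (hVU : ∀ w ∈ V, 4 < ‖w‖) :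
    ∃ R : ℝ, ∀ t : ℂ, R < ‖t‖ → {w ∈ V | endMap (w ^ 2) = t}.encard = 2 := by
  obtain ⟨ρ, -, hρ⟩ := (hasBasis_cobounded_norm (E := ℂ)).mem_iff.1 hV
  obtain ⟨R, hR⟩ := exists_endMap_eq (ρ ^ 2)
  refine ⟨R, fun t ht => ?_⟩
  obtain ⟨s, hs1, hs2, hst⟩ := hR t ht
  have hs0 : s ≠ 0 := norm_pos_iff.1 (by linarith)
  rw [← encard_sq_eq hs0]
  congr 1
  ext w
  constructor
  · rintro ⟨hw, h⟩
    refine injOn_endMap ?_ hs2 (h.trans hst.symm)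
    have := hVU w hw
    show 16 ≤ ‖w ^ 2‖
    rw [norm_pow]
    nlinarith
  · intro hw
    have hw' : w ^ 2 = s := hw
    refine ⟨hρ ?_, by rw [hw', hst]⟩
    rw [← hw', norm_pow] at hs1
    exact (lt_of_pow_lt_pow_left₀ 2 (norm_nonneg w) hs1).le

lemma tendsto_endMap_sq_cobounded :
    Tendsto (fun w : ℂ => ‖endMap (w ^ 2)‖) (Bornology.cobounded ℂ) atTop := by
  have h1 : Tendsto (fun w : ℂ => ‖w ^ 2‖) (Bornology.cobounded ℂ) atTop := by
    simp only [norm_pow]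
    exact (tendsto_pow_atTop two_ne_zero).comp tendsto_norm_cobounded_atTop
  obtain ⟨R, -, hR⟩ := exists_error_le
  refine tendsto_atTop_mono' _ ?_ (h1.atTop_mul_const (r := 1 / 2) (by norm_num))
  filter_upwards [h1.eventually_ge_atTop R] with w hw
  have h2 := hR _ hw
  have h3 := norm_sub_norm_le (w ^ 2) ((w ^ 2)⁻¹ + (4 * Real.log ‖w ^ 2‖ : ℝ))
  unfold endMap
  linarith [norm_nonneg (w ^ 2)]

/-- The inversion `w ↦ w⁻¹` exchanges the two ends. -/
lemma endMap_inv_sq (w : ℂ) : endMap (w⁻¹ ^ 2) = -endMap (w ^ 2) := by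
  unfold endMap
  rw [← inv_pow, inv_inv, norm_pow, norm_pow, norm_inv, Real.log_pow, Real.log_pow, Real.log_inv]
  push_cast
  ring

lemma surf_two_eq (c : ℝ) (w : ℂ) : surf c w 2 = -(c / 2) * (endMap (w ^ 2)).re := by
  have : surf c w 2 = c * (4 * Real.log ‖w‖ - (w ^ 2 - w⁻¹ ^ 2).re / 2) := rfl
  rw [this, endMap, norm_pow, Real.log_pow, inv_pow]
  simp only [Complex.sub_re, Complex.add_re, Complex.ofReal_re]
  push_cast
  ring

lemma surf_one_eq (c : ℝ) (w : ℂ) : surf c w 1 = -(c / 2) * (endMap (w ^ 2)).im := by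
  have : surf c w 1 = c * (-(w ^ 2 - w⁻¹ ^ 2).im / 2) := rfl
  rw [this, endMap, norm_pow, Real.log_pow, inv_pow]
  simp only [Complex.sub_im, Complex.add_im, Complex.ofReal_im]
  ring

/-- The plane of projection is spanned by the `x₃`- and the `x₂`-axis, in which the projection is a
multiple of `endMap (w ^ 2)`. -/
lemma hasEndOfMultiplicity_surf {c : ℝ} (hc : 0 < c) {l : Filter ℂ} {U : Set ℂ} (hU : U ∈ l)
    (hl : Tendsto (fun w : ℂ => ‖endMap (w ^ 2)‖) l atTop)
    (hcard : ∀ V ∈ l, V ⊆ U →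
      ∃ R : ℝ, ∀ t : ℂ, R < ‖t‖ → {w ∈ V | endMap (w ^ 2) = t}.encard = 2) :
    HasEndOfMultiplicity (surf c) l 2 := by
  have h0 : ∀ v : E3, inner ℝ (EuclideanSpace.single (2 : Fin 3) (1 : ℝ)) v = v 2 := by
    intro v
    rw [EuclideanSpace.inner_single_left]
    simp
  have h1 : ∀ v : E3, inner ℝ (EuclideanSpace.single (1 : Fin 3) (1 : ℝ)) v = v 1 := by
    intro v
    rw [EuclideanSpace.inner_single_left]
    simp
  refine ⟨![EuclideanSpace.single 2 1, EuclideanSpace.single 1 1], ?_, ?_, U, hU, ?_⟩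
  · refine ⟨fun i => ?_, fun i j hij => ?_⟩
    · fin_cases i <;> simp
    · fin_cases i <;> fin_cases j <;> simp [h0, h1] at hij ⊢
  · simp only [Matrix.cons_val_zero, Matrix.cons_val_one, h0, h1, surf_one_eq, surf_two_eq]
    have : ∀ w : ℂ, (-(c / 2) * (endMap (w ^ 2)).re) ^ 2 + (-(c / 2) * (endMap (w ^ 2)).im) ^ 2
        = (c / 2) ^ 2 * ‖endMap (w ^ 2)‖ ^ 2 := by
      intro w
      rw [Complex.sq_norm, Complex.normSq_apply]
      ring
    simp only [this]
    exact ((tendsto_pow_atTop two_ne_zero).comp hl).const_mul_atTop (by positivity)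
  · intro V hV hVU
    obtain ⟨R, hR⟩ := hcard V hV hVU
    refine ⟨(c / 2) ^ 2 * R ^ 2, fun a b hab => ?_⟩
    simp only [Matrix.cons_val_zero, Matrix.cons_val_one, h0, h1, surf_one_eq, surf_two_eq]
    set t : ℂ := ⟨-(2 / c) * a, -(2 / c) * b⟩ with ht
    have hnorm : R < ‖t‖ := by
      refine lt_of_pow_lt_pow_left₀ 2 (norm_nonneg _) ?_
      rw [Complex.sq_norm, Complex.normSq_apply, ht]
      have : -(2 / c) * a * (-(2 / c) * a) + -(2 / c) * b * (-(2 / c) * b)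
          = (a ^ 2 + b ^ 2) / (c / 2) ^ 2 := by
        field_simp
      rw [this, lt_div_iff₀ (by positivity)]
      linarith
    rw [Nat.cast_ofNat, ← hR t hnorm]
    congr 1
    ext w
    simp only [Set.mem_ofPred_eq]
    refine and_congr_right fun _ => ?_
    rw [Complex.ext_iff, ht]
    simp only
    constructor
    · rintro ⟨h2, h3⟩
      rw [← h2, ← h3]
      constructor <;> field_simp
    · rintro ⟨h2, h3⟩
      rw [h2, h3]
      constructor <;> field_simp

lemma surf_hasEnd_cobounded {c : ℝ} (hc : 0 < c) :
    HasEndOfMultiplicity (surf c) (Bornology.cobounded ℂ) 2 :=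
  hasEndOfMultiplicity_surf hc (U := {w | 4 < ‖w‖})
    (tendsto_norm_cobounded_atTop.eventually_gt_atTop 4) tendsto_endMap_sq_cobounded
    fun _ hV hVU => encard_endMap_sq_of_cobounded hV hVU

lemma surf_hasEnd_zero {c : ℝ} (hc : 0 < c) :
    HasEndOfMultiplicity (surf c) (𝓝[≠] 0) 2 := by
  have hinv : Tendsto (fun w : ℂ => w⁻¹) (𝓝[≠] 0) (Bornology.cobounded ℂ) :=
    tendsto_inv₀_nhdsNE_zero
  refine hasEndOfMultiplicity_surf hc (U := {w | 4 < ‖w⁻¹‖})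
    ((tendsto_norm_cobounded_atTop.comp hinv).eventually_gt_atTop 4) ?_ fun V hV hVU => ?_
  · refine (tendsto_endMap_sq_cobounded.comp hinv).congr fun w => ?_
    simp only [Function.comp_apply, endMap_inv_sq, norm_neg]
  · have hV' : (fun w : ℂ => w⁻¹) ⁻¹' V ∈ Bornology.cobounded ℂ :=
      tendsto_inv₀_cobounded' hV
    obtain ⟨R, hR⟩ := encard_endMap_sq_of_cobounded hV' fun w hw => by
      have := hVU hw
      simpa using this
    refine ⟨R, fun t ht => ?_⟩
    rw [← hR (-t) (by rwa [norm_neg]),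
      ← (inv_injective (G := ℂ)).encard_image {w ∈ (fun w : ℂ => w⁻¹) ⁻¹' V | _}]
    congr 1
    ext w
    constructor
    · rintro ⟨hw, h⟩
      refine ⟨w⁻¹, ⟨?_, ?_⟩, inv_inv w⟩
      · simpa using hw
      · rw [endMap_inv_sq, h]
    · rintro ⟨u, ⟨hu, h⟩, rfl⟩
      refine ⟨hu, ?_⟩
      rw [endMap_inv_sq, h, neg_neg]

end MinimalAnnuli

namespace MinimalAnnuli

open Complex Filter Topology InnerProductSpace MeasureTheory

/-! ### The annulus in the parameter that makes the level curves circles -/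

/-- The change of parameter `z ↦ w`: the inverse of `w ↦ w exp ((w⁻² - w²) / 8)` near the unit
circle. -/
def reparam (z : ℂ) : ℂ := exp (logInv (log z))

/-- The minimal annulus, whose height at `z` is `4 c log |z|`. -/
def ann (c : ℝ) (z : ℂ) : E3 := surf c (reparam z)

lemma openStrip_le {τ : ℂ} (hτ : τ ∈ openStrip) : |τ.re| ≤ 1 / 10 := le_of_lt hτ

lemma reparam_exp {τ : ℂ} (hτ : |τ.re| ≤ 1 / 10) : reparam (exp τ) = exp (logInv τ) := by
  obtain ⟨n, hn⟩ := Complex.exp_eq_exp_iff_exists_int.1 (exp_log (exp_ne_zero τ))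
  rw [reparam, hn, logInv_add_int hτ]
  exact Complex.exp_periodic.int_mul n _

lemma ann_exp (c : ℝ) {τ : ℂ} (hτ : |τ.re| ≤ 1 / 10) :
    ann c (exp τ) = reE3 (surfLift c (logInv τ)) := by
  rw [ann, reparam_exp hτ, surf_exp]

lemma ann_exp_two (c : ℝ) {τ : ℂ} (hτ : |τ.re| ≤ 1 / 10) :
    ann c (exp τ) 2 = 4 * c * τ.re := by
  rw [ann_exp c hτ, reE3_apply]
  simp [surfLift, logHeight_logInv hτ]
  ring

/-- A point of an annulus is the exponential of a point of a vertical strip. -/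
lemma exists_exp_eq_of_mem {z : ℂ} {t : ℝ} (h1 : Real.exp (-t) < ‖z‖) (h2 : ‖z‖ < Real.exp t) :
    ∃ τ : ℂ, exp τ = z ∧ |τ.re| < t := by
  have hz : 0 < ‖z‖ := (Real.exp_pos _).trans h1
  refine ⟨log z, exp_log (norm_pos_iff.1 hz), ?_⟩
  rw [Complex.log_re, abs_lt]
  exact ⟨(Real.lt_log_iff_exp_lt hz).2 h1, (Real.log_lt_iff_lt_exp hz).2 h2⟩

lemma differentiableAt_reparam {τ : ℂ} (hτ : τ ∈ openStrip) :
    DifferentiableAt ℂ reparam (exp τ) := by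
  refine (hasDerivAt_of_comp_exp (g := fun s => exp (logInv s)) ((hasDerivAt_logInv hτ).cexp)
    ?_).differentiableAt
  filter_upwards [isOpen_openStrip.mem_nhds hτ] with s hs using reparam_exp (openStrip_le hs)

lemma reparam_injOn {t : ℝ} (ht : t ≤ 1 / 10) :
    Set.InjOn reparam (annulus (Real.exp (-t)) (Real.exp t)) := by
  rintro z ⟨hz1, hz2⟩ z' ⟨hz1', hz2'⟩ h
  obtain ⟨τ, rfl, hτ⟩ := exists_exp_eq_of_mem hz1 hz2
  obtain ⟨σ, rfl, hσ⟩ := exists_exp_eq_of_mem hz1' hz2'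
  have hτ' : |τ.re| ≤ 1 / 10 := by linarith
  have hσ' : |σ.re| ≤ 1 / 10 := by linarith
  rw [reparam_exp hτ', reparam_exp hσ'] at h
  obtain ⟨n, hn⟩ := Complex.exp_eq_exp_iff_exists_int.1 h
  have h1 : τ = σ + n * (2 * Real.pi * I) := by
    rw [← logHeight_logInv hτ', hn, logHeight_add_int, logHeight_logInv hσ']
  rw [h1]
  exact Complex.exp_periodic.int_mul n _

/-- The parameter `m = √2 sinh ζ`, in which the Gauss map is `(1 - m) / (1 + m)`. -/
def gaussParam (τ : ℂ) : ℂ := √2 * sinh (logInv τ)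

/-- The logarithm of the Gauss map, in the coordinate `τ = log z`. -/
def logGauss (τ : ℂ) : ℂ := log (1 - gaussParam τ) - log (1 + gaussParam τ)

/-- In the strip, `|Re m|` is less than `1`, so that `1 - m` and `1 + m` have principal logarithms. -/
lemma abs_re_gaussParam_lt (τ : ℂ) : |(gaussParam τ).re| < 1 := by
  set ζ := logInv τ with hζ
  have hre : (gaussParam τ).re = √2 * (Real.sinh ζ.re * Real.cos ζ.im) := by
    have h : ζ = (ζ.re : ℂ) + (ζ.im : ℂ) * I := (Complex.re_add_im ζ).symm
    rw [gaussParam, ← hζ, h, Complex.sinh_add, Complex.sinh_mul_I, Complex.cosh_mul_I]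
    simp [← Complex.ofReal_sinh, ← Complex.ofReal_cosh, ← Complex.ofReal_sin,
      ← Complex.ofReal_cos]
  have h1 := cosh_two_mul_re_lt (logInv_mem τ)
  rw [← hζ, Real.cosh_two_mul, Real.cosh_sq] at h1
  have h2 : Real.cos ζ.im ^ 2 ≤ 1 := Real.cos_sq_le_one _
  rw [← sq_lt_one_iff_abs_lt_one, hre, mul_pow, mul_pow, Real.sq_sqrt (by norm_num)]
  nlinarith [sq_nonneg (Real.sinh ζ.re), sq_nonneg (Real.cos ζ.im)]

lemma one_sub_gaussParam_mem (τ : ℂ) : 1 - gaussParam τ ∈ slitPlane := by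
  left
  have := (abs_lt.1 (abs_re_gaussParam_lt τ)).2
  simp
  linarith

lemma one_add_gaussParam_mem (τ : ℂ) : 1 + gaussParam τ ∈ slitPlane := by
  left
  have := (abs_lt.1 (abs_re_gaussParam_lt τ)).1
  simp
  linarith

lemma exp_logGauss (τ : ℂ) : exp (logGauss τ) = (1 - gaussParam τ) / (1 + gaussParam τ) := by
  rw [logGauss, exp_sub, exp_log (slitPlane_ne_zero (one_sub_gaussParam_mem τ)),
    exp_log (slitPlane_ne_zero (one_add_gaussParam_mem τ))]

lemma one_sub_cosh_eq (τ : ℂ) :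
    1 - cosh (2 * logInv τ) / 2 = (1 - gaussParam τ) * (1 + gaussParam τ) / 2 := by
  rw [Complex.cosh_two_mul, Complex.cosh_sq, gaussParam]
  linear_combination sinh (logInv τ) ^ 2 / 2 * sqrt_two_sq

/-- The velocity of the holomorphic null curve in the coordinate `τ = log z`: the height
differential is constant, and `L = logGauss` is the logarithm of the Gauss map. -/
def annPhi (c : ℝ) (τ : ℂ) : Fin 3 → ℂ :=
  (4 * c : ℂ) • ![-sinh (logGauss τ), I * cosh (logGauss τ), 1]

lemma annPhi_eq (c : ℝ) (τ : ℂ) :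
    annPhi c τ = (1 - cosh (2 * logInv τ) / 2)⁻¹ • surfLiftDeriv c (logInv τ) := by
  have h1 := slitPlane_ne_zero (one_sub_gaussParam_mem τ)
  have h2 := slitPlane_ne_zero (one_add_gaussParam_mem τ)
  have h3 : (4 * √2 * sinh (logInv τ) : ℂ) = 4 * gaussParam τ := by rw [gaussParam]; ring
  have h4 : 2 * cosh (2 * logInv τ) = 2 + 2 * gaussParam τ ^ 2 := by
    linear_combination (-4) * one_sub_cosh_eq τ
  unfold annPhi surfLiftDeriv
  rw [h3, h4, one_sub_cosh_eq, Complex.sinh, Complex.cosh, Complex.exp_neg, exp_logGauss]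
  ext k
  fin_cases k <;> simp <;> field_simp <;> ring

lemma hasDerivAt_annLift (c : ℝ) {τ : ℂ} (hτ : τ ∈ openStrip) :
    HasDerivAt (fun s => surfLift c (logInv s)) (annPhi c τ) τ := by
  rw [annPhi_eq]
  exact (hasDerivAt_surfLift c _).scomp τ (hasDerivAt_logInv hτ)

lemma ann_isReHolomorphicAt (c : ℝ) {τ : ℂ} (hτ : τ ∈ openStrip) :
    IsReHolomorphicAt (ann c) ((exp τ)⁻¹ • annPhi c τ) (exp τ) := by
  refine IsReHolomorphicAt.of_exp (F := fun s => surfLift c (logInv s)) ?_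
    (hasDerivAt_annLift c hτ) ?_
  · exact DifferentiableOn.analyticAt (s := openStrip)
      (fun s hs => (hasDerivAt_annLift c hs).differentiableAt.differentiableWithinAt)
      (isOpen_openStrip.mem_nhds hτ)
  · filter_upwards [isOpen_openStrip.mem_nhds hτ] with s hs using ann_exp c (openStrip_le hs)

lemma annPhi_null (c : ℝ) (τ : ℂ) :
    annPhi c τ 0 ^ 2 + annPhi c τ 1 ^ 2 + annPhi c τ 2 ^ 2 = 0 := by
  simp only [annPhi, Pi.smul_apply, smul_eq_mul, Matrix.cons_val_zero, Matrix.cons_val_one,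
    Matrix.cons_val]
  linear_combination (-(4 * c : ℂ) ^ 2) * Complex.cosh_sq_sub_sinh_sq (logGauss τ) +
    (4 * c : ℂ) ^ 2 * cosh (logGauss τ) ^ 2 * I_sq

lemma norm_sinh_sq_add_norm_cosh_sq (z : ℂ) :
    ‖sinh z‖ ^ 2 + ‖cosh z‖ ^ 2 + 1 = 2 * Real.cosh z.re ^ 2 := by
  have h : z = (z.re : ℂ) + (z.im : ℂ) * I := (Complex.re_add_im z).symm
  conv_lhs => rw [h, Complex.sinh_add, Complex.cosh_add, Complex.sinh_mul_I, Complex.cosh_mul_I]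
  simp only [← Complex.ofReal_sinh, ← Complex.ofReal_cosh, ← Complex.ofReal_sin,
    ← Complex.ofReal_cos, Complex.sq_norm, Complex.normSq_apply]
  have h1 := Real.sin_sq_add_cos_sq z.im
  have h2 := Real.cosh_sq z.re
  generalize Real.sin z.im = a at h1 ⊢
  generalize Real.cos z.im = b at h1 ⊢
  generalize Real.sinh z.re = u at h2 ⊢
  generalize Real.cosh z.re = v at h2 ⊢
  simp
  linear_combination (u ^ 2 + v ^ 2) * h1 - h2

lemma norm_reE3_smul_annPhi {c : ℝ} (hc : 0 < c) (τ v : ℂ) :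
    ‖reE3 (v • annPhi c τ)‖ = 4 * c * Real.cosh (logGauss τ).re * ‖v‖ := by
  have hcosh := Real.cosh_pos (logGauss τ).re
  rw [← sq_eq_sq₀ (norm_nonneg _) (by positivity), norm_reE3_smul_sq (annPhi_null c τ)]
  simp only [annPhi, Pi.smul_apply, smul_eq_mul, Matrix.cons_val_zero, Matrix.cons_val_one,
    Matrix.cons_val, norm_mul, norm_neg, norm_I, Complex.norm_real, Complex.norm_ofNat,
    Real.norm_eq_abs, abs_of_pos hc, one_mul, mul_one]
  linear_combination ‖v‖ ^ 2 * (4 * c) ^ 2 / 2 * norm_sinh_sq_add_norm_cosh_sq (logGauss τ)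

lemma fderiv_ann_exp (c : ℝ) {τ : ℂ} (hτ : τ ∈ openStrip) (v : ℂ) :
    fderiv ℝ (ann c) (exp τ) (exp τ * v) = reE3 (v • annPhi c τ) := by
  rw [(ann_isReHolomorphicAt c hτ).fderiv_apply, smul_smul, mul_comm (exp τ) v, mul_assoc,
    mul_inv_cancel₀ (exp_ne_zero τ), mul_one]

lemma ann_minimal {c : ℝ} (hc : 0 < c) {D : Set ℂ}
    (hD : ∀ z ∈ D, ∃ τ ∈ openStrip, exp τ = z) : IsConformalMinimalImmersion (ann c) D := by
  choose! l hl hexp using hD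
  refine isConformalMinimalImmersion_of_isReHolomorphicAt
    (fun z => z⁻¹ • annPhi c (l z)) (fun z hz => ?_) (fun z hz => ?_) fun z hz h => ?_
  · have := ann_isReHolomorphicAt c (hl z hz)
    rwa [hexp z hz] at this
  · simp only [Pi.smul_apply, smul_eq_mul]
    linear_combination z⁻¹ ^ 2 * annPhi_null c (l z)
  · have hz0 : z ≠ 0 := by
      rw [← hexp z hz]
      exact exp_ne_zero _
    have h2 := congrFun h 2
    simp [annPhi, hz0, hc.ne'] at h2

section Annulus

variable {c t₀ : ℝ}

lemma exists_openStrip_exp_eq (ht₀ : t₀ ≤ 1 / 10) {z : ℂ}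
    (hz : z ∈ annulus (Real.exp (-t₀)) (Real.exp t₀)) :
    ∃ τ ∈ openStrip, exp τ = z := by
  obtain ⟨τ, h, hτ⟩ := exists_exp_eq_of_mem hz.1 hz.2
  exact ⟨τ, lt_of_lt_of_le hτ ht₀, h⟩

lemma ann_two (ht₀ : t₀ ≤ 1 / 10) {z : ℂ} (h1 : Real.exp (-t₀) ≤ ‖z‖) (h2 : ‖z‖ ≤ Real.exp t₀) :
    ann c z 2 = 4 * c * Real.log ‖z‖ := by
  have hz : 0 < ‖z‖ := (Real.exp_pos _).trans_le h1
  have h : |(log z).re| ≤ 1 / 10 := by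
    rw [Complex.log_re]
    refine le_trans ?_ ht₀
    rw [abs_le]
    exact ⟨(Real.le_log_iff_exp_le hz).2 h1, (Real.log_le_iff_le_exp hz).2 h2⟩
  have := ann_exp_two c h
  rwa [exp_log (norm_pos_iff.1 hz), Complex.log_re] at this

lemma continuousAt_ann (ht₀ : t₀ < 1 / 10) {z : ℂ} (h1 : Real.exp (-t₀) ≤ ‖z‖)
    (h2 : ‖z‖ ≤ Real.exp t₀) : ContinuousAt (ann c) z := by
  have hz : 0 < ‖z‖ := (Real.exp_pos _).trans_le h1
  have h : log z ∈ openStrip := by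
    show |(log z).re| < 1 / 10
    rw [Complex.log_re]
    refine lt_of_le_of_lt ?_ ht₀
    rw [abs_le]
    exact ⟨(Real.le_log_iff_exp_le hz).2 h1, (Real.log_le_iff_le_exp hz).2 h2⟩
  have := (ann_isReHolomorphicAt c h).hasFDerivAt.continuousAt
  rwa [exp_log (norm_pos_iff.1 hz)] at this

/-- The closed annulus. -/
def closedAnnulus (R₀ R₁ : ℝ) : Set ℂ := {z | R₀ ≤ ‖z‖ ∧ ‖z‖ ≤ R₁}

lemma isCompact_closedAnnulus (R₀ R₁ : ℝ) : IsCompact (closedAnnulus R₀ R₁) := by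
  refine (isCompact_closedBall (0 : ℂ) R₁).of_isClosed_subset ?_ ?_
  · exact (isClosed_le continuous_const continuous_norm).inter
      (isClosed_le continuous_norm continuous_const)
  · intro w hw
    simpa using hw.2

lemma continuousOn_ann (ht₀ : t₀ < 1 / 10) :
    ContinuousOn (ann c) (closedAnnulus (Real.exp (-t₀)) (Real.exp t₀)) := fun _ hz =>
  (continuousAt_ann ht₀ hz.1 hz.2).continuousWithinAt

/-- On the closed annulus, the open annulus is the part strictly between the two planes. -/
lemma mem_annulus_iff_ann_mem_slab (hc : 0 < c) (ht₀ : t₀ < 1 / 10) {z : ℂ}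
    (hz : z ∈ closedAnnulus (Real.exp (-t₀)) (Real.exp t₀)) :
    z ∈ annulus (Real.exp (-t₀)) (Real.exp t₀) ↔ ann c z ∈ slab (-(4 * c * t₀)) (4 * c * t₀) := by
  have hz0 : 0 < ‖z‖ := (Real.exp_pos _).trans_le hz.1
  have h4 : 0 < 4 * c := by linarith
  simp only [annulus, slab, Set.mem_ofPred_eq, ann_two ht₀.le hz.1 hz.2,
    ← Real.lt_log_iff_exp_lt hz0, ← Real.log_lt_iff_lt_exp hz0]
  rw [← mul_neg, mul_lt_mul_iff_right₀ h4, mul_lt_mul_iff_right₀ h4]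

lemma annulus_subset_closedAnnulus (R₀ R₁ : ℝ) : annulus R₀ R₁ ⊆ closedAnnulus R₀ R₁ :=
  fun _ hz => ⟨hz.1.le, hz.2.le⟩

lemma mem_closure_annulus (ht : 0 < t₀) {s : ℝ} (hs : s ∈ Set.Icc (-t₀) t₀) :
    ((Real.exp s : ℝ) : ℂ) ∈ closure (annulus (Real.exp (-t₀)) (Real.exp t₀)) := by
  have h1 : s ∈ closure (Set.Ioo (-t₀) t₀) := by
    rwa [closure_Ioo (by linarith)]
  have h2 : Continuous fun s : ℝ => ((Real.exp s : ℝ) : ℂ) :=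
    Complex.continuous_ofReal.comp Real.continuous_exp
  refine map_mem_closure (f := fun s : ℝ => ((Real.exp s : ℝ) : ℂ)) h2 h1 fun u hu => ?_
  rw [annulus, Set.mem_ofPred_eq, Complex.norm_real, Real.norm_of_nonneg (Real.exp_pos u).le,
    Real.exp_lt_exp, Real.exp_lt_exp]
  exact hu

/-- The annulus extends continuously to the closed annulus, whose boundary circles lie in the two
planes; this gives properness and the boundary conditions by compactness. -/
lemma ann_isMinimalAnnulus (hc : 0 < c) (ht : 0 < t₀) (ht₀ : t₀ < 1 / 10) :
    IsMinimalAnnulus (-(4 * c * t₀)) (4 * c * t₀) (Real.exp (-t₀)) (Real.exp t₀) (ann c) := by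
  set A := annulus (Real.exp (-t₀)) (Real.exp t₀) with hA
  set B := closedAnnulus (Real.exp (-t₀)) (Real.exp t₀) with hB
  have hAB : A ⊆ B := annulus_subset_closedAnnulus _ _
  have hBcl : closure (ann c '' A) ⊆ ann c '' B :=
    closure_minimal (Set.image_mono hAB)
      ((isCompact_closedAnnulus _ _).image_of_continuousOn (continuousOn_ann ht₀)).isClosed
  have hcl : ∀ s ∈ Set.Icc (-t₀) t₀, ann c (Real.exp s : ℝ) ∈ closure (ann c '' A) ∧
      ann c (Real.exp s : ℝ) 2 = 4 * c * s := by
    intro s hs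
    have hn : ‖((Real.exp s : ℝ) : ℂ)‖ = Real.exp s := by
      rw [Complex.norm_real, Real.norm_of_nonneg (Real.exp_pos s).le]
    have h1 : Real.exp (-t₀) ≤ ‖((Real.exp s : ℝ) : ℂ)‖ := by
      rw [hn]; exact Real.exp_le_exp.2 hs.1
    have h2 : ‖((Real.exp s : ℝ) : ℂ)‖ ≤ Real.exp t₀ := by
      rw [hn]; exact Real.exp_le_exp.2 hs.2
    refine ⟨?_, by rw [ann_two ht₀.le h1 h2, hn, Real.log_exp]⟩
    exact mem_closure_image (continuousAt_ann ht₀ h1 h2)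
      (mem_closure_annulus ht hs)
  refine ⟨⟨Real.exp_pos _, Real.exp_lt_exp.2 (by linarith)⟩,
    ann_minimal hc fun z hz => exists_openStrip_exp_eq ht₀.le hz,
    fun z hz => (mem_annulus_iff_ann_mem_slab hc ht₀ (hAB hz)).1 hz, ?_, ?_, ?_, ?_⟩
  · intro K hK hKs
    have h1 : A ∩ ann c ⁻¹' K = B ∩ ann c ⁻¹' K := by
      refine Set.Subset.antisymm (Set.inter_subset_inter_left _ hAB) fun z hz => ⟨?_, hz.2⟩
      exact (mem_annulus_iff_ann_mem_slab hc ht₀ hz.1).2 (hKs hz.2)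
    rw [h1]
    exact (isCompact_closedAnnulus _ _).of_isClosed_subset
      ((continuousOn_ann ht₀).preimage_isClosed_of_isClosed
        (isCompact_closedAnnulus _ _).isClosed hK.isClosed) Set.inter_subset_left
  · rintro p ⟨hp, hp'⟩
    obtain ⟨z, hz, rfl⟩ := hBcl hp
    have hzA : ann c z ∉ slab (-(4 * c * t₀)) (4 * c * t₀) := fun h =>
      hp' ⟨z, (mem_annulus_iff_ann_mem_slab hc ht₀ hz).2 h, rfl⟩
    have hz0 : 0 < ‖z‖ := (Real.exp_pos _).trans_le hz.1
    have h1 : -t₀ ≤ Real.log ‖z‖ := (Real.le_log_iff_exp_le hz0).2 hz.1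
    have h2 : Real.log ‖z‖ ≤ t₀ := (Real.log_le_iff_le_exp hz0).2 hz.2
    simp only [slab, Set.mem_ofPred_eq, ann_two ht₀.le hz.1 hz.2, not_and_or, not_lt] at hzA ⊢
    rcases hzA with h | h
    · left
      nlinarith
    · right
      nlinarith
  · refine ⟨_, (hcl (-t₀) ⟨le_rfl, by linarith⟩).1, ?_⟩
    show _ = _
    rw [(hcl (-t₀) ⟨le_rfl, by linarith⟩).2]
    ring
  · exact ⟨_, (hcl t₀ ⟨by linarith, le_rfl⟩).1, (hcl t₀ ⟨by linarith, le_rfl⟩).2⟩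

lemma level_set_ann (hc : 0 < c) (ht₀ : t₀ < 1 / 10) {η : ℝ}
    (hη : η ∈ Set.Ioo (-(4 * c * t₀)) (4 * c * t₀)) :
    Real.exp (η / (4 * c)) ∈ Set.Ioo (Real.exp (-t₀)) (Real.exp t₀) ∧
    {z ∈ annulus (Real.exp (-t₀)) (Real.exp t₀) | ann c z 2 = η}
      = Metric.sphere 0 (Real.exp (η / (4 * c))) := by
  have h4 : 0 < 4 * c := by linarith
  have hr : Real.exp (η / (4 * c)) ∈ Set.Ioo (Real.exp (-t₀)) (Real.exp t₀) := by
    rw [Set.mem_Ioo, Real.exp_lt_exp, Real.exp_lt_exp, lt_div_iff₀ h4, div_lt_iff₀ h4]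
    constructor <;> linarith [hη.1, hη.2]
  refine ⟨hr, ?_⟩
  ext z
  rw [mem_sphere_zero_iff_norm]
  constructor
  · rintro ⟨hz, h⟩
    rw [ann_two ht₀.le hz.1.le hz.2.le] at h
    have hz0 : 0 < ‖z‖ := (Real.exp_pos _).trans hz.1
    rw [← h, mul_div_cancel_left₀ _ h4.ne', Real.exp_log hz0]
  · intro h
    rw [← h] at hr
    refine ⟨hr, ?_⟩
    rw [ann_two ht₀.le hr.1.le hr.2.le, h, Real.log_exp]
    field_simp

end Annulus

/-! ### Gauss map and flux -/

lemma differentiableAt_gaussParam {τ : ℂ} (hτ : τ ∈ openStrip) : DifferentiableAt ℂ gaussParam τ :=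
  (((Complex.hasDerivAt_sinh _).comp τ (hasDerivAt_logInv hτ)).const_mul _).differentiableAt

lemma differentiableAt_logGauss {τ : ℂ} (hτ : τ ∈ openStrip) : DifferentiableAt ℂ logGauss τ :=
  ((differentiableAt_const _).sub (differentiableAt_gaussParam hτ)).clog (one_sub_gaussParam_mem τ)
    |>.sub (((differentiableAt_const _).add (differentiableAt_gaussParam hτ)).clog
      (one_add_gaussParam_mem τ))

lemma sinh_add_int (ζ : ℂ) (n : ℤ) : sinh (ζ + n * (2 * Real.pi * I)) = sinh ζ := by
  have h2 : -(ζ + n * (2 * Real.pi * I)) = -ζ + (-n : ℤ) * (2 * Real.pi * I) := by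
    push_cast; ring
  rw [Complex.sinh, Complex.sinh, h2, Complex.exp_periodic.int_mul _ _,
    Complex.exp_periodic.int_mul _ _]

lemma logGauss_add_int {τ : ℂ} (hτ : |τ.re| ≤ 1 / 10) (n : ℤ) :
    logGauss (τ + n * (2 * Real.pi * I)) = logGauss τ := by
  simp only [logGauss, gaussParam, logInv_add_int hτ, sinh_add_int]

lemma logGauss_log_exp {τ : ℂ} (hτ : |τ.re| ≤ 1 / 10) :
    logGauss (log (exp τ)) = logGauss τ := by
  obtain ⟨n, hn⟩ := Complex.exp_eq_exp_iff_exists_int.1 (exp_log (exp_ne_zero τ))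
  rw [hn, logGauss_add_int hτ]

lemma phi_ann_exp (c : ℝ) {τ : ℂ} (hτ : τ ∈ openStrip) (k : Fin 3) :
    phi (ann c) k (exp τ) = (exp τ)⁻¹ * annPhi c τ k := by
  rw [(ann_isReHolomorphicAt c hτ).phi_eq]
  rfl

lemma phi_zero_sub_phi_one {c : ℝ} {τ : ℂ} (hτ : τ ∈ openStrip) :
    phi (ann c) 0 (exp τ) - I * phi (ann c) 1 (exp τ)
      = (exp τ)⁻¹ * (4 * c * exp (-logGauss τ)) := by
  simp only [phi_ann_exp c hτ, annPhi, Pi.smul_apply, smul_eq_mul, Matrix.cons_val_zero,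
    Matrix.cons_val_one]
  rw [← Complex.cosh_sub_sinh]
  linear_combination (-(exp τ)⁻¹ * (4 * c) * cosh (logGauss τ)) * I_sq

lemma gaussMap_ann {c : ℝ} (hc : 0 < c) {τ : ℂ} (hτ : τ ∈ openStrip) :
    gaussMap (ann c) (exp τ) = exp (logGauss τ) := by
  have hc' : (c : ℂ) ≠ 0 := Complex.ofReal_ne_zero.2 hc.ne'
  rw [gaussMap, phi_zero_sub_phi_one hτ, phi_ann_exp c hτ, Complex.exp_neg]
  have h1 := exp_ne_zero τ
  have h2 := exp_ne_zero (logGauss τ)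
  simp [annPhi]
  field_simp

/-- The Gauss map has a single-valued logarithm on the annulus, so its winding number vanishes. -/
lemma ann_hasWindingNumber {c t₀ : ℝ} (hc : 0 < c) (ht₀ : t₀ < 1 / 10) :
    HasWindingNumber (Real.exp (-t₀)) (Real.exp t₀) (ann c) 0 := by
  have hc' : (c : ℂ) ≠ 0 := Complex.ofReal_ne_zero.2 hc.ne'
  refine ⟨fun z hz => ?_, fun z hz => ?_, fun r hr => ?_⟩
  · obtain ⟨τ, hτ, rfl⟩ := exists_openStrip_exp_eq ht₀.le hz
    rw [phi_zero_sub_phi_one hτ]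
    have h1 := exp_ne_zero τ
    have h2 := exp_ne_zero (-logGauss τ)
    simp [hc']
  · obtain ⟨τ, hτ, rfl⟩ := exists_openStrip_exp_eq ht₀.le hz
    rw [gaussMap_ann hc hτ]
    exact exp_ne_zero _
  · have hr0 : 0 ≤ r := ((Real.exp_pos _).trans hr.1).le
    have key : ∀ z ∈ Metric.sphere (0 : ℂ) r,
        HasDerivAt (fun z => logGauss (log z)) (logDeriv (gaussMap (ann c)) z) z := by
      intro z hz
      have hz' : z ∈ annulus (Real.exp (-t₀)) (Real.exp t₀) := by
        rw [mem_sphere_zero_iff_norm] at hz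
        rw [annulus, Set.mem_ofPred_eq, hz]
        exact hr
      obtain ⟨τ, hτ, rfl⟩ := exists_openStrip_exp_eq ht₀.le hz'
      have hev : ∀ᶠ s in 𝓝 τ, s ∈ openStrip := isOpen_openStrip.mem_nhds hτ
      have h1 := hasDerivAt_of_comp_exp (f := fun z => logGauss (log z))
        (differentiableAt_logGauss hτ).hasDerivAt
        (hev.mono fun s hs => logGauss_log_exp (openStrip_le hs))
      have h2 := hasDerivAt_of_comp_exp (f := gaussMap (ann c))
        (differentiableAt_logGauss hτ).hasDerivAt.cexp
        (hev.mono fun s hs => gaussMap_ann hc hs)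
      convert! h1 using 1
      rw [logDeriv_apply, h2.deriv, gaussMap_ann hc hτ]
      have := exp_ne_zero (logGauss τ)
      field_simp
    rw [circleIntegral.integral_eq_zero_of_hasDerivWithinAt hr0
      fun z hz => (key z hz).hasDerivWithinAt]
    simp

lemma circleMap_exp (t θ : ℝ) : circleMap 0 (Real.exp t) θ = exp (t + θ * I) := by
  rw [circleMap, zero_add, exp_add, Complex.ofReal_exp]

lemma add_mul_I_mem {t : ℝ} (ht : |t| < 1 / 10) (θ : ℝ) : (t + θ * I : ℂ) ∈ openStrip := by
  simpa [openStrip] using ht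

lemma angularVelocity_ann (c : ℝ) {t : ℝ} (ht : |t| < 1 / 10) (θ : ℝ) :
    angularVelocity (ann c) (Real.exp t) θ = reE3 (I • annPhi c (t + θ * I)) := by
  rw [angularVelocity, circleMap_exp, fderiv_ann_exp c (add_mul_I_mem ht θ)]

lemma circleLength_ann {c : ℝ} (hc : 0 < c) {t : ℝ} (ht : |t| < 1 / 10) :
    circleLength (ann c) (Real.exp t)
      = 4 * c * ∫ θ in (0 : ℝ)..(2 * Real.pi), Real.cosh (logGauss (t + θ * I)).re := by
  rw [circleLength, ← intervalIntegral.integral_const_mul]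
  congr 1
  funext θ
  rw [angularVelocity_ann c ht, norm_reE3_smul_annPhi hc, norm_I, mul_one]

lemma hasDerivAt_add_mul_I (t θ : ℝ) : HasDerivAt (fun θ : ℝ => (t + θ * I : ℂ)) I θ := by
  simpa using ((Complex.ofRealCLM.hasDerivAt (x := θ)).mul_const I).const_add (t : ℂ)

lemma continuousOn_logGauss : ContinuousOn logGauss openStrip := fun _ hs =>
  (differentiableAt_logGauss hs).continuousAt.continuousWithinAt

lemma continuous_logGauss_line {t : ℝ} (ht : |t| < 1 / 10) :
    Continuous fun θ : ℝ => logGauss (t + θ * I) :=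
  continuousOn_logGauss.comp_continuous (by fun_prop) fun θ => add_mul_I_mem ht θ

lemma hasDerivAt_annLift_line (c : ℝ) {t : ℝ} (ht : |t| < 1 / 10) (θ : ℝ) :
    HasDerivAt (fun θ : ℝ => surfLift c (logInv (t + θ * I))) (I • annPhi c (t + θ * I)) θ :=
  HasDerivAt.scomp (g₁ := fun s => surfLift c (logInv s)) θ
    (hasDerivAt_annLift c (add_mul_I_mem ht θ)) (hasDerivAt_add_mul_I t θ)

/-- The flux is the period of the conjugate surface: minus the imaginary part of the holomorphic
curve changes along the circle by the increment of `surfLift` under `ζ ↦ ζ + 2πi`. -/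
lemma flux_ann {c : ℝ} (hc : 0 < c) {t : ℝ} (ht : |t| < 1 / 10) :
    flux (ann c) (Real.exp t) = !₂[0, 0, 8 * Real.pi * c] := by
  have h1 : ∀ θ : ℝ, ‖angularVelocity (ann c) (Real.exp t) θ‖ • conormal (ann c) (Real.exp t) θ
      = reE3 (annPhi c (t + θ * I)) := by
    intro θ
    have hcosh := Real.cosh_pos (logGauss (t + θ * I)).re
    have he := Real.exp_pos t
    have h2 : circleMap 0 1 θ = exp (t + θ * I) * (Real.exp (-t) : ℝ) := by
      rw [circleMap, zero_add, Complex.ofReal_one, one_mul, Complex.ofReal_exp,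
        Complex.ofReal_neg, ← Complex.exp_add]
      congr 1
      ring
    rw [angularVelocity_ann c ht, conormal, circleMap_exp, h2,
      fderiv_ann_exp c (add_mul_I_mem ht θ), norm_reE3_smul_annPhi hc, norm_reE3_smul_annPhi hc,
      norm_I, Complex.norm_real, Real.norm_of_nonneg (Real.exp_pos _).le, Real.exp_neg]
    have h3 : reE3 (((Real.exp t)⁻¹ : ℝ) • annPhi c (t + θ * I))
        = (Real.exp t)⁻¹ • reE3 (annPhi c (t + θ * I)) := map_smul reE3 _ _
    rw [Complex.coe_smul, h3, smul_smul, smul_smul]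
    convert! one_smul ℝ _ using 2
    field_simp
  have hder : ∀ θ : ℝ, HasDerivAt
      (fun θ : ℝ => reE3 (-I • surfLift c (logInv (t + θ * I))))
      (reE3 (annPhi c (t + θ * I))) θ := by
    intro θ
    have h2 := (hasDerivAt_annLift_line c ht θ).const_smul (-I)
    have h3 : -I • I • annPhi c (t + θ * I) = annPhi c (t + θ * I) := by
      rw [smul_smul]
      simp
    rw [h3] at h2
    exact reE3.hasFDerivAt.comp_hasDerivAt θ h2
  have hcont : Continuous fun θ : ℝ => reE3 (annPhi c (t + θ * I)) := by
    refine reE3.continuous.comp (continuous_pi fun k => ?_)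
    have := continuous_logGauss_line ht
    fin_cases k
    · exact continuous_const.mul (Complex.continuous_sinh.comp this).neg
    · exact continuous_const.mul (continuous_const.mul (Complex.continuous_cosh.comp this))
    · exact (continuous_const : Continuous fun _ : ℝ => (4 * c * 1 : ℂ))
  rw [flux]
  simp only [h1]
  rw [intervalIntegral.integral_eq_sub_of_hasDerivAt (fun θ _ => hder θ)
    (hcont.intervalIntegrable _ _), ← map_sub, ← smul_sub]
  have ht' : |((t : ℂ) + ((0 : ℝ) : ℂ) * I).re| ≤ 1 / 10 := by simpa using ht.le
  have h5 : ((t : ℂ) + ((2 * Real.pi : ℝ) : ℂ) * I)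
      = (t + ((0 : ℝ) : ℂ) * I) + 2 * Real.pi * I := by
    push_cast; ring
  rw [h5, logInv_add_two_pi ht']
  set ζ := logInv (t + ((0 : ℝ) : ℂ) * I)
  have h6 : surfLift c (ζ + 2 * Real.pi * I) - surfLift c ζ = ![0, 0, 8 * Real.pi * c * I] := by
    have h7 := logHeight_add_int ζ 1
    have h8 := sinh_two_mul_add_int ζ 1
    simp only [Int.cast_one, one_mul] at h7 h8
    have h9 : cosh (ζ + 2 * Real.pi * I) = cosh ζ := by
      rw [Complex.cosh_add, Complex.sinh_mul_I, Complex.cosh_mul_I]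
      simp
    unfold surfLift
    rw [h7, h8, h9]
    ext k
    fin_cases k <;> simp
    ring
  rw [h6]
  ext k
  fin_cases k <;> simp

end MinimalAnnuli

namespace MinimalAnnuli

open Complex Filter Topology

/-! ### The level curves are figure eights -/

/-- The projection `x₁ + i x₂` of the real part of a vector of `ℂ³`. -/
def horizontalCLM : (Fin 3 → ℂ) →L[ℝ] ℂ :=
  Complex.ofRealCLM ∘L Complex.reCLM ∘L ContinuousLinearMap.proj 0 +
    I • (Complex.ofRealCLM ∘L Complex.reCLM ∘L ContinuousLinearMap.proj 1)

lemma horizontalCLM_apply (v : Fin 3 → ℂ) :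
    horizontalCLM v = ((v 0).re : ℂ) + I * ((v 1).re : ℂ) := rfl

section Level

variable {c t : ℝ}

lemma abs_re_line_le (ht : |t| < 1 / 10) (θ : ℝ) : |((t : ℂ) + θ * I).re| ≤ 1 / 10 := by
  simpa using ht.le

lemma horizontalCurve_ann (c : ℝ) (ht : |t| < 1 / 10) :
    horizontalCurve (ann c) (Real.exp t)
      = fun θ : ℝ => horizontalCLM (surfLift c (logInv (t + θ * I))) := by
  funext θ
  rw [horizontalCurve, circleMap_exp, ann_exp c (abs_re_line_le ht θ)]
  rfl

lemma contDiff_horizontalCurve (c : ℝ) (ht : |t| < 1 / 10) :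
    ContDiff ℝ ∞ (horizontalCurve (ann c) (Real.exp t)) := by
  rw [horizontalCurve_ann c ht]
  have h1 : ContDiffOn ℂ ∞ (fun s => surfLift c (logInv s)) openStrip :=
    DifferentiableOn.contDiffOn
      (fun s hs => (hasDerivAt_annLift c hs).differentiableAt.differentiableWithinAt)
      isOpen_openStrip
  have h2 : ContDiff ℝ ∞ fun θ : ℝ => (t + θ * I : ℂ) :=
    contDiff_const.add (Complex.ofRealCLM.contDiff.mul contDiff_const)
  refine horizontalCLM.contDiff.comp (contDiff_iff_contDiffAt.2 fun θ => ?_)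
  exact ((h1.contDiffAt (isOpen_openStrip.mem_nhds (add_mul_I_mem ht θ))).restrict_scalars ℝ).comp θ
    h2.contDiffAt

lemma hasDerivAt_horizontalCurve (c : ℝ) (ht : |t| < 1 / 10) (θ : ℝ) :
    HasDerivAt (horizontalCurve (ann c) (Real.exp t))
      (horizontalCLM (I • annPhi c (t + θ * I))) θ := by
  rw [horizontalCurve_ann c ht]
  exact horizontalCLM.hasFDerivAt.comp_hasDerivAt θ (hasDerivAt_annLift_line c ht θ)

/-- The tangent of a level curve, in terms of the logarithm of the Gauss map. -/
lemma deriv_horizontalCurve_eq_exp (c : ℝ) (ht : |t| < 1 / 10) (θ : ℝ) :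
    deriv (horizontalCurve (ann c) (Real.exp t)) θ
      = ((4 * c * Real.cosh (logGauss (t + θ * I)).re : ℝ) : ℂ) *
        exp (I * ((logGauss (t + θ * I)).im - Real.pi / 2 : ℝ)) := by
  rw [(hasDerivAt_horizontalCurve c ht θ).deriv, horizontalCLM_apply]
  set L := logGauss (t + θ * I) with hL
  have hexp : exp (I * (L.im - Real.pi / 2 : ℝ))
      = (Real.sin L.im : ℂ) - (Real.cos L.im : ℂ) * I := by
    rw [mul_comm, Complex.exp_mul_I, ← Complex.ofReal_cos, ← Complex.ofReal_sin,
      Real.cos_sub_pi_div_two, Real.sin_sub_pi_div_two]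
    push_cast
    ring
  rw [hexp]
  have h : L = (L.re : ℂ) + (L.im : ℂ) * I := (Complex.re_add_im L).symm
  have hs : sinh L = ((Real.sinh L.re * Real.cos L.im : ℝ) : ℂ)
      + ((Real.cosh L.re * Real.sin L.im : ℝ) : ℂ) * I := by
    conv_lhs => rw [h, Complex.sinh_add, Complex.sinh_mul_I, Complex.cosh_mul_I]
    push_cast
    ring
  have hc : cosh L = ((Real.cosh L.re * Real.cos L.im : ℝ) : ℂ)
      + ((Real.sinh L.re * Real.sin L.im : ℝ) : ℂ) * I := by
    conv_lhs => rw [h, Complex.cosh_add, Complex.sinh_mul_I, Complex.cosh_mul_I]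
    push_cast
    ring
  have h0 : ((I • annPhi c (t + θ * I)) 0).re = 4 * c * (Real.cosh L.re * Real.sin L.im) := by
    simp only [annPhi, ← hL, hs]
    simp [-Complex.ofReal_mul, -Complex.ofReal_cosh, -Complex.ofReal_sinh, -Complex.ofReal_cos,
      -Complex.ofReal_sin]
  have h1 : ((I • annPhi c (t + θ * I)) 1).re = -(4 * c * (Real.cosh L.re * Real.cos L.im)) := by
    simp only [annPhi, ← hL, hc]
    simp [-Complex.ofReal_mul, -Complex.ofReal_cosh, -Complex.ofReal_sinh, -Complex.ofReal_cos,
      -Complex.ofReal_sin]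
  rw [h0, h1]
  push_cast
  ring

lemma norm_deriv_horizontalCurve (hc : 0 < c) (ht : |t| < 1 / 10) (θ : ℝ) :
    ‖deriv (horizontalCurve (ann c) (Real.exp t)) θ‖
      = 4 * c * Real.cosh (logGauss (t + θ * I)).re := by
  have hcosh := Real.cosh_pos (logGauss (t + θ * I)).re
  rw [deriv_horizontalCurve_eq_exp c ht, norm_mul, mul_comm I, Complex.norm_exp_ofReal_mul_I,
    mul_one, Complex.norm_real, Real.norm_of_nonneg (by positivity)]

lemma re_deriv_horizontalCurve (c : ℝ) (ht : |t| < 1 / 10) (θ : ℝ) :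
    (deriv (horizontalCurve (ann c) (Real.exp t)) θ).re
      = -(4 * √2 * c * (sinh (logInv (t + θ * I)) /
        (1 - cosh (2 * logInv (t + θ * I)) / 2)).im) := by
  rw [(hasDerivAt_horizontalCurve c ht θ).deriv, horizontalCLM_apply, annPhi_eq]
  have : (I • (1 - cosh (2 * logInv (t + θ * I)) / 2)⁻¹ • surfLiftDeriv c (logInv (t + θ * I))) 0
      = I * ((4 * √2 * c : ℝ) * (sinh (logInv (t + θ * I)) /
        (1 - cosh (2 * logInv (t + θ * I)) / 2))) := by
    simp [surfLiftDeriv]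
    ring
  rw [this, Complex.I_mul_re, Complex.im_ofReal_mul]
  simp

lemma im_deriv_horizontalCurve (c : ℝ) (ht : |t| < 1 / 10) (θ : ℝ) :
    (deriv (horizontalCurve (ann c) (Real.exp t)) θ).im
      = -(2 * c * (cosh (2 * logInv (t + θ * I)) /
        (1 - cosh (2 * logInv (t + θ * I)) / 2)).re) := by
  rw [(hasDerivAt_horizontalCurve c ht θ).deriv, horizontalCLM_apply, annPhi_eq]
  have : (I • (1 - cosh (2 * logInv (t + θ * I)) / 2)⁻¹ • surfLiftDeriv c (logInv (t + θ * I))) 1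
      = ((-(2 * c) : ℝ) : ℂ) * (cosh (2 * logInv (t + θ * I)) /
        (1 - cosh (2 * logInv (t + θ * I)) / 2)) := by
    simp only [surfLiftDeriv, Pi.smul_apply, smul_eq_mul, Matrix.cons_val_one,
      Matrix.cons_val_zero]
    push_cast
    linear_combination (c * (2 * cosh (2 * logInv (t + θ * I))) *
      (1 - cosh (2 * logInv (t + θ * I)) / 2)⁻¹) * I_sq
  rw [this, Complex.re_ofReal_mul]
  simp

lemma re_horizontalCurve (c : ℝ) (ht : |t| < 1 / 10) (θ : ℝ) :
    (horizontalCurve (ann c) (Real.exp t) θ).re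
      = 4 * √2 * c * (cosh (logInv (t + θ * I))).re := by
  rw [horizontalCurve_ann c ht]
  simp only [horizontalCLM_apply]
  have : surfLift c (logInv (t + θ * I)) 0
      = ((4 * √2 * c : ℝ) : ℂ) * cosh (logInv (t + θ * I)) := by
    simp [surfLift]
    ring
  rw [this, Complex.re_ofReal_mul]
  simp

lemma im_horizontalCurve (c : ℝ) (ht : |t| < 1 / 10) (θ : ℝ) :
    (horizontalCurve (ann c) (Real.exp t) θ).im
      = -(c * (sinh (2 * logInv (t + θ * I))).im) := by
  rw [horizontalCurve_ann c ht]
  simp only [horizontalCLM_apply]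
  have : surfLift c (logInv (t + θ * I)) 1
      = I * ((c : ℂ) * sinh (2 * logInv (t + θ * I))) := by
    simp [surfLift]
    ring
  rw [this, Complex.I_mul_re, Complex.im_ofReal_mul]
  simp

lemma logInv_line_neg (ht : |t| < 1 / 10) (θ : ℝ) :
    logInv (t + (-θ : ℝ) * I) = starRingEnd ℂ (logInv (t + θ * I)) := by
  rw [← logInv_conj (abs_re_line_le ht θ)]
  simp

lemma logInv_line_add_pi (ht : |t| < 1 / 10) (θ : ℝ) :
    logInv (t + (θ + Real.pi : ℝ) * I) = logInv (t + θ * I) + Real.pi * I := by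
  rw [← logInv_add_pi (abs_re_line_le ht θ)]
  push_cast
  ring_nf

lemma horizontalCurve_neg (c : ℝ) (ht : |t| < 1 / 10) (θ : ℝ) :
    horizontalCurve (ann c) (Real.exp t) (-θ)
      = starRingEnd ℂ (horizontalCurve (ann c) (Real.exp t) θ) := by
  apply Complex.ext
  · rw [Complex.conj_re, re_horizontalCurve c ht, re_horizontalCurve c ht, logInv_line_neg ht,
      Complex.cosh_conj, Complex.conj_re]
  · rw [Complex.conj_im, im_horizontalCurve c ht, im_horizontalCurve c ht, im_sinh_two_mul,
      im_sinh_two_mul, logInv_line_neg ht, Complex.conj_im, Complex.conj_re, mul_neg, Real.sin_neg]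
    ring

lemma horizontalCurve_periodic (X : ℂ → E3) (r : ℝ) :
    Function.Periodic (horizontalCurve X r) (2 * Real.pi) := by
  intro θ
  simp only [horizontalCurve, periodic_circleMap 0 r θ]

/-- The imaginary part of the equation `logHeight (logInv τ) = τ`. -/
lemma eq_im_logInv_sub (ht : |t| < 1 / 10) (θ : ℝ) :
    θ = (logInv (t + θ * I)).im -
      Real.cosh (2 * (logInv (t + θ * I)).re) * Real.sin (2 * (logInv (t + θ * I)).im) / 4 := by
  rw [← im_sinh_two_mul]
  have h := congrArg Complex.im (logHeight_logInv (abs_re_line_le ht θ))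
  simp only [logHeight] at h
  simpa using h.symm

lemma abs_sin_two_mul_le (y : ℝ) : |Real.sin (2 * y)| ≤ 2 * |y| := by
  refine Real.abs_sin_le_abs.trans ?_
  rw [abs_mul, abs_two]

/-- The argument of `w = e^ζ` runs through `(0, π)` together with that of `z`. -/
lemma im_logInv_mem_Ioo (ht : |t| < 1 / 10) {θ : ℝ} (hθ : θ ∈ Set.Ioo 0 Real.pi) :
    (logInv (t + θ * I)).im ∈ Set.Ioo 0 Real.pi := by
  have h1 := eq_im_logInv_sub ht θ
  have h2 := cosh_two_mul_re_lt (logInv_mem (t + θ * I))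
  have h3 := Real.one_le_cosh (2 * (logInv (t + θ * I)).re)
  generalize Real.cosh (2 * (logInv (t + θ * I)).re) = C at h1 h2 h3
  generalize (logInv (t + θ * I)).im = y at h1 ⊢
  constructor
  · by_contra! hy
    have h4 := (abs_le.1 (abs_sin_two_mul_le y)).1
    rw [abs_of_nonpos hy] at h4
    have := hθ.1
    nlinarith
  · by_contra! hy
    have h5 : Real.sin (2 * y) = Real.sin (2 * (y - Real.pi)) := by
      rw [mul_sub, Real.sin_sub_two_pi]
    have h4 := (abs_le.1 (abs_sin_two_mul_le (y - Real.pi))).2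
    rw [← h5, abs_of_nonneg (by linarith)] at h4
    have := hθ.2
    nlinarith

/-- This imaginary part is, up to a negative factor, the derivative of the first coordinate. -/
lemma im_sinh_div_pos {ζ : ℂ} (hζ : ζ ∈ strip) (h : ζ.im ∈ Set.Ioo 0 Real.pi) :
    0 < (sinh ζ / (1 - cosh (2 * ζ) / 2)).im := by
  have hsin : 0 < Real.sin ζ.im := Real.sin_pos_of_mem_Ioo h
  have hz : ζ = (ζ.re : ℂ) + (ζ.im : ℂ) * I := (Complex.re_add_im ζ).symm
  have hs : sinh ζ = ((Real.sinh ζ.re * Real.cos ζ.im : ℝ) : ℂ)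
      + ((Real.cosh ζ.re * Real.sin ζ.im : ℝ) : ℂ) * I := by
    conv_lhs => rw [hz, Complex.sinh_add, Complex.sinh_mul_I, Complex.cosh_mul_I]
    push_cast
    ring
  have hc : 1 - cosh (2 * ζ) / 2
      = ((1 - Real.cosh (2 * ζ.re) * Real.cos (2 * ζ.im) / 2 : ℝ) : ℂ)
      + ((-(Real.sinh (2 * ζ.re) * Real.sin (2 * ζ.im)) / 2 : ℝ) : ℂ) * I := by
    have h2 : 2 * ζ = ((2 * ζ.re : ℝ) : ℂ) + ((2 * ζ.im : ℝ) : ℂ) * I := by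
      apply Complex.ext <;> simp
    rw [h2, Complex.cosh_add, Complex.sinh_mul_I, Complex.cosh_mul_I]
    push_cast
    ring
  have hne := one_sub_cosh_ne_zero hζ
  have hn : 0 < normSq (1 - cosh (2 * ζ) / 2) := normSq_pos.2 hne
  rw [Complex.div_im, ← sub_div]
  refine div_pos ?_ hn
  rw [hs, hc]
  simp only [Complex.add_re, Complex.add_im, Complex.ofReal_re, Complex.ofReal_im,
    Complex.re_ofReal_mul, Complex.im_ofReal_mul, Complex.I_re, Complex.I_im]
  have h1 := cosh_two_mul_re_lt hζ
  have h2 : Real.cosh (2 * ζ.re) * Real.cos (2 * ζ.im) ≤ Real.cosh (2 * ζ.re) :=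
    mul_le_of_le_one_right (Real.cosh_pos _).le (Real.cos_le_one _)
  have h3 := Real.cosh_pos ζ.re
  have h4 : 0 < Real.cosh ζ.re * Real.sin ζ.im *
      (1 - Real.cosh (2 * ζ.re) * Real.cos (2 * ζ.im) / 2) := by
    have : 0 < 1 - Real.cosh (2 * ζ.re) * Real.cos (2 * ζ.im) / 2 := by linarith
    positivity
  have h5 : 0 ≤ Real.sinh ζ.re * Real.cos ζ.im * (Real.sinh (2 * ζ.re) * Real.sin (2 * ζ.im)) := by
    rw [Real.sinh_two_mul, Real.sin_two_mul]
    have : Real.sinh ζ.re * Real.cos ζ.im *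
        (2 * Real.sinh ζ.re * Real.cosh ζ.re * (2 * Real.sin ζ.im * Real.cos ζ.im))
        = 4 * Real.cosh ζ.re * Real.sin ζ.im * (Real.sinh ζ.re * Real.cos ζ.im) ^ 2 := by ring
    rw [this]
    positivity
  nlinarith

/-- On the upper half of a level curve the first coordinate is strictly decreasing. -/
lemma strictAntiOn_re_horizontalCurve (hc : 0 < c) (ht : |t| < 1 / 10) :
    StrictAntiOn (fun θ => (horizontalCurve (ann c) (Real.exp t) θ).re) (Set.Icc 0 Real.pi) := by
  have hder : ∀ θ, HasDerivAt (fun θ => (horizontalCurve (ann c) (Real.exp t) θ).re)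
      (deriv (horizontalCurve (ann c) (Real.exp t)) θ).re θ := fun θ =>
    Complex.reCLM.hasFDerivAt.comp_hasDerivAt θ
      (hasDerivAt_horizontalCurve c ht θ).differentiableAt.hasDerivAt
  refine strictAntiOn_of_deriv_neg (convex_Icc _ _)
    (fun θ _ => (hder θ).continuousAt.continuousWithinAt) fun θ hθ => ?_
  rw [interior_Icc] at hθ
  rw [(hder θ).deriv, re_deriv_horizontalCurve c ht]
  have h1 := im_sinh_div_pos (logInv_mem _) (im_logInv_mem_Ioo ht hθ)
  have h2 : 0 < √2 := by positivity
  have := mul_pos (mul_pos (mul_pos (by norm_num : (0 : ℝ) < 4) h2) hc) h1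
  linarith

/-- The symmetries under conjugation and the half turn fix the line `Im τ = π / 2`. -/
lemma im_logInv_half_pi (ht : |t| < 1 / 10) :
    logInv (t + (Real.pi / 2 : ℝ) * I)
      = ((logInv (t + (Real.pi / 2 : ℝ) * I)).re : ℂ) + (Real.pi / 2 : ℝ) * I := by
  have h1 := logInv_line_add_pi ht (-(Real.pi / 2))
  rw [logInv_line_neg ht, show -(Real.pi / 2) + Real.pi = Real.pi / 2 by ring] at h1
  have h2 := congrArg Complex.im h1
  simp only [Complex.add_im, Complex.conj_im, Complex.mul_im, Complex.ofReal_re, Complex.I_im,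
    Complex.ofReal_im, Complex.I_re] at h2
  apply Complex.ext
  · simp
  · simp only [Complex.add_im, Complex.ofReal_im, Complex.mul_im, Complex.ofReal_re, Complex.I_im,
      Complex.I_re]
    linarith

/-- The second coordinate vanishes only where the argument of `w` is a multiple of `π / 2`, and there
the arguments of `w` and `z` agree. -/
lemma eq_half_pi_of_im_eq_zero (hc : 0 < c) (ht : |t| < 1 / 10) {θ : ℝ}
    (hθ : θ ∈ Set.Ioo 0 Real.pi) (h : (horizontalCurve (ann c) (Real.exp t) θ).im = 0) :
    θ = Real.pi / 2 := by
  rw [im_horizontalCurve c ht, im_sinh_two_mul, neg_eq_zero] at h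
  have h1 := (mul_eq_zero.1 ((mul_eq_zero.1 h).resolve_left hc.ne')).resolve_left
    (Real.cosh_pos _).ne'
  have hy := im_logInv_mem_Ioo ht hθ
  have h2 := eq_im_logInv_sub ht θ
  rw [h1, mul_zero, zero_div, sub_zero] at h2
  rw [← h2] at hy h1
  obtain ⟨n, hn⟩ := Real.sin_eq_zero_iff.1 h1
  have hpi := Real.pi_pos
  have hn1 : (0 : ℝ) < n := by
    by_contra! hn0
    nlinarith [hy.1]
  have hn2 : (n : ℝ) < 2 := by
    by_contra! hn0
    nlinarith [hy.2]
  have hn1' : 0 < n := by exact_mod_cast hn1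
  have hn2' : n < 2 := by exact_mod_cast hn2
  have : n = 1 := by omega
  rw [this] at hn
  push_cast at hn
  linarith

/-- The two tangents at the double point. -/
lemma deriv_horizontalCurve_half_pi (c : ℝ) (ht : |t| < 1 / 10) : ∃ P Q : ℝ, 0 < P ∧ 0 < Q ∧
    deriv (horizontalCurve (ann c) (Real.exp t)) (Real.pi / 2) = ⟨-(c * P), c * Q⟩ ∧
    deriv (horizontalCurve (ann c) (Real.exp t)) (-(Real.pi / 2)) = ⟨c * P, c * Q⟩ := by
  set x := (logInv (t + (Real.pi / 2 : ℝ) * I)).re with hx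
  have h1 : logInv (t + (Real.pi / 2 : ℝ) * I) = (x : ℂ) + (Real.pi / 2 : ℝ) * I :=
    im_logInv_half_pi ht
  have h2 : logInv (t + (-(Real.pi / 2) : ℝ) * I) = (x : ℂ) - (Real.pi / 2 : ℝ) * I := by
    rw [logInv_line_neg ht, h1]
    simp [sub_eq_add_neg, Complex.conj_ofNat]
  have hs1 : sinh ((x : ℂ) + (Real.pi / 2 : ℝ) * I) = (Real.cosh x : ℂ) * I := by
    rw [Complex.sinh_add, Complex.sinh_mul_I, Complex.cosh_mul_I, ← Complex.ofReal_cos,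
      ← Complex.ofReal_sin, Real.cos_pi_div_two, Real.sin_pi_div_two]
    simp
  have hs2 : sinh ((x : ℂ) - (Real.pi / 2 : ℝ) * I) = -((Real.cosh x : ℂ) * I) := by
    rw [Complex.sinh_sub, Complex.sinh_mul_I, Complex.cosh_mul_I, ← Complex.ofReal_cos,
      ← Complex.ofReal_sin, Real.cos_pi_div_two, Real.sin_pi_div_two]
    simp
  have hc1 : cosh (2 * ((x : ℂ) + (Real.pi / 2 : ℝ) * I)) = ((-Real.cosh (2 * x) : ℝ) : ℂ) := by
    rw [show 2 * ((x : ℂ) + (Real.pi / 2 : ℝ) * I) = 2 * x + Real.pi * I by push_cast; ring,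
      Complex.cosh_add, Complex.sinh_mul_I, Complex.cosh_mul_I]
    simp
  have hc2 : cosh (2 * ((x : ℂ) - (Real.pi / 2 : ℝ) * I)) = ((-Real.cosh (2 * x) : ℝ) : ℂ) := by
    rw [show 2 * ((x : ℂ) - (Real.pi / 2 : ℝ) * I) = 2 * x - Real.pi * I by push_cast; ring,
      Complex.cosh_sub, Complex.sinh_mul_I, Complex.cosh_mul_I]
    simp
  have hk : 1 - ((-Real.cosh (2 * x) : ℝ) : ℂ) / 2 = ((1 + Real.cosh (2 * x) / 2 : ℝ) : ℂ) := by
    push_cast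
    ring
  have hp1 := Real.cosh_pos x
  have hp2 := Real.cosh_pos (2 * x)
  have e1 : ∀ a b : ℝ, ((a : ℂ) * I / (b : ℂ)).im = a / b := fun a b => by
    rw [mul_div_right_comm, ← Complex.ofReal_div, Complex.im_ofReal_mul, Complex.I_im, mul_one]
  refine ⟨4 * √2 * (Real.cosh x / (1 + Real.cosh (2 * x) / 2)),
    2 * (Real.cosh (2 * x) / (1 + Real.cosh (2 * x) / 2)), by positivity, by positivity, ?_, ?_⟩
  · apply Complex.ext
    · rw [re_deriv_horizontalCurve c ht, h1, hs1, hc1, hk, e1]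
      ring
    · rw [im_deriv_horizontalCurve c ht, h1, hc1, hk, ← Complex.ofReal_div, Complex.ofReal_re]
      ring
  · apply Complex.ext
    · rw [re_deriv_horizontalCurve c ht, h2, hs2, hc2, hk, neg_div, Complex.neg_im, e1]
      ring
    · rw [im_deriv_horizontalCurve c ht, h2, hc2, hk, ← Complex.ofReal_div, Complex.ofReal_re]
      ring

lemma horizontalCurve_half_pi (c : ℝ) (ht : |t| < 1 / 10) :
    horizontalCurve (ann c) (Real.exp t) (Real.pi / 2) = 0 := by
  have h1 := im_logInv_half_pi ht
  apply Complex.ext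
  · rw [re_horizontalCurve c ht, h1, Complex.cosh_add, Complex.cosh_mul_I, Complex.sinh_mul_I,
      ← Complex.ofReal_cos, ← Complex.ofReal_sin, Real.cos_pi_div_two, Real.sin_pi_div_two,
      ← Complex.ofReal_cosh, ← Complex.ofReal_sinh]
    simp
  · have h2 : (logInv (t + (Real.pi / 2 : ℝ) * I)).im = Real.pi / 2 := by
      rw [h1]; simp
    rw [im_horizontalCurve c ht, im_sinh_two_mul, h2, mul_div_cancel₀ _ two_ne_zero, Real.sin_pi]
    simp

/-- The only double point of a level curve is at the parameters `±π/2`: the first coordinate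
forces the two parameters to be opposite, and then the second coordinate vanishes. -/
lemma eq_half_pi_of_horizontalCurve_eq (hc : 0 < c) (ht : |t| < 1 / 10) {p q : ℝ}
    (hp : -(Real.pi / 2) ≤ p) (hq : q < 3 * Real.pi / 2) (hpq : p < q)
    (h : horizontalCurve (ann c) (Real.exp t) p = horizontalCurve (ann c) (Real.exp t) q) :
    p = -(Real.pi / 2) ∧ q = Real.pi / 2 := by
  set γ := horizontalCurve (ann c) (Real.exp t) with hγ
  have hpi := Real.pi_pos
  have hneg : ∀ θ, (γ (-θ)).re = (γ θ).re := fun θ => by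
    rw [hγ, horizontalCurve_neg c ht, Complex.conj_re]
  have hneg' : ∀ θ, (γ (-θ)).im = -(γ θ).im := fun θ => by
    rw [hγ, horizontalCurve_neg c ht, Complex.conj_im]
  have hrefl : ∀ θ, γ (2 * Real.pi - θ) = γ (-θ) := fun θ => by
    have h1 : γ (-θ + 2 * Real.pi) = γ (-θ) := horizontalCurve_periodic _ _ _
    rw [← h1]
    congr 1
    ring
  -- injectivity on `[0, π]`, to which each parameter is brought by the reflections `hneg`, `hrefl`
  have hinj := (strictAntiOn_re_horizontalCurve hc ht).injOn
  have hre := congrArg Complex.re h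
  have him := congrArg Complex.im h
  rcases lt_or_ge p 0 with hp0 | hp0
  · rcases lt_or_ge q 0 with hq0 | hq0
    · exfalso
      have := hinj (x₁ := -p) (x₂ := -q) ⟨by linarith, by linarith⟩ ⟨by linarith, by linarith⟩
        (by simpa only [← hγ, hneg] using hre)
      linarith
    rcases le_or_gt q Real.pi with hq1 | hq1
    · have h1 := hinj (x₁ := -p) (x₂ := q) ⟨by linarith, by linarith⟩ ⟨hq0, hq1⟩
        (by simpa only [← hγ, hneg] using hre)
      have h2 : (γ q).im = 0 := by
        have h3 := hneg' q
        rw [show -q = p by linarith, him] at h3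
        linarith
      have h4 := eq_half_pi_of_im_eq_zero hc ht (θ := q) ⟨by linarith, by linarith⟩ h2
      exact ⟨by linarith, h4⟩
    · exfalso
      have := hinj (x₁ := -p) (x₂ := 2 * Real.pi - q) ⟨by linarith, by linarith⟩
        ⟨by linarith, by linarith⟩ (by simpa only [← hγ, hrefl, hneg] using hre)
      linarith
  · exfalso
    rcases le_or_gt q Real.pi with hq1 | hq1
    · have := hinj (x₁ := p) (x₂ := q) ⟨by linarith, by linarith⟩ ⟨by linarith, by linarith⟩ hre
      linarith
    rcases le_or_gt p Real.pi with hp1 | hp1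
    · have h1 := hinj (x₁ := p) (x₂ := 2 * Real.pi - q) ⟨by linarith, by linarith⟩
        ⟨by linarith, by linarith⟩ (by simpa only [← hγ, hrefl, hneg] using hre)
      have h2 : (γ p).im = 0 := by
        have h3 := hneg' p
        have h5 := hrefl p
        rw [show 2 * Real.pi - p = q by linarith] at h5
        rw [← h5, ← him] at h3
        linarith
      have h4 := eq_half_pi_of_im_eq_zero hc ht (θ := p) ⟨by linarith, by linarith⟩ h2
      linarith
    · have := hinj (x₁ := 2 * Real.pi - p) (x₂ := 2 * Real.pi - q) ⟨by linarith, by linarith⟩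
        ⟨by linarith, by linarith⟩ (by simpa only [← hγ, hrefl, hneg] using hre)
      linarith

/-- The double point is at the parameters `±π/2`, and `arg g - π/2` is a periodic angle function of
the tangent. -/
lemma ann_isFigureEight (hc : 0 < c) (ht : |t| < 1 / 10) :
    IsFigureEight (horizontalCurve (ann c) (Real.exp t)) := by
  have hpi := Real.pi_pos
  refine ⟨contDiff_horizontalCurve c ht, horizontalCurve_periodic _ _, fun θ h => ?_,
    ⟨-(Real.pi / 2), Real.pi / 2, by linarith, by linarith, ?_, ?_, ?_⟩,
    ⟨fun θ => (logGauss (t + θ * I)).im - Real.pi / 2, ?_, fun θ => ?_, fun θ => ?_⟩⟩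
  · have h1 := norm_deriv_horizontalCurve hc ht θ
    rw [h, norm_zero] at h1
    have := mul_pos (mul_pos (by norm_num : (0 : ℝ) < 4) hc)
      (Real.cosh_pos (logGauss (t + θ * I)).re)
    linarith
  · rw [horizontalCurve_neg c ht, horizontalCurve_half_pi c ht, map_zero]
  · obtain ⟨P, Q, hP, hQ, h1, h2⟩ := deriv_horizontalCurve_half_pi c ht
    rw [h1, h2, LinearIndependent.pair_iff]
    intro a b hab
    have hr := congrArg Complex.re hab
    have hi := congrArg Complex.im hab
    simp only [Complex.add_re, Complex.add_im, Complex.smul_re, Complex.smul_im, smul_eq_mul,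
      Complex.zero_re, Complex.zero_im] at hr hi
    have e1 : a - b = 0 := by
      have : (a - b) * (c * P) = 0 := by linarith
      exact (mul_eq_zero.1 this).resolve_right (mul_pos hc hP).ne'
    have e2 : a + b = 0 := by
      have : (a + b) * (c * Q) = 0 := by linarith
      exact (mul_eq_zero.1 this).resolve_right (mul_pos hc hQ).ne'
    constructor <;> linarith
  · intro p hp q hq hpq h
    exact eq_half_pi_of_horizontalCurve_eq hc ht hp.1 (by linarith [hq.2]) hpq h
  · exact (Complex.continuous_im.comp (continuous_logGauss_line ht)).sub continuous_const
  · have h1 : ((t : ℂ) + ((θ + 2 * Real.pi : ℝ) : ℂ) * I)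
        = (t + θ * I) + (1 : ℤ) * (2 * Real.pi * I) := by
      push_cast; ring
    simp only [h1]
    rw [logGauss_add_int (abs_re_line_le ht θ)]
  · rw [norm_deriv_horizontalCurve hc ht]
    exact deriv_horizontalCurve_eq_exp c ht θ

end Level

end MinimalAnnuli

namespace MinimalAnnuli

open Complex Filter Topology MeasureTheory

/-! ### Integrals over vertical segments -/

lemma exists_bound_near_line {Φ : ℂ → ℝ} (hΦ : ContinuousOn Φ openStrip) {t : ℝ}
    (ht : |t| < 1 / 10) : ∃ ε > 0, ∃ C : ℝ, ∀ s ∈ Metric.ball t ε, |s| < 1 / 10 ∧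
      ∀ θ ∈ Set.Icc 0 (2 * Real.pi), ‖Φ (s + θ * I)‖ ≤ C := by
  set ε := (1 / 10 - |t|) / 2 with hε
  have hε0 : 0 < ε := by rw [hε]; linarith
  have hs : ∀ s ∈ Set.Icc (t - ε) (t + ε), |s| < 1 / 10 := by
    intro s hs
    have h1 : |s - t| ≤ ε := abs_le.2 ⟨by linarith [hs.1], by linarith [hs.2]⟩
    have h2 : |s| ≤ |s - t| + |t| := by simpa using abs_add_le (s - t) t
    linarith
  have hK : IsCompact (Set.Icc (t - ε) (t + ε) ×ˢ Set.Icc 0 (2 * Real.pi)) :=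
    isCompact_Icc.prod isCompact_Icc
  have hcont : ContinuousOn (fun p : ℝ × ℝ => Φ (p.1 + p.2 * I))
      (Set.Icc (t - ε) (t + ε) ×ˢ Set.Icc 0 (2 * Real.pi)) :=
    hΦ.comp (by fun_prop) fun p hp => add_mul_I_mem (hs p.1 hp.1) p.2
  obtain ⟨C, hC⟩ := hK.exists_bound_of_continuousOn hcont
  refine ⟨ε, hε0, C, fun s hsb => ?_⟩
  have hs' : s ∈ Set.Icc (t - ε) (t + ε) := by
    rw [← Real.closedBall_eq_Icc]
    exact Metric.ball_subset_closedBall hsb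
  exact ⟨hs s hs', fun θ hθ => hC (s, θ) ⟨hs', hθ⟩⟩

lemma continuous_line {Φ : ℂ → ℝ} (hΦ : ContinuousOn Φ openStrip) {t : ℝ} (ht : |t| < 1 / 10) :
    Continuous fun θ : ℝ => Φ (t + θ * I) :=
  hΦ.comp_continuous (by fun_prop) fun θ => add_mul_I_mem ht θ

lemma mem_Icc_of_mem_uIoc {θ : ℝ} (hθ : θ ∈ Set.uIoc 0 (2 * Real.pi)) :
    θ ∈ Set.Icc 0 (2 * Real.pi) := by
  rw [Set.uIoc_of_le (by positivity)] at hθ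
  exact ⟨hθ.1.le, hθ.2⟩

lemma hasDerivAt_integral_line {Φ Φ' : ℂ → ℝ} (hΦ : ContinuousOn Φ openStrip)
    (hΦ' : ContinuousOn Φ' openStrip)
    (hder : ∀ s θ : ℝ, |s| < 1 / 10 →
      HasDerivAt (fun s : ℝ => Φ (s + θ * I)) (Φ' (s + θ * I)) s) {t : ℝ} (ht : |t| < 1 / 10) :
    HasDerivAt (fun t : ℝ => ∫ θ in (0 : ℝ)..(2 * Real.pi), Φ (t + θ * I))
      (∫ θ in (0 : ℝ)..(2 * Real.pi), Φ' (t + θ * I)) t := by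
  obtain ⟨ε, hε, C, hC⟩ := exists_bound_near_line hΦ' ht
  refine (intervalIntegral.hasDerivAt_integral_of_dominated_loc_of_deriv_le
    (F := fun (t : ℝ) (θ : ℝ) => Φ (t + θ * I)) (F' := fun (t : ℝ) (θ : ℝ) => Φ' (t + θ * I))
    (bound := fun _ => C) (Metric.ball_mem_nhds t hε) ?_ ?_ ?_ ?_ ?_ ?_).2
  · filter_upwards [Metric.ball_mem_nhds t hε] with s hs
    exact (continuous_line hΦ (hC s hs).1).aestronglyMeasurable
  · exact (continuous_line hΦ ht).intervalIntegrable _ _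
  · exact (continuous_line hΦ' ht).aestronglyMeasurable
  · exact Eventually.of_forall fun θ hθ s hs => (hC s hs).2 θ (mem_Icc_of_mem_uIoc hθ)
  · exact intervalIntegrable_const
  · exact Eventually.of_forall fun θ _ s hs => hder s θ (hC s hs).1

lemma continuousAt_integral_line {Φ : ℂ → ℝ} (hΦ : ContinuousOn Φ openStrip) {t : ℝ}
    (ht : |t| < 1 / 10) :
    ContinuousAt (fun t : ℝ => ∫ θ in (0 : ℝ)..(2 * Real.pi), Φ (t + θ * I)) t := by
  obtain ⟨ε, hε, C, hC⟩ := exists_bound_near_line hΦ ht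
  have hball := Metric.ball_mem_nhds t hε
  refine intervalIntegral.continuousAt_of_dominated_interval (bound := fun _ => C) ?_ ?_ ?_ ?_
  · filter_upwards [hball] with s hs
    exact (continuous_line hΦ (hC s hs).1).aestronglyMeasurable
  · filter_upwards [hball] with s hs
    exact Eventually.of_forall fun θ hθ => (hC s hs).2 θ (mem_Icc_of_mem_uIoc hθ)
  · exact intervalIntegrable_const
  · refine Eventually.of_forall fun θ _ => ?_
    have h1 : ContinuousAt Φ (t + θ * I) :=
      hΦ.continuousAt (isOpen_openStrip.mem_nhds (add_mul_I_mem ht θ))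
    exact ContinuousAt.comp (f := fun s : ℝ => (s + θ * I : ℂ)) h1 (by fun_prop)

/-! ### The length of the level curves -/

/-- The length of the level curve `|z| = e^t`, in units of `4 c`: the integral of `cosh log |g|`. -/
def normLength (t : ℝ) : ℝ :=
  ∫ θ in (0 : ℝ)..(2 * Real.pi), Real.cosh (logGauss (t + θ * I)).re

/-- The first derivative of `normLength`. -/
def normLength₁ (t : ℝ) : ℝ :=
  ∫ θ in (0 : ℝ)..(2 * Real.pi),
    Real.sinh (logGauss (t + θ * I)).re * (deriv logGauss (t + θ * I)).re

/-- The second derivative of `normLength`, in the form `∫ cosh u |∇u|²` with `u = log |g|`. -/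
def normLength₂ (t : ℝ) : ℝ :=
  ∫ θ in (0 : ℝ)..(2 * Real.pi),
    Real.cosh (logGauss (t + θ * I)).re * ‖deriv logGauss (t + θ * I)‖ ^ 2

lemma differentiableOn_logGauss : DifferentiableOn ℂ logGauss openStrip := fun _ hs =>
  (differentiableAt_logGauss hs).differentiableWithinAt

lemma hasDerivAt_logGauss {τ : ℂ} (hτ : τ ∈ openStrip) :
    HasDerivAt logGauss (deriv logGauss τ) τ := (differentiableAt_logGauss hτ).hasDerivAt

lemma differentiableOn_deriv_logGauss : DifferentiableOn ℂ (deriv logGauss) openStrip :=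
  differentiableOn_logGauss.deriv isOpen_openStrip

lemma hasDerivAt_deriv_logGauss {τ : ℂ} (hτ : τ ∈ openStrip) :
    HasDerivAt (deriv logGauss) (deriv (deriv logGauss) τ) τ :=
  (differentiableOn_deriv_logGauss.differentiableAt (isOpen_openStrip.mem_nhds hτ)).hasDerivAt

lemma continuousOn_deriv_logGauss : ContinuousOn (deriv logGauss) openStrip :=
  differentiableOn_deriv_logGauss.continuousOn

lemma continuousOn_deriv_deriv_logGauss : ContinuousOn (deriv (deriv logGauss)) openStrip :=
  (differentiableOn_deriv_logGauss.deriv isOpen_openStrip).continuousOn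

lemma hasDerivAt_comp_add_right {f : ℂ → ℂ} {f' : ℂ} {s θ : ℝ}
    (h : HasDerivAt f f' (s + θ * I)) : HasDerivAt (fun s : ℝ => f (s + θ * I)) f' s := by
  have h1 : HasDerivAt (fun s : ℝ => (s + θ * I : ℂ)) 1 s := by
    simpa using (Complex.ofRealCLM.hasDerivAt (x := s)).add_const (θ * I : ℂ)
  have h2 := HasDerivAt.scomp (g₁ := f) s h h1
  rwa [one_smul] at h2

lemma hasDerivAt_comp_add_mul_I {f : ℂ → ℂ} {f' : ℂ} {t θ : ℝ}
    (h : HasDerivAt f f' (t + θ * I)) :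
    HasDerivAt (fun θ : ℝ => f (t + θ * I)) (I * f') θ :=
  HasDerivAt.scomp (g₁ := f) θ h (hasDerivAt_add_mul_I t θ)

lemma hasDerivAt_re {f : ℝ → ℂ} {f' : ℂ} {s : ℝ} (h : HasDerivAt f f' s) :
    HasDerivAt (fun s => (f s).re) f'.re s := Complex.reCLM.hasFDerivAt.comp_hasDerivAt s h

lemma hasDerivAt_im {f : ℝ → ℂ} {f' : ℂ} {s : ℝ} (h : HasDerivAt f f' s) :
    HasDerivAt (fun s => (f s).im) f'.im s := Complex.imCLM.hasFDerivAt.comp_hasDerivAt s h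

lemma continuousOn_re_logGauss : ContinuousOn (fun τ => (logGauss τ).re) openStrip :=
  Complex.continuous_re.comp_continuousOn continuousOn_logGauss

lemma hasDerivAt_normLength {t : ℝ} (ht : |t| < 1 / 10) :
    HasDerivAt normLength (normLength₁ t) t := by
  refine hasDerivAt_integral_line (Φ := fun τ => Real.cosh (logGauss τ).re)
    (Φ' := fun τ => Real.sinh (logGauss τ).re * (deriv logGauss τ).re)
    (Real.continuous_cosh.comp_continuousOn continuousOn_re_logGauss)
    ((Real.continuous_sinh.comp_continuousOn continuousOn_re_logGauss).mul
      (Complex.continuous_re.comp_continuousOn continuousOn_deriv_logGauss)) ?_ ht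
  intro s θ hs
  exact (hasDerivAt_re (hasDerivAt_comp_add_right (hasDerivAt_logGauss (add_mul_I_mem hs θ)))).cosh

lemma deriv_logGauss_periodic {τ : ℂ} (hτ : τ ∈ openStrip) :
    deriv logGauss (τ + 2 * Real.pi * I) = deriv logGauss τ := by
  rw [← deriv_comp_add_const]
  refine EventuallyEq.deriv_eq ?_
  filter_upwards [isOpen_openStrip.mem_nhds hτ] with s hs
  simpa using logGauss_add_int (openStrip_le hs) 1

/-- Integration by parts along the level curve turns `∫ (cosh u)_tt` into `∫ cosh u |∇u|²`,
because `u = log |g|` is harmonic. -/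
lemma integral_second_derivative {t : ℝ} (ht : |t| < 1 / 10) :
    ∫ θ in (0 : ℝ)..(2 * Real.pi), (Real.cosh (logGauss (t + θ * I)).re *
      (deriv logGauss (t + θ * I)).re * (deriv logGauss (t + θ * I)).re +
      Real.sinh (logGauss (t + θ * I)).re * (deriv (deriv logGauss) (t + θ * I)).re)
      = normLength₂ t := by
  have hu := continuous_line continuousOn_re_logGauss ht
  have h1re := continuous_line (Complex.continuous_re.comp_continuousOn
    continuousOn_deriv_logGauss) ht
  have h1im := continuous_line (Complex.continuous_im.comp_continuousOn
    continuousOn_deriv_logGauss) ht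
  have h1n := continuous_line (continuous_norm.comp_continuousOn continuousOn_deriv_logGauss) ht
  have h2re := continuous_line (Complex.continuous_re.comp_continuousOn
    continuousOn_deriv_deriv_logGauss) ht
  simp only [Function.comp_apply] at h1re h1im h1n h2re
  have hc := Real.continuous_cosh.comp hu
  have hs := Real.continuous_sinh.comp hu
  simp only [Function.comp_def] at hc hs
  have hder : ∀ θ : ℝ, HasDerivAt
      (fun θ : ℝ => Real.sinh (logGauss (t + θ * I)).re * (deriv logGauss (t + θ * I)).im)
      (Real.cosh (logGauss (t + θ * I)).re * (deriv logGauss (t + θ * I)).re *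
        (deriv logGauss (t + θ * I)).re +
        Real.sinh (logGauss (t + θ * I)).re * (deriv (deriv logGauss) (t + θ * I)).re -
        Real.cosh (logGauss (t + θ * I)).re * ‖deriv logGauss (t + θ * I)‖ ^ 2) θ := by
    intro θ
    have h1 := (hasDerivAt_re (hasDerivAt_comp_add_mul_I
      (hasDerivAt_logGauss (add_mul_I_mem ht θ)))).sinh.mul
      (hasDerivAt_im (hasDerivAt_comp_add_mul_I
      (hasDerivAt_deriv_logGauss (add_mul_I_mem ht θ))))
    convert! h1 using 1
    rw [Complex.I_mul_re, Complex.I_mul_im, Complex.sq_norm, Complex.normSq_apply]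
    ring
  have hint := intervalIntegral.integral_eq_sub_of_hasDerivAt (a := 0) (b := 2 * Real.pi)
    (fun θ _ => hder θ) (Continuous.intervalIntegrable (by fun_prop) _ _)
  have hper1 : ((t : ℂ) + ((2 * Real.pi : ℝ) : ℂ) * I)
      = (t + ((0 : ℝ) : ℂ) * I) + 2 * Real.pi * I := by
    push_cast; ring
  have hper2 : logGauss ((t + ((0 : ℝ) : ℂ) * I) + 2 * Real.pi * I)
      = logGauss (t + ((0 : ℝ) : ℂ) * I) := by
    simpa using logGauss_add_int (abs_re_line_le ht 0) 1
  rw [hper1, hper2, deriv_logGauss_periodic (add_mul_I_mem ht 0), sub_self,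
    intervalIntegral.integral_sub (Continuous.intervalIntegrable (by fun_prop) _ _)
      (Continuous.intervalIntegrable (by fun_prop) _ _)] at hint
  exact sub_eq_zero.1 hint

lemma hasDerivAt_normLength₁ {t : ℝ} (ht : |t| < 1 / 10) :
    HasDerivAt normLength₁ (normLength₂ t) t := by
  rw [← integral_second_derivative ht]
  have hre := Complex.continuous_re.comp_continuousOn continuousOn_deriv_logGauss
  have hsinh := Real.continuous_sinh.comp_continuousOn continuousOn_re_logGauss
  refine hasDerivAt_integral_line
    (Φ := fun τ => Real.sinh (logGauss τ).re * (deriv logGauss τ).re)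
    (Φ' := fun τ => Real.cosh (logGauss τ).re * (deriv logGauss τ).re * (deriv logGauss τ).re +
      Real.sinh (logGauss τ).re * (deriv (deriv logGauss) τ).re)
    (hsinh.mul hre)
    ((((Real.continuous_cosh.comp_continuousOn continuousOn_re_logGauss).mul hre).mul hre).add
      (hsinh.mul (Complex.continuous_re.comp_continuousOn continuousOn_deriv_deriv_logGauss))) ?_ ht
  intro s θ hs
  exact (hasDerivAt_re (hasDerivAt_comp_add_right
    (hasDerivAt_logGauss (add_mul_I_mem hs θ)))).sinh.mul
    (hasDerivAt_re (hasDerivAt_comp_add_right (hasDerivAt_deriv_logGauss (add_mul_I_mem hs θ))))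

lemma continuousAt_normLength₂ {t : ℝ} (ht : |t| < 1 / 10) : ContinuousAt normLength₂ t :=
  continuousAt_integral_line (Φ := fun τ => Real.cosh (logGauss τ).re * ‖deriv logGauss τ‖ ^ 2)
    ((Real.continuous_cosh.comp_continuousOn continuousOn_re_logGauss).mul
      ((continuous_norm.comp_continuousOn continuousOn_deriv_logGauss).pow 2)) ht

/-! ### The central level curve -/

/-- The argument of `w` along the central level curve, as a function of the argument of `z`. -/
def centralArg (θ : ℝ) : ℝ := (logInv (θ * I)).im

lemma logInv_mul_I (θ : ℝ) : logInv (θ * I) = centralArg θ * I := by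
  have h0 : |((θ : ℂ) * I).re| ≤ 1 / 10 := by simp
  have h1 := logInv_conj h0
  have h2 := logInv_neg h0
  have h3 : starRingEnd ℂ ((θ : ℂ) * I) = -(θ * I) := by simp
  rw [h3, h2] at h1
  have h4 := congrArg Complex.re h1
  rw [Complex.neg_re, Complex.conj_re] at h4
  apply Complex.ext
  · simp
    linarith
  · simp [centralArg]

lemma gaussParam_mul_I (θ : ℝ) : gaussParam (θ * I) = (√2 * Real.sin (centralArg θ) : ℝ) * I := by
  rw [gaussParam, logInv_mul_I, Complex.sinh_mul_I]
  push_cast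
  ring

/-- On the central level curve the Gauss map has modulus one. -/
lemma re_logGauss_mul_I (θ : ℝ) : (logGauss (θ * I)).re = 0 := by
  have h := congrArg norm (exp_logGauss (θ * I))
  rw [Complex.norm_exp, norm_div, gaussParam_mul_I] at h
  have h1 : 1 + ((√2 * Real.sin (centralArg θ) : ℝ) : ℂ) * I
      = starRingEnd ℂ (1 - ((√2 * Real.sin (centralArg θ) : ℝ) : ℂ) * I) := by
    rw [map_sub, map_one, map_mul, Complex.conj_ofReal, Complex.conj_I]
    ring
  have h2 := slitPlane_ne_zero (one_sub_gaussParam_mem (θ * I))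
  rw [gaussParam_mul_I] at h2
  rw [h1, Complex.norm_conj, div_self (norm_ne_zero_iff.2 h2)] at h
  exact Real.exp_eq_one_iff _ |>.1 h

lemma deriv_logGauss_eq {τ : ℂ} (hτ : τ ∈ openStrip) :
    deriv logGauss τ
      = -(4 * √2 * cosh (logInv τ)) / ((1 - gaussParam τ) * (1 + gaussParam τ)) ^ 2 := by
  have h1 := slitPlane_ne_zero (one_sub_gaussParam_mem τ)
  have h2 := slitPlane_ne_zero (one_add_gaussParam_mem τ)
  have hm : HasDerivAt gaussParam (√2 * (cosh (logInv τ) *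
      (1 - cosh (2 * logInv τ) / 2)⁻¹)) τ :=
    ((Complex.hasDerivAt_sinh _).comp τ (hasDerivAt_logInv hτ)).const_mul _
  have h3 := ((hm.const_sub 1).clog (one_sub_gaussParam_mem τ)).sub
    ((hm.const_add 1).clog (one_add_gaussParam_mem τ))
  rw [HasDerivAt.deriv (f := logGauss) h3, one_sub_cosh_eq]
  field_simp
  ring

lemma norm_deriv_logGauss_sq (θ : ℝ) :
    ‖deriv logGauss (θ * I)‖ ^ 2
      = 16 * (1 + Real.cos (2 * centralArg θ)) / (2 - Real.cos (2 * centralArg θ)) ^ 4 := by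
  have hτ : (θ * I : ℂ) ∈ openStrip := by simpa using add_mul_I_mem (t := 0) (by norm_num) θ
  have h1 : (1 - gaussParam (θ * I)) * (1 + gaussParam (θ * I))
      = ((2 - Real.cos (2 * centralArg θ) : ℝ) : ℂ) := by
    rw [gaussParam_mul_I, Real.cos_two_mul, Real.cos_sq']
    push_cast
    linear_combination Complex.sin (centralArg θ) ^ 2 * sqrt_two_sq -
      √2 ^ 2 * Complex.sin (centralArg θ) ^ 2 * I_sq
  have h2 : -(4 * √2 * cosh (logInv (θ * I)))
      = ((-(4 * √2 * Real.cos (centralArg θ)) : ℝ) : ℂ) := by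
    rw [logInv_mul_I, Complex.cosh_mul_I]
    push_cast
    ring
  rw [deriv_logGauss_eq hτ, h1, h2, ← Complex.ofReal_pow, ← Complex.ofReal_div, Complex.norm_real,
    Real.norm_eq_abs, sq_abs, div_pow, Real.cos_two_mul]
  have h3 : √2 ^ 2 = 2 := Real.sq_sqrt (by norm_num)
  congr 1
  · linear_combination 16 * Real.cos (centralArg θ) ^ 2 * h3
  · ring

lemma hasDerivAt_centralArg (θ : ℝ) :
    HasDerivAt centralArg (2 / (2 - Real.cos (2 * centralArg θ))) θ := by
  have hτ : ((0 : ℝ) + θ * I : ℂ) ∈ openStrip := add_mul_I_mem (by norm_num) θ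
  have h1 := hasDerivAt_im (hasDerivAt_comp_add_mul_I (hasDerivAt_logInv hτ))
  simp only [Complex.ofReal_zero, zero_add] at h1
  convert! h1 using 1
  have h2 : 1 - cosh (2 * logInv (θ * I)) / 2
      = (((2 - Real.cos (2 * centralArg θ)) / 2 : ℝ) : ℂ) := by
    rw [logInv_mul_I, ← mul_assoc, Complex.cosh_mul_I]
    push_cast
    ring
  rw [h2, ← Complex.ofReal_inv, Complex.I_mul_im, Complex.ofReal_re, inv_div]

lemma centralArg_two_pi : centralArg (2 * Real.pi) = centralArg 0 + 2 * Real.pi := by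
  have h := logInv_add_two_pi (τ := ((0 : ℝ) : ℂ) * I) (by simp)
  have h1 : ((0 : ℝ) : ℂ) * I + 2 * Real.pi * I = ((2 * Real.pi : ℝ) : ℂ) * I := by
    push_cast; ring
  rw [h1] at h
  have := congrArg Complex.im h
  simpa [centralArg] using this

lemma two_sub_cos_pos (ψ : ℝ) : 0 < 2 - Real.cos ψ := by linarith [Real.cos_le_one ψ]

/-- Up to a multiple of `(2 - cos ψ)⁻¹`, the function `(1 + cos ψ) / (2 - cos ψ)³` has a periodic
primitive. -/
lemma hasDerivAt_reduction (ψ : ℝ) :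
    HasDerivAt (fun ψ : ℝ => 2 * (Real.sin ψ / (2 - Real.cos ψ) ^ 2) +
      8 / 3 * (Real.sin ψ / (2 - Real.cos ψ)))
      (4 * (1 + Real.cos ψ) / (2 - Real.cos ψ) ^ 3 - 10 / 3 / (2 - Real.cos ψ)) ψ := by
  have hD := (two_sub_cos_pos ψ).ne'
  have hd : HasDerivAt (fun ψ : ℝ => 2 - Real.cos ψ) (Real.sin ψ) ψ := by
    simpa using (Real.hasDerivAt_cos ψ).const_sub 2
  have h1 := (((Real.hasDerivAt_sin ψ).div (hd.pow 2) (pow_ne_zero 2 hD)).const_mul 2).add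
    (((Real.hasDerivAt_sin ψ).div hd hD).const_mul (8 / 3))
  convert! h1 using 1
  have hs := Real.sin_sq ψ
  simp only [Pi.pow_apply]
  generalize Real.sin ψ = s at hs ⊢
  generalize Real.cos ψ = k at hs hD ⊢
  field_simp
  rw [hs]
  ring

lemma normLength₂_zero_eq : normLength₂ 0 = ∫ θ in (0 : ℝ)..(2 * Real.pi),
    16 * (1 + Real.cos (2 * centralArg θ)) / (2 - Real.cos (2 * centralArg θ)) ^ 4 := by
  unfold normLength₂
  congr 1
  funext θ
  rw [Complex.ofReal_zero, zero_add, re_logGauss_mul_I, Real.cosh_zero, one_mul,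
    norm_deriv_logGauss_sq]

lemma normLength_zero : normLength 0 = 2 * Real.pi := by
  unfold normLength
  have : ∀ θ : ℝ, Real.cosh (logGauss (((0 : ℝ) : ℂ) + θ * I)).re = 1 := fun θ => by
    rw [Complex.ofReal_zero, zero_add, re_logGauss_mul_I, Real.cosh_zero]
  simp only [this]
  simp

lemma continuous_centralArg : Continuous centralArg :=
  continuous_iff_continuousAt.2 fun θ => (hasDerivAt_centralArg θ).continuousAt

lemma continuous_integrand : Continuous fun θ : ℝ =>
    16 * (1 + Real.cos (2 * centralArg θ)) / (2 - Real.cos (2 * centralArg θ)) ^ 4 := by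
  have := continuous_centralArg
  exact Continuous.div (by fun_prop) (by fun_prop) fun θ => pow_ne_zero 4 (two_sub_cos_pos _).ne'

/-- The primitive of `hasDerivAt_reduction` along `ψ = 2 centralArg θ`. By this substitution the
integral in `normLength₂_zero_eq` becomes that of `20 / 3 / (2 - cos ψ)` over one period, which is
`40π / (3√3)`; rational bounds for `1 / (2 - cos ψ)` suffice for the estimate. -/
lemma hasDerivAt_reduction_comp (θ : ℝ) :
    HasDerivAt (fun θ => 2 * (Real.sin (2 * centralArg θ) / (2 - Real.cos (2 * centralArg θ)) ^ 2) +
      8 / 3 * (Real.sin (2 * centralArg θ) / (2 - Real.cos (2 * centralArg θ))))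
      ((4 * (1 + Real.cos (2 * centralArg θ)) / (2 - Real.cos (2 * centralArg θ)) ^ 3 -
        10 / 3 / (2 - Real.cos (2 * centralArg θ))) *
        (2 * (2 / (2 - Real.cos (2 * centralArg θ))))) θ :=
  HasDerivAt.comp (h₂ := fun ψ : ℝ => 2 * (Real.sin ψ / (2 - Real.cos ψ) ^ 2) +
    8 / 3 * (Real.sin ψ / (2 - Real.cos ψ))) θ (hasDerivAt_reduction (2 * centralArg θ))
    ((hasDerivAt_centralArg θ).const_mul 2)

/-- The bound rests on `1 / (2 - k) ≥ 1 / 3` for `k = cos ψ`. -/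
lemma four_pi_lt_normLength₂_zero : 4 * Real.pi < normLength₂ 0 := by
  rw [normLength₂_zero_eq]
  have hder := fun θ => (hasDerivAt_reduction_comp θ).add
    ((hasDerivAt_centralArg θ).const_mul (20 / 9))
  have h := intervalIntegral.sub_le_integral_of_hasDeriv_right_of_le
    (φ := fun θ : ℝ =>
      16 * (1 + Real.cos (2 * centralArg θ)) / (2 - Real.cos (2 * centralArg θ)) ^ 4)
    (a := 0) (b := 2 * Real.pi) (by positivity)
    (fun θ _ => (hder θ).continuousAt.continuousWithinAt)
    (fun θ _ => (hder θ).hasDerivWithinAt) continuous_integrand.integrableOn_Icc fun θ _ => by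
      have hD := two_sub_cos_pos (2 * centralArg θ)
      have hc := Real.neg_one_le_cos (2 * centralArg θ)
      generalize Real.cos (2 * centralArg θ) = k at hD hc ⊢
      rw [← sub_nonneg]
      have : 16 * (1 + k) / (2 - k) ^ 4 - ((4 * (1 + k) / (2 - k) ^ 3 - 10 / 3 / (2 - k)) *
          (2 * (2 / (2 - k))) + 20 / 9 * (2 / (2 - k)))
          = 40 / 9 * (1 + k) / (2 - k) ^ 2 := by
        field_simp
        ring
      rw [this]
      have : 0 ≤ 1 + k := by linarith
      positivity
  refine lt_of_lt_of_le ?_ h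
  simp only [Pi.add_apply]
  rw [centralArg_two_pi, show 2 * (centralArg 0 + 2 * Real.pi)
    = 2 * centralArg 0 + (2 : ℕ) * (2 * Real.pi) by push_cast; ring,
    Real.sin_add_nat_mul_two_pi, Real.cos_add_nat_mul_two_pi]
  linarith [Real.pi_pos]

/-- The bound rests on `1 / (2 - k) ≤ (14 + 5k + 4k² + 4k³) / 27` for `k = cos ψ`, where the
difference is `(1 - k²) (2k - 1)²` divided by `27 (2 - k)`; the mean of the right side is
`16/27 < 3/5`. -/
lemma normLength₂_zero_lt : normLength₂ 0 < 8 * Real.pi := by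
  rw [normLength₂_zero_eq]
  have hψ := fun θ => (hasDerivAt_centralArg θ).const_mul 2
  have hsin := fun θ => (hψ θ).sin
  have hcos := fun θ => (hψ θ).cos
  have hder := fun θ => (hasDerivAt_reduction_comp θ).add (((((hasDerivAt_centralArg θ).const_mul
    (16 / 27)).add ((hsin θ).const_mul (1 / 6))).add
    (((hsin θ).mul (hcos θ)).const_mul (1 / 27))).sub (((hsin θ).pow 3).const_mul (2 / 81))
    |>.const_mul (20 / 3))
  have h := intervalIntegral.integral_le_sub_of_hasDeriv_right_of_le
    (φ := fun θ : ℝ =>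
      16 * (1 + Real.cos (2 * centralArg θ)) / (2 - Real.cos (2 * centralArg θ)) ^ 4)
    (a := 0) (b := 2 * Real.pi) (by positivity)
    (fun θ _ => (hder θ).continuousAt.continuousWithinAt)
    (fun θ _ => (hder θ).hasDerivWithinAt) continuous_integrand.integrableOn_Icc fun θ _ => by
      have hD := two_sub_cos_pos (2 * centralArg θ)
      have hc := Real.neg_one_le_cos (2 * centralArg θ)
      have hc' := Real.cos_le_one (2 * centralArg θ)
      have hs := Real.sin_sq (2 * centralArg θ)
      generalize Real.cos (2 * centralArg θ) = k at hD hc hc' hs ⊢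
      generalize Real.sin (2 * centralArg θ) = s at hs ⊢
      rw [← sub_nonneg]
      have h1 : 0 ≤ 160 / 81 * ((1 + k) * (1 - k)) * (k - 1 / 2) ^ 2 / (2 - k) ^ 2 := by
        have : 0 ≤ (1 + k) * (1 - k) := mul_nonneg (by linarith) (by linarith)
        positivity
      convert! h1 using 1
      norm_num
      field_simp
      rw [hs]
      ring
  refine lt_of_le_of_lt h ?_
  simp only [Pi.add_apply, Pi.sub_apply, Pi.mul_apply, Pi.pow_apply]
  rw [centralArg_two_pi, show 2 * (centralArg 0 + 2 * Real.pi)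
    = 2 * centralArg 0 + (2 : ℕ) * (2 * Real.pi) by push_cast; ring,
    Real.sin_add_nat_mul_two_pi, Real.cos_add_nat_mul_two_pi]
  linarith [Real.pi_pos]

end MinimalAnnuli

namespace MinimalAnnuli

open Complex Filter Topology

/-! ### The estimate of the second derivative of the length -/

/-- The estimate holds strictly at `t = 0`, hence for small `t` by continuity. -/
lemma exists_length_estimate : ∃ t₀ : ℝ, 0 < t₀ ∧ t₀ < 1 / 10 ∧ ∀ t : ℝ, |t| < t₀ →
    2 * normLength t < normLength₂ t ∧ normLength₂ t < 4 * normLength t := by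
  have h0 : |(0 : ℝ)| < 1 / 10 := by norm_num
  have hN : ContinuousAt normLength 0 := (hasDerivAt_normLength h0).continuousAt
  have hN₂ : ContinuousAt normLength₂ 0 := continuousAt_normLength₂ h0
  have h1 : ∀ᶠ t in 𝓝 (0 : ℝ), 2 * normLength t < normLength₂ t :=
    (hN.const_mul 2).eventually_lt hN₂ (by
      rw [normLength_zero]
      linarith [four_pi_lt_normLength₂_zero])
  have h2 : ∀ᶠ t in 𝓝 (0 : ℝ), normLength₂ t < 4 * normLength t :=
    hN₂.eventually_lt (hN.const_mul 4) (by
      rw [normLength_zero]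
      linarith [normLength₂_zero_lt])
  obtain ⟨ε, hε, h⟩ := Metric.eventually_nhds_iff.1 (h1.and h2)
  refine ⟨min ε (1 / 20), by positivity, (min_le_right _ _).trans_lt (by norm_num), fun t ht => ?_⟩
  exact h (by simpa using ht.trans_le (min_le_left _ _))

lemma contDiffAt_two_and_iteratedDeriv {f f₁ f₂ : ℝ → ℝ} {I : Set ℝ} (hI : IsOpen I)
    (h1 : ∀ y ∈ I, HasDerivAt f (f₁ y) y) (h2 : ∀ y ∈ I, HasDerivAt f₁ (f₂ y) y)
    (h3 : ContinuousOn f₂ I) {x : ℝ} (hx : x ∈ I) :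
    ContDiffAt ℝ 2 f x ∧ iteratedDeriv 2 f x = f₂ x := by
  have e1 : Set.EqOn (deriv f) f₁ I := fun y hy => (h1 y hy).deriv
  have e2 : Set.EqOn (deriv f₁) f₂ I := fun y hy => (h2 y hy).deriv
  have c1 : ContDiffOn ℝ 1 f₁ I := by
    rw [show (1 : WithTop ℕ∞) = 0 + 1 from rfl, contDiffOn_succ_iff_deriv_of_isOpen hI]
    refine ⟨fun y hy => (h2 y hy).differentiableAt.differentiableWithinAt, by simp, ?_⟩
    exact contDiffOn_zero.2 (h3.congr e2)
  have c2 : ContDiffOn ℝ 2 f I := by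
    rw [show (2 : WithTop ℕ∞) = 1 + 1 from rfl, contDiffOn_succ_iff_deriv_of_isOpen hI]
    exact ⟨fun y hy => (h1 y hy).differentiableAt.differentiableWithinAt, by simp, c1.congr e1⟩
  refine ⟨c2.contDiffAt (hI.mem_nhds hx), ?_⟩
  rw [iteratedDeriv_succ, iteratedDeriv_one, (e1.eventuallyEq_of_mem (hI.mem_nhds hx)).deriv_eq,
    (h2 x hx).deriv]

/-- The length of the level curve at height `y` is `4 c` times `normLength (y / (4 c))`. -/
lemma length_ann {c t₀ : ℝ} (hc : 0 < c) (ht₀ : t₀ < 1 / 10) {η : ℝ}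
    (hη : η ∈ Set.Ioo (-(4 * c * t₀)) (4 * c * t₀)) :
    circleLength (ann c) (Real.exp (η / (4 * c))) = 4 * c * normLength (η / (4 * c)) ∧
    ContDiffAt ℝ 2 (fun y => circleLength (ann c) (Real.exp (y / (4 * c)))) η ∧
    iteratedDeriv 2 (fun y => circleLength (ann c) (Real.exp (y / (4 * c)))) η
      = normLength₂ (η / (4 * c)) / (4 * c) := by
  have h4 : 0 < 4 * c := by linarith
  have hsmall : ∀ y ∈ Set.Ioo (-(4 * c * t₀)) (4 * c * t₀), |y / (4 * c)| < 1 / 10 := by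
    intro y hy
    refine lt_trans ?_ ht₀
    rw [abs_lt, lt_div_iff₀ h4, div_lt_iff₀ h4]
    constructor <;> linarith [hy.1, hy.2]
  have hlen : ∀ y ∈ Set.Ioo (-(4 * c * t₀)) (4 * c * t₀),
      circleLength (ann c) (Real.exp (y / (4 * c))) = 4 * c * normLength (y / (4 * c)) :=
    fun y hy => circleLength_ann hc (hsmall y hy)
  have hlin : ∀ y : ℝ, HasDerivAt (fun y : ℝ => y / (4 * c)) (1 / (4 * c)) y := fun y =>
    (hasDerivAt_id y).div_const _
  have h1 : ∀ y ∈ Set.Ioo (-(4 * c * t₀)) (4 * c * t₀),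
      HasDerivAt (fun y => circleLength (ann c) (Real.exp (y / (4 * c))))
        (normLength₁ (y / (4 * c))) y := by
    intro y hy
    have h := ((hasDerivAt_normLength (hsmall y hy)).comp y (hlin y)).const_mul (4 * c)
    have he : 4 * c * (normLength₁ (y / (4 * c)) * (1 / (4 * c))) = normLength₁ (y / (4 * c)) := by
      field_simp
    rw [he] at h
    refine h.congr_of_eventuallyEq ?_
    filter_upwards [isOpen_Ioo.mem_nhds hy] with u hu using hlen u hu
  have h2 : ∀ y ∈ Set.Ioo (-(4 * c * t₀)) (4 * c * t₀),
      HasDerivAt (fun y => normLength₁ (y / (4 * c))) (normLength₂ (y / (4 * c)) / (4 * c)) y := by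
    intro y hy
    have h := (hasDerivAt_normLength₁ (hsmall y hy)).comp y (hlin y)
    rwa [mul_one_div] at h
  have h3 : ContinuousOn (fun y => normLength₂ (y / (4 * c)) / (4 * c))
      (Set.Ioo (-(4 * c * t₀)) (4 * c * t₀)) := by
    intro y hy
    refine ContinuousAt.continuousWithinAt (ContinuousAt.div_const ?_ _)
    exact ContinuousAt.comp (f := fun y : ℝ => y / (4 * c))
      (continuousAt_normLength₂ (hsmall y hy)) (hlin y).continuousAt
  exact ⟨hlen η hη, contDiffAt_two_and_iteratedDeriv isOpen_Ioo h1 h2 h3 hη⟩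

end MinimalAnnuli

end

open MinimalAnnuli in
theorem mainTheorem5 :
    ∃ κ : ℝ, 0 < κ ∧ ∀ h F₃ : ℝ, 0 < h → 0 < F₃ → h < κ * F₃ →
      ∃ (R₀ R₁ : ℝ) (X : ℂ → MinimalAnnuli.E3) (r : ℝ → ℝ)
        (a b : Fin 3 → ℂ) (Y : ℂ → MinimalAnnuli.E3) (T : ℂ → ℂ),
        -- `X` is a minimal annulus of winding number zero in the slab `|x₃| < h`,
        -- with flux `(0, 0, F₃)`
        MinimalAnnuli.IsMinimalAnnulus (-h) h R₀ R₁ X ∧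
        MinimalAnnuli.HasWindingNumber R₀ R₁ X 0 ∧
        (∀ ρ ∈ Set.Ioo R₀ R₁, MinimalAnnuli.flux X ρ = !₂[0, 0, F₃]) ∧
        -- the level curve at height `η` is the image of the circle `|z| = r η`; it is a figure eight
        (∀ η ∈ Set.Ioo (-h) h, r η ∈ Set.Ioo R₀ R₁ ∧
          {z ∈ MinimalAnnuli.annulus R₀ R₁ | X z 2 = η} = Metric.sphere 0 (r η) ∧
          MinimalAnnuli.IsFigureEight (MinimalAnnuli.horizontalCurve X (r η))) ∧
        -- the length `ℓ η` of the level curve is twice differentiable and satisfies the estimate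
        (∀ η ∈ Set.Ioo (-h) h,
          ContDiffAt ℝ 2 (fun y => MinimalAnnuli.circleLength X (r y)) η ∧
          2 * (2 * Real.pi / F₃) ^ 2 * MinimalAnnuli.circleLength X (r η)
            < iteratedDeriv 2 (fun y => MinimalAnnuli.circleLength X (r y)) η ∧
          iteratedDeriv 2 (fun y => MinimalAnnuli.circleLength X (r y)) η
            < 4 * (2 * Real.pi / F₃) ^ 2 * MinimalAnnuli.circleLength X (r η)) ∧
        -- the Laurent polynomials `G₋` (coefficients `a`) and `G₊` (coefficients `b`)
        (∀ i, a i ≠ 0) ∧ (∀ i, b i ≠ 0) ∧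
        a 1 ^ 2 + 2 * a 0 * a 2 = 0 ∧ b 1 ^ 2 + 2 * b 0 * b 2 = 0 ∧
        -- the complete minimal surface `Y` on `ℂ \ {0}` built from them
        MinimalAnnuli.IsConformalMinimalImmersion Y {0}ᶜ ∧
        MinimalAnnuli.HasWeierstrassData Y
          (MinimalAnnuli.trinomial a) (MinimalAnnuli.trinomial b) ∧
        MinimalAnnuli.IsCompleteOn Y {0}ᶜ ∧
        MinimalAnnuli.HasTotalCurvature Y {0}ᶜ (-8 * Real.pi) ∧
        MinimalAnnuli.HasEndOfMultiplicity Y (nhdsWithin 0 {0}ᶜ) 2 ∧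
        MinimalAnnuli.HasEndOfMultiplicity Y (Bornology.cobounded ℂ) 2 ∧
        -- the annulus `X` is a part of `Y`, up to a conformal change of parameter
        DifferentiableOn ℂ T (MinimalAnnuli.annulus R₀ R₁) ∧
        Set.InjOn T (MinimalAnnuli.annulus R₀ R₁) ∧
        Set.MapsTo T (MinimalAnnuli.annulus R₀ R₁) {0}ᶜ ∧
        Set.EqOn X (Y ∘ T) (MinimalAnnuli.annulus R₀ R₁) := by
  obtain ⟨t₀, ht₀, ht₀', hest⟩ := exists_length_estimate
  have hpi := Real.pi_pos
  refine ⟨t₀ / (2 * Real.pi), by positivity, fun h F₃ hh hF hhF => ?_⟩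
  -- the surface of scale `c` has flux `8 π c`
  set c : ℝ := F₃ / (8 * Real.pi) with hcdef
  have hc : 0 < c := by positivity
  have hF₃ : F₃ = 8 * Real.pi * c := by rw [hcdef]; field_simp
  -- the slab corresponds to `|log |z|| < t`, since the height is `4 c log |z|`
  set t : ℝ := h / (4 * c) with htdef
  have ht : 0 < t := by positivity
  have hht : h = 4 * c * t := by rw [htdef]; field_simp
  have htt₀ : t < t₀ := by
    rw [htdef, div_lt_iff₀ (by positivity)]
    rw [hF₃] at hhF
    calc h < t₀ / (2 * Real.pi) * (8 * Real.pi * c) := hhF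
      _ = t₀ * (4 * c) := by field_simp; ring
  have ht' : t < 1 / 10 := htt₀.trans ht₀'
  have hlog : ∀ {s : ℝ}, s ∈ Set.Ioo (Real.exp (-t)) (Real.exp t) →
      ∃ u : ℝ, |u| < 1 / 10 ∧ Real.exp u = s := by
    intro s hs
    have hs0 : 0 < s := (Real.exp_pos _).trans hs.1
    refine ⟨Real.log s, lt_trans (abs_lt.2 ⟨?_, ?_⟩) ht', Real.exp_log hs0⟩
    · exact (Real.lt_log_iff_exp_lt hs0).2 hs.1
    · exact (Real.log_lt_iff_lt_exp hs0).2 hs.2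
  have hsq : ((√c : ℝ) : ℂ) ≠ 0 := Complex.ofReal_ne_zero.2 (Real.sqrt_pos.2 hc).ne'
  have hsq2 : ((√2 : ℝ) : ℂ) ≠ 0 := Complex.ofReal_ne_zero.2 (Real.sqrt_pos.2 two_pos).ne'
  rw [hht]
  refine ⟨Real.exp (-t), Real.exp t, ann c, fun η => Real.exp (η / (4 * c)), coeffMinus c,
    coeffPlus c, surf c, reparam, ann_isMinimalAnnulus hc ht ht', ann_hasWindingNumber hc ht',
    fun ρ hρ => ?_, fun η hη => ?_, fun η hη => ?_, fun i => ?_, fun i => ?_, ?_, ?_,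
    surf_minimal hc, surf_hasWeierstrassData hc, surf_isCompleteOn hc, surf_hasTotalCurvature hc,
    surf_hasEnd_zero hc, surf_hasEnd_cobounded hc, fun z hz => ?_, reparam_injOn ht'.le,
    fun z _ => Complex.exp_ne_zero _, fun z _ => rfl⟩
  · obtain ⟨u, hu, rfl⟩ := hlog hρ
    rw [flux_ann hc hu, hF₃]
  · obtain ⟨h1, h2⟩ := level_set_ann hc ht' hη
    refine ⟨h1, h2, ?_⟩
    obtain ⟨u, hu, hu'⟩ := hlog h1
    simp only
    rw [← hu']
    exact ann_isFigureEight hc hu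
  · obtain ⟨h1, h2, h3⟩ := length_ann hc ht' hη
    refine ⟨h2, ?_⟩
    simp only
    have h4 : 0 < 4 * c := by linarith
    have hsmall : |η / (4 * c)| < t₀ := by
      refine lt_trans ?_ htt₀
      rw [abs_lt, lt_div_iff₀ h4, div_lt_iff₀ h4]
      constructor <;> linarith [hη.1, hη.2]
    obtain ⟨h5, h6⟩ := hest _ hsmall
    have h7 : ∀ k : ℝ, k * (2 * Real.pi / F₃) ^ 2 * (4 * c * normLength (η / (4 * c)))
        = k * normLength (η / (4 * c)) / (4 * c) := by
      intro k
      rw [hF₃]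
      field_simp
      ring
    rw [h1, h3, h7, h7]
    exact ⟨div_lt_div_of_pos_right h5 h4, div_lt_div_of_pos_right h6 h4⟩
  · fin_cases i <;> simp [coeffMinus, hsq, hsq2]
  · fin_cases i <;> simp [coeffPlus, hsq, hsq2]
  · simp [coeffMinus]
    linear_combination (√c : ℂ) ^ 2 * sqrt_two_sq
  · simp [coeffPlus]
    linear_combination (√c : ℂ) ^ 2 * sqrt_two_sq
  · obtain ⟨τ, hτ, rfl⟩ := exists_openStrip_exp_eq ht'.le hz
    exact (differentiableAt_reparam hτ).differentiableWithinAt
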